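/- **Conventions.** Let $z$ be a formal parameter, $\mathbb{K}=\mathbb{R}[[z]]$, and let $\hat\otimes$ be the $z$-adically completed tensor product over $\mathbb K$. A three-dimensional real Lie bialgebra is written as $[x^i,x^j]=\sum_k f^{ij}_k x^k$, $\delta(x^n)=\sum_{l,m} c^n_{lm}\,x^l\otimes x^m$ $(i,j,k,l,m,n\in\{0,1,2\})$; its Drinfel'd double $D$ is the six-dimensional Lie algebra with basis $x^i,X_i$ and (summing over repeated indices) $$[x^i,x^j]=f^{ij}_kx^k,\qquad [X_i,X_j]=c^k_{ij}X_k,\qquad [x^i,X_j]=c^i_{jk}x^k-f^{ik}_jX_k ,$$ with cocommutator $\delta_D(x^n)=c^n_{lm}x^l\otimes x^m$, $\delta_D(X_n)=-f^{lm}_nX_l\otimes X_m$. Write $\Delta_0(y)=1\otimes y+y\otimes 1$. Given relations and coproducts on six generators $x^i,X_i$, let $A$ be the $z$-adically complete $\mathbb K$-algebra which they generate with these relations (formal power series in $z$ over the free algebra, modulo the closed two-sided ideal generated by the relations). We say that $A$ is a *Hopf quantization of $D$* if * $A$ is topologically free over $\mathbb K$ ($z$-adically complete, separated and without $z$-torsion);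 * $A/zA\cong U(D)$ as algebras, by a map sending each generator to the generator of the same name; * $A$ has a topological Hopf algebra structure over $\mathbb K$ (coproduct $\Delta:A\to A\hat\otimes A$, counit, antipode) for which $\Delta$ takes the given values on the generators, the counit vanishes on the generators, and for every generator $y$ one has $\Delta(y)=\Delta_0(y)-z\,\delta_D(y)+O(z^2)$. Let $\mathfrak r_3(\rho)$ be the Lie algebra $[x^0,x^1]=x^1$, $[x^0,x^2]=\rho x^2$, $[x^1,x^2]=0$. **Theorem.** For all real $\rho$, and all real $\lambda\neq0$ in (3), the following are Hopf quantizations of the doubles of the indicated Lie bialgebras $(\mathfrak g,\mathfrak g^*)$ with $\mathfrak g=\mathfrak r_3(\rho)$. **(1)** $(\mathfrak r_3(\rho),\mathfrak n_3)$: $[X_1,X_2]=(1+\rho)X_0$, $[X_0,X_1]=[X_0,X_2]=0$ on $\mathfrak g^*$. Coproduct: $x^1,x^2,X_0$ are primitive and $$\Delta(x^0)=\Delta_0(x^0)-z(1+\rho)(x^1\otimes x^2-x^2\otimes x^1),$$ $$\Delta(X_1)=e^{zX_0}\otimes X_1+X_1\otimes e^{-zX_0},\qquad \Delta(X_2)=e^{z\rho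 X_0}\otimes X_2+X_2\otimes e^{-z\rho X_0}.$$ Relations: $[x^0,x^1]=x^1$, $[x^0,x^2]=\rho x^2$, $[x^1,x^2]=0$, $[X_0,X_1]=[X_0,X_2]=0$, $[X_1,X_2]=\frac{\sinh(z(1+\rho)X_0)}{z}$, $[x^i,X_0]=0$ for $i=0,1,2$, $$[x^0,X_1]=(1+\rho)x^2\cosh(zX_0)-X_1,\quad [x^1,X_1]=\tfrac{\sinh(zX_0)}{z},\quad [x^2,X_1]=0,$$ $$[x^0,X_2]=-(1+\rho)x^1\cosh(z\rho X_0)-\rho X_2,\quad [x^1,X_2]=0,\quad [x^2,X_2]=\tfrac{\sinh(z\rho X_0)}{z}.$$ **(2)** $(\mathfrak r_3(\rho),\mathfrak r_3(-\rho))$ (Gomez 6): $[X_0,X_1]=X_0$, $[X_0,X_2]=0$, $[X_1,X_2]=\rho X_2$ on $\mathfrak g^*$. Coproduct: $x^1,X_0$ are primitive and $$\Delta(x^0)=e^{zx^1}\otimes x^0+x^0\otimes e^{-zx^1},\qquad \Delta(x^2)=e^{-z\rho x^1}\otimes x^2+x^2\otimes e^{z\rho x^1},$$ $$\Delta(X_1)=e^{zX_0}\otimes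 X_1+X_1\otimes e^{-zX_0},\qquad \Delta(X_2)=e^{z\rho X_0}\otimes X_2+X_2\otimes e^{-z\rho X_0}.$$ Relations: $[x^0,x^1]=\frac{\sinh(zx^1)}{z}$, $[x^0,x^2]=\rho x^2\cosh(zx^1)$, $[x^1,x^2]=0$, $[X_0,X_1]=\frac{\sinh(zX_0)}{z}$, $[X_0,X_2]=0$, $[X_1,X_2]=\rho X_2\cosh(zX_0)$, $$[x^0,X_0]=\tfrac{\sinh(zx^1)}{z},\quad [x^1,X_0]=0,\quad [x^2,X_0]=0,$$ $$[x^0,X_1]=-\cosh(zX_0)\,x^0-\cosh(zx^1)\,X_1,\quad [x^1,X_1]=\tfrac{\sinh(zX_0)}{z},\quad [x^2,X_1]=\rho x^2\cosh(zX_0),$$ $$[x^0,X_2]=-\rho X_2\cosh(zx^1),\quad [x^1,X_2]=0,\quad [x^2,X_2]=\tfrac{\sinh(z\rho(-x^1+X_0))}{z}.$$ **(3)** $(\mathfrak r_3(\rho),\mathfrak r_3(-\rho))$ (Gomez 7): $[X_0,X_1]=\lambda X_1$, $[X_0,X_2]=-\lambda\rho X_2$, $[X_1,X_2]=0$ on $\mathfrak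 g^*$. Coproduct: $x^0,X_0$ are primitive and $$\Delta(x^1)=e^{-z\lambda x^0}\otimes x^1+x^1\otimes e^{z\lambda x^0},\qquad \Delta(x^2)=e^{z\lambda\rho x^0}\otimes x^2+x^2\otimes e^{-z\lambda\rho x^0},$$ $$\Delta(X_1)=e^{zX_0}\otimes X_1+X_1\otimes e^{-zX_0},\qquad \Delta(X_2)=e^{z\rho X_0}\otimes X_2+X_2\otimes e^{-z\rho X_0}.$$ Relations: $[x^0,x^1]=x^1$, $[x^0,x^2]=\rho x^2$, $[x^1,x^2]=0$, $[X_0,X_1]=\lambda X_1$, $[X_0,X_2]=-\lambda\rho X_2$, $[X_1,X_2]=0$, $$[x^0,X_0]=0,\quad [x^1,X_0]=\lambda x^1,\quad [x^2,X_0]=-\lambda\rho x^2,$$ $$[x^0,X_1]=-X_1,\quad [x^1,X_1]=\tfrac{\sinh(z(-\lambda x^0+X_0))}{z},\quad [x^2,X_1]=0,$$ $$[x^0,X_2]=-\rho X_2,\quad [x^1,X_2]=0,\quad [x^2,X_2]=\tfrac{\sinh(z\rho(\lambda x^0+X_0))}{z}.$$ Moreover, if in addition $\rho\neq0$, the double in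 (3) is isomorphic to $\mathfrak{sl}_2(\mathbb R)\oplus\mathfrak{sl}_2(\mathbb R)$ as a Lie algebra. -/

import Mathlib

open scoped PowerSeries TensorProduct

noncomputable section

namespace QuantumDouble

/-! ## Completed tensor products over `ℝ⟦z⟧` -/

/-- The ground ring `ℝ⟦z⟧` of formal power series in the deformation parameter `z`. -/
abbrev K : Type := ℝ⟦X⟧

/-- The deformation parameter `z`. -/
abbrev z : K := PowerSeries.X

section Completion

/-- Congruence modulo `z ^ n` on an `ℝ⟦z⟧`-algebra. -/
def zCon (S : Type) [Ring S] [Algebra K S] (n : ℕ) : RingCon S where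
  r a b := ∃ c : S, a - b = z ^ n • c
  iseqv :=
    { refl := fun a => ⟨0, by simp⟩
      symm := by
        rintro a b ⟨c, h⟩
        exact ⟨-c, by rw [smul_neg, ← h, neg_sub]⟩
      trans := by
        rintro a b d ⟨c, h⟩ ⟨e, h'⟩
        exact ⟨c + e, by rw [smul_add, ← h, ← h', sub_add_sub_cancel]⟩ }
  add' := by
    rintro a b d e ⟨c, h⟩ ⟨c', h'⟩
    exact ⟨c + c', by rw [smul_add, ← h, ← h', add_sub_add_comm]⟩
  mul' := by
    rintro a b d e ⟨c, h⟩ ⟨c', h'⟩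
    refine ⟨c * d + b * c', ?_⟩
    rw [smul_add, ← smul_mul_assoc, ← mul_smul_comm, ← h, ← h']
    noncomm_ring

/-- The algebra `S / z ^ n S`. -/
abbrev Level (S : Type) [Ring S] [Algebra K S] (n : ℕ) : Type := (zCon S n).Quotient

lemma zpow_smul_level {S : Type} [Ring S] [Algebra K S] (n : ℕ) (u : Level S n) :
    z ^ n • u = 0 := by
  induction u using Quotient.inductionOn' with
  | h a =>
    change ((z ^ n • a : S) : Level S n) = ((0 : S) : Level S n)
    exact (RingCon.eq _).2 ⟨a, by simp⟩

/-- The `z`-adic completion `lim S / z ^ n S` of an `ℝ⟦z⟧`-algebra `S`, as the algebra of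
compatible sequences in `∏ n, S / z ^ n S`. -/
def Completion (S : Type) [Ring S] [Algebra K S] : Subalgebra K (∀ n, Level S n) where
  carrier := {u | ∀ n, ∃ a : S, u n = a ∧ u (n + 1) = a}
  mul_mem' := by
    intro u v hu hv n
    obtain ⟨a, ha, ha'⟩ := hu n
    obtain ⟨b, hb, hb'⟩ := hv n
    exact ⟨a * b, by simp [ha, hb], by simp [ha', hb']⟩
  add_mem' := by
    intro u v hu hv n
    obtain ⟨a, ha, ha'⟩ := hu n
    obtain ⟨b, hb, hb'⟩ := hv n
    exact ⟨a + b, by simp [ha, hb], by simp [ha', hb']⟩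
  algebraMap_mem' := fun r n => ⟨algebraMap K S r, rfl, rfl⟩

variable {S T : Type} [Ring S] [Algebra K S] [Ring T] [Algebra K T]

/-- The canonical map from an algebra to its completion. -/
def Completion.of (S : Type) [Ring S] [Algebra K S] : S →ₐ[K] Completion S where
  toFun a := ⟨fun _ => a, fun _ => ⟨a, rfl, rfl⟩⟩
  map_one' := rfl
  map_mul' _ _ := rfl
  map_zero' := rfl
  map_add' _ _ := rfl
  commutes' _ := rfl

/-- The map `S / z ^ n S → T / z ^ n T` induced by an `ℝ⟦z⟧`-linear map from `S` to the
completion of `T`. -/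
def Completion.extendLevel (f : S →ₗ[K] Completion T) (n : ℕ) : Level S n →ₗ[K] Level T n where
  toFun := Quotient.lift (fun a => (f a).1 n) (by
    rintro a b ⟨c, h⟩
    have h1 : f a - f b = z ^ n • f c := by rw [← map_sub, h, map_smul]
    have h2 : (f a).1 n - (f b).1 n = z ^ n • (f c).1 n :=
      congrArg (fun u : Completion T => u.1 n) h1
    rw [zpow_smul_level] at h2
    exact sub_eq_zero.1 h2)
  map_add' := by
    rintro ⟨a⟩ ⟨b⟩
    exact congrArg (fun u : Completion T => u.1 n) (map_add f a b)
  map_smul' := by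
    rintro r ⟨a⟩
    exact congrArg (fun u : Completion T => u.1 n) (map_smul f r a)

/-- The unique `z`-adically continuous extension to the completion of `S` of an `ℝ⟦z⟧`-linear map
from `S` to the completion of `T`. -/
def Completion.extend (f : S →ₗ[K] Completion T) : Completion S →ₗ[K] Completion T where
  toFun u := ⟨fun n => extendLevel f n (u.1 n), fun n => by
    obtain ⟨a, ha, ha'⟩ := u.2 n
    obtain ⟨b, hb, hb'⟩ := (f a).2 n
    refine ⟨b, ?_, ?_⟩
    · change extendLevel f n (u.1 n) = b
      rw [ha]; exact hb
    · change extendLevel f (n + 1) (u.1 (n + 1)) = b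
      rw [ha']; exact hb'⟩
  map_add' u v := by
    apply Subtype.ext
    funext n
    exact map_add (extendLevel f n) (u.1 n) (v.1 n)
  map_smul' r u := by
    apply Subtype.ext
    funext n
    exact map_smul (extendLevel f n) r (u.1 n)

lemma Completion.extend_of (f : S →ₗ[K] Completion T) (a : S) : extend f (of S a) = f a := rfl

/-- The continuous extension to completions of an `ℝ⟦z⟧`-linear map `S → T`. -/
def Completion.map (f : S →ₗ[K] T) : Completion S →ₗ[K] Completion T :=
  extend ((of T).toLinearMap ∘ₗ f)

end Completion

/-! ## Topological Hopf algebras over `ℝ⟦z⟧` -/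

section Hopf

variable (A : Type) [Ring A] [Algebra K A]

/-- The completed tensor product of `A` with itself, `lim (A ⊗ A) / z ^ n (A ⊗ A)`. -/
abbrev CTensor2 : Type := Completion (A ⊗[K] A)

/-- The completed tensor product of three copies of `A`. -/
abbrev CTensor3 : Type := Completion ((A ⊗[K] A) ⊗[K] A)

variable {A}

/-- `D ⊗ id` on the completed tensor square: it sends `a ⊗ b` to `D a ⊗ b`. -/
def comulTensorId (D : A →ₗ[K] CTensor2 A) : CTensor2 A →ₗ[K] CTensor3 A :=
  Completion.extend (LinearMap.mul' K (CTensor3 A) ∘ₗ TensorProduct.map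
    (Completion.map
      (Algebra.TensorProduct.includeLeft : A ⊗[K] A →ₐ[K] (A ⊗[K] A) ⊗[K] A).toLinearMap ∘ₗ D)
    ((Completion.of _).comp
      (Algebra.TensorProduct.includeRight : A →ₐ[K] (A ⊗[K] A) ⊗[K] A)).toLinearMap)

/-- `id ⊗ D` on the completed tensor square: it sends `a ⊗ b` to `a ⊗ D b`. -/
def idTensorComul (D : A →ₗ[K] CTensor2 A) : CTensor2 A →ₗ[K] CTensor3 A :=
  Completion.extend (LinearMap.mul' K (CTensor3 A) ∘ₗ TensorProduct.map
    ((Completion.of _).comp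
      ((Algebra.TensorProduct.includeLeft : A ⊗[K] A →ₐ[K] (A ⊗[K] A) ⊗[K] A).comp
        (Algebra.TensorProduct.includeLeft : A →ₐ[K] A ⊗[K] A))).toLinearMap
    (Completion.map
      (Algebra.TensorProduct.map (Algebra.TensorProduct.includeRight : A →ₐ[K] A ⊗[K] A)
        (AlgHom.id K A)).toLinearMap ∘ₗ D))

variable (A)

/-- A topological Hopf algebra structure on an `ℝ⟦z⟧`-algebra `A` (meant to be `z`-adically
complete): the coproduct takes values in the completed tensor square, and the Hopf algebra axioms
hold in the completed tensor powers. -/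
structure TopHopfStructure where
  /-- The coproduct, a homomorphism of algebras. -/
  comul : A →ₐ[K] CTensor2 A
  /-- The counit, a homomorphism of algebras. -/
  counit : A →ₐ[K] K
  /-- The antipode. -/
  antipode : A →ₗ[K] A
  coassoc : ∀ a : A, comulTensorId comul.toLinearMap (comul a) =
    idTensorComul comul.toLinearMap (comul a)
  counit_left : ∀ a : A, Completion.map
    ((TensorProduct.lid K A).toLinearMap ∘ₗ counit.toLinearMap.rTensor A) (comul a) =
      Completion.of A a
  counit_right : ∀ a : A, Completion.map
    ((TensorProduct.rid K A).toLinearMap ∘ₗ counit.toLinearMap.lTensor A) (comul a) =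
      Completion.of A a
  antipode_left : ∀ a : A, Completion.map
    (LinearMap.mul' K A ∘ₗ antipode.rTensor A) (comul a) =
      Completion.of A (algebraMap K A (counit a))
  antipode_right : ∀ a : A, Completion.map
    (LinearMap.mul' K A ∘ₗ antipode.lTensor A) (comul a) =
      Completion.of A (algebraMap K A (counit a))

/-- An `ℝ⟦z⟧`-module is topologically free if it is `z`-adically complete (and separated) and has
no `z`-torsion, that is, if it is isomorphic to `V⟦z⟧` for a real vector space `V`. -/
structure TopFree (M : Type) [AddCommGroup M] [Module K M] : Prop where
  complete : IsAdicComplete (Ideal.span {z}) M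
  torsionFree : ∀ a : M, z • a = 0 → a = 0

end Hopf

/-! ## Three-dimensional Lie bialgebras and their Drinfel'd doubles -/

/-- The bracket on `𝔤 ⊕ 𝔤*` determined by tensors `f`, `c`:
`[x^i, x^j] = f^{ij}_k x^k`, `[X_i, X_j] = c^k_{ij} X_k`,
`[x^i, X_j] = c^i_{jk} x^k - f^{ik}_j X_k`.
Here `f i j k` is `f^{ij}_k`, and `c i j k` is `c^k_{ij}`; a vector is the pair of its coordinate
vectors with respect to the `x^i` and the `X_i`. -/
def doubleBracket (f c : Fin 3 → Fin 3 → Fin 3 → ℝ) (u v : (Fin 3 → ℝ) × (Fin 3 → ℝ)) :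
    (Fin 3 → ℝ) × (Fin 3 → ℝ) :=
  (fun k => ∑ i, ∑ j, (u.1 i * v.1 j * f i j k + (u.1 i * v.2 j - v.1 i * u.2 j) * c j k i),
   fun k => ∑ i, ∑ j, (u.2 i * v.2 j * c i j k - (u.1 i * v.2 j - v.1 i * u.2 j) * f i k j))

lemma doubleBracket_add_left (f c : Fin 3 → Fin 3 → Fin 3 → ℝ)
    (u v w : (Fin 3 → ℝ) × (Fin 3 → ℝ)) :
    doubleBracket f c (u + v) w = doubleBracket f c u w + doubleBracket f c v w := by
  apply Prod.ext <;> funext k <;>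
    simp only [doubleBracket, Prod.fst_add, Prod.snd_add, Pi.add_apply,
      ← Finset.sum_add_distrib] <;>
    refine Finset.sum_congr rfl fun i _ => Finset.sum_congr rfl fun j _ => ?_ <;> ring

lemma doubleBracket_add_right (f c : Fin 3 → Fin 3 → Fin 3 → ℝ)
    (u v w : (Fin 3 → ℝ) × (Fin 3 → ℝ)) :
    doubleBracket f c u (v + w) = doubleBracket f c u v + doubleBracket f c u w := by
  apply Prod.ext <;> funext k <;>
    simp only [doubleBracket, Prod.fst_add, Prod.snd_add, Pi.add_apply,
      ← Finset.sum_add_distrib] <;>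
    refine Finset.sum_congr rfl fun i _ => Finset.sum_congr rfl fun j _ => ?_ <;> ring

lemma doubleBracket_smul_right (f c : Fin 3 → Fin 3 → Fin 3 → ℝ) (t : ℝ)
    (u v : (Fin 3 → ℝ) × (Fin 3 → ℝ)) :
    doubleBracket f c u (t • v) = t • doubleBracket f c u v := by
  apply Prod.ext <;> funext k <;>
    simp only [doubleBracket, Prod.smul_fst, Prod.smul_snd, Pi.smul_apply, smul_eq_mul,
      Finset.mul_sum] <;>
    refine Finset.sum_congr rfl fun i _ => Finset.sum_congr rfl fun j _ => ?_ <;> ring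

/-- A three-dimensional real Lie bialgebra `(𝔤, δ)` in coordinates, `[x^i, x^j] = f^{ij}_k x^k`
and `δ(x^n) = c^n_{lm} x^l ⊗ x^m`. The Jacobi identity of the double bracket is equivalent to
the conjunction of the Jacobi identities for `f` and for `c` and the cocycle condition. -/
structure LieBialgebra where
  /-- Structure constants of the bracket of `𝔤`: `f i j k = f^{ij}_k`. -/
  f : Fin 3 → Fin 3 → Fin 3 → ℝ
  /-- Structure constants of the cocommutator: `c l m n = c^n_{lm}`. -/
  c : Fin 3 → Fin 3 → Fin 3 → ℝ
  f_skew : ∀ i j k, f i j k = -f j i k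
  c_skew : ∀ i j k, c i j k = -c j i k
  jacobi : ∀ u v w, doubleBracket f c u (doubleBracket f c v w) =
    doubleBracket f c (doubleBracket f c u v) w + doubleBracket f c v (doubleBracket f c u w)

/-- The Drinfel'd double `D(𝔤) = 𝔤 ⊕ 𝔤*`. -/
def LieBialgebra.Double (_B : LieBialgebra) : Type := (Fin 3 → ℝ) × (Fin 3 → ℝ)

namespace LieBialgebra

variable (B : LieBialgebra)

instance : AddCommGroup B.Double := inferInstanceAs (AddCommGroup ((Fin 3 → ℝ) × (Fin 3 → ℝ)))

instance : Module ℝ B.Double := inferInstanceAs (Module ℝ ((Fin 3 → ℝ) × (Fin 3 → ℝ)))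

instance : LieRing B.Double where
  bracket u v := doubleBracket B.f B.c u v
  add_lie := doubleBracket_add_left B.f B.c
  lie_add := doubleBracket_add_right B.f B.c
  lie_self u := by
    have hf := B.f_skew
    have hc := B.c_skew
    apply Prod.ext <;> funext k
    · change ∑ i, ∑ j, (u.1 i * u.1 j * B.f i j k +
        (u.1 i * u.2 j - u.1 i * u.2 j) * B.c j k i) = 0
      have h : ∑ i, ∑ j, u.1 i * u.1 j * B.f i j k = -∑ i, ∑ j, u.1 i * u.1 j * B.f i j k := by
        conv_lhs => rw [Finset.sum_comm]
        simp only [← Finset.sum_neg_distrib]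
        refine Finset.sum_congr rfl fun i _ => Finset.sum_congr rfl fun j _ => ?_
        rw [hf j i k]; ring
      simp only [sub_self, zero_mul, add_zero]
      linarith
    · change ∑ i, ∑ j, (u.2 i * u.2 j * B.c i j k -
        (u.1 i * u.2 j - u.1 i * u.2 j) * B.f i k j) = 0
      have h : ∑ i, ∑ j, u.2 i * u.2 j * B.c i j k = -∑ i, ∑ j, u.2 i * u.2 j * B.c i j k := by
        conv_lhs => rw [Finset.sum_comm]
        simp only [← Finset.sum_neg_distrib]
        refine Finset.sum_congr rfl fun i _ => Finset.sum_congr rfl fun j _ => ?_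
        rw [hc j i k]; ring
      simp only [sub_self, zero_mul, sub_zero]
      linarith
  leibniz_lie u v w := B.jacobi u v w

instance : LieAlgebra ℝ B.Double where
  lie_smul := doubleBracket_smul_right B.f B.c

end LieBialgebra

/-- Labels of the six generators: `Sum.inl i` for `x^i` and `Sum.inr i` for `X_i`. -/
abbrev Gen : Type := Fin 3 ⊕ Fin 3

namespace LieBialgebra

variable (B : LieBialgebra)

/-- The basis `x^0, x^1, x^2, X_0, X_1, X_2` of the double. -/
def gen : Gen → B.Double
  | Sum.inl i => (Pi.single i 1, 0)
  | Sum.inr i => (0, Pi.single i 1)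

/-- The coefficients of the cocommutator of the double in this basis: `δ(g)` is the sum of
`cocomm g l m • l ⊗ m`, where `δ(x^n) = c^n_{lm} x^l ⊗ x^m` and
`δ(X_n) = -f^{lm}_n X_l ⊗ X_m`. -/
def cocomm : Gen → Gen → Gen → ℝ
  | Sum.inl n, Sum.inl l, Sum.inl m => B.c l m n
  | Sum.inr n, Sum.inr l, Sum.inr m => -B.f l m n
  | _, _, _ => 0

end LieBialgebra

/-! ## Algebras given by generators and relations -/

/-- The free real algebra on the six generators. -/
abbrev Free : Type := FreeAlgebra ℝ Gen

/-- Formal power series in the central variable `z` with coefficients in the free algebra: the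
`z`-adically complete free `ℝ⟦z⟧`-algebra on the six generators. -/
abbrev FreeZ : Type := PowerSeries Free

instance : Algebra K FreeZ :=
  RingHom.toAlgebra' (PowerSeries.map (algebraMap ℝ Free)) fun r a => by
    ext n
    rw [PowerSeries.coeff_mul, PowerSeries.coeff_mul, ← Finset.Nat.sum_antidiagonal_swap]
    refine Finset.sum_congr rfl fun p _ => ?_
    simp only [PowerSeries.coeff_map, Prod.fst_swap, Prod.snd_swap]
    exact Algebra.commutes _ _

/-- The series `exp (z a)`. -/
def expZ (a : Free) : FreeZ := PowerSeries.mk fun n => ((n.factorial : ℝ)⁻¹) • a ^ n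

/-- The series `cosh (z a)`. -/
def coshZ (a : Free) : FreeZ :=
  PowerSeries.mk fun n => if Even n then ((n.factorial : ℝ)⁻¹) • a ^ n else 0

/-- The series `sinh (z a) / z`, whose coefficient at `z ^ n` is `a ^ (n + 1) / (n + 1)!` for even
`n`, and zero for odd `n`. -/
def sinhDivZ (a : Free) : FreeZ :=
  PowerSeries.mk fun n => if Even n then (((n + 1).factorial : ℝ)⁻¹) • a ^ (n + 1) else 0

/-- The commutator. -/
def comm (a b : FreeZ) : FreeZ := a * b - b * a

/-- The generator `x^i` of the free algebra. -/
def x (i : Fin 3) : Free := FreeAlgebra.ι ℝ (Sum.inl i)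

/-- The generator `X_i` of the free algebra. -/
def X (i : Fin 3) : Free := FreeAlgebra.ι ℝ (Sum.inr i)

/-- The generator `x^i` as a constant power series. -/
def xz (i : Fin 3) : FreeZ := PowerSeries.C (x i)

/-- The generator `X_i` as a constant power series. -/
def Xz (i : Fin 3) : FreeZ := PowerSeries.C (X i)

/-- Data presenting a quantum algebra: the relations between the six generators, and the values of
the coproduct on the generators. -/
structure QuantumData where
  /-- The elements that are set equal to zero. -/
  rels : Set FreeZ
  /-- The coproducts of the generators. -/
  coprod : Gen → FreeZ ⊗[K] FreeZ

namespace QuantumData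

variable (P : QuantumData)

/-- The `z`-adic closure `⋂ n, (J + z ^ n FreeZ)` of the two-sided ideal `J` generated by the
relations. -/
def relIdeal : TwoSidedIdeal FreeZ :=
  ⨅ n : ℕ, TwoSidedIdeal.span (P.rels ∪ {(PowerSeries.X : FreeZ) ^ n})

/-- The `z`-adically complete `ℝ⟦z⟧`-algebra defined by the generators and the relations. -/
def Alg : Type := P.relIdeal.ringCon.Quotient

instance : Ring P.Alg := inferInstanceAs (Ring P.relIdeal.ringCon.Quotient)

instance : Algebra K P.Alg := inferInstanceAs (Algebra K P.relIdeal.ringCon.Quotient)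

/-- The quotient map from the free algebra. -/
def proj : FreeZ →ₐ[K] P.Alg := RingCon.mkₐ K P.relIdeal.ringCon

/-- The generators of the quantum algebra. -/
def gen (g : Gen) : P.Alg := P.proj (PowerSeries.C (FreeAlgebra.ι ℝ g))

end QuantumData

/-- The quantum algebra given by the data `P` is a Hopf algebra quantization of the Drinfel'd
double of the Lie bialgebra `B`: it is a topologically free `ℝ⟦z⟧`-algebra, its reduction modulo
`z` is the universal enveloping algebra of the double (with generators going to generators), and it
carries a topological Hopf algebra structure with the prescribed coproduct, whose coproduct agrees
with the primitive one modulo `z` and whose first-order term is the cocommutator `δ` of the double,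
in the sign convention `Δ = Δ₀ - z δ + O(z²)` (replace `z` by `-z` for the opposite one). -/
structure IsHopfQuantization (B : LieBialgebra) (P : QuantumData) : Prop where
  topFree : TopFree P.Alg
  classicalLimit : ∃ π : P.Alg →+* UniversalEnvelopingAlgebra ℝ B.Double,
    (∀ (r : K) (a : P.Alg), π (r • a) = PowerSeries.constantCoeff r • π a) ∧
    Function.Surjective π ∧
    (∀ a : P.Alg, π a = 0 ↔ ∃ b : P.Alg, a = z • b) ∧
    ∀ g : Gen, π (P.gen g) = UniversalEnvelopingAlgebra.ι ℝ (B.gen g)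
  hopf : ∃ H : TopHopfStructure P.Alg,
    (∀ g : Gen, H.comul (P.gen g) =
      Completion.of _ (Algebra.TensorProduct.map P.proj P.proj (P.coprod g))) ∧
    (∀ g : Gen, H.counit (P.gen g) = 0) ∧
    ∀ g : Gen, ∃ b : CTensor2 P.Alg, H.comul (P.gen g) =
      Completion.of _ (1 ⊗ₜ[K] P.gen g + P.gen g ⊗ₜ[K] 1 -
        z • ∑ l : Gen, ∑ m : Gen,
          (PowerSeries.C (B.cocomm g l m) : K) • (P.gen l ⊗ₜ[K] P.gen m)) + z ^ 2 • b

/-! ## The three doubles with `𝔤 = 𝔯₃(ρ)` -/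

/-- Skew-symmetric structure constants on a three-dimensional space with given values of
`[e₀, e₁]`, `[e₀, e₂]`, `[e₁, e₂]`. -/
def skewConst (b₀₁ b₀₂ b₁₂ : Fin 3 → ℝ) : Fin 3 → Fin 3 → Fin 3 → ℝ :=
  ![![0, b₀₁, b₀₂], ![-b₀₁, 0, b₁₂], ![-b₀₂, -b₁₂, 0]]

lemma skewConst_skew (b₀₁ b₀₂ b₁₂ : Fin 3 → ℝ) (i j k : Fin 3) :
    skewConst b₀₁ b₀₂ b₁₂ i j k = -skewConst b₀₁ b₀₂ b₁₂ j i k := by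
  fin_cases i <;> fin_cases j <;> simp [skewConst]

/-- The Lie algebra `𝔯₃(ρ)`: `[x^0, x^1] = x^1`, `[x^0, x^2] = ρ x^2`, `[x^1, x^2] = 0`. -/
def r3 (ρ : ℝ) : Fin 3 → Fin 3 → Fin 3 → ℝ := skewConst ![0, 1, 0] ![0, 0, ρ] 0

lemma doubleBracket_A (ρ : ℝ) (u v : (Fin 3 → ℝ) × (Fin 3 → ℝ)) :
    doubleBracket (r3 ρ) (skewConst 0 0 ![1 + ρ, 0, 0]) u v =
      (![0,
        (u.1 0 * v.1 1 - u.1 1 * v.1 0) - (1 + ρ) * (u.1 0 * v.2 2 - v.1 0 * u.2 2),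
        ρ * (u.1 0 * v.1 2 - u.1 2 * v.1 0) + (1 + ρ) * (u.1 0 * v.2 1 - v.1 0 * u.2 1)],
       ![(1 + ρ) * (u.2 1 * v.2 2 - u.2 2 * v.2 1) + (u.1 1 * v.2 1 - v.1 1 * u.2 1) + ρ * (u.1 2 * v.2 2 - v.1 2 * u.2 2),
        -(u.1 0 * v.2 1 - v.1 0 * u.2 1),
        -(ρ * (u.1 0 * v.2 2 - v.1 0 * u.2 2))]) := by
  apply Prod.ext <;> funext k <;> fin_cases k <;>
    simp [doubleBracket, r3, skewConst, Fin.sum_univ_three] <;> ring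

/-- The Lie bialgebra `(𝔯₃(ρ), 𝔫₃)`, with `[X_1, X_2] = (1 + ρ) X_0` on the dual. -/
def bialgA (ρ : ℝ) : LieBialgebra where
  f := r3 ρ
  c := skewConst 0 0 ![1 + ρ, 0, 0]
  f_skew := skewConst_skew _ _ _
  c_skew := skewConst_skew _ _ _
  jacobi u v w := by
    simp only [doubleBracket_A]
    apply Prod.ext <;> funext k <;> fin_cases k <;> simp <;> ring

lemma doubleBracket_B (ρ : ℝ) (u v : (Fin 3 → ℝ) × (Fin 3 → ℝ)) :
    doubleBracket (r3 ρ) (skewConst ![1, 0, 0] 0 ![0, 0, ρ]) u v =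
      (![-(u.1 0 * v.2 1 - v.1 0 * u.2 1),
        (u.1 0 * v.1 1 - u.1 1 * v.1 0) + (u.1 0 * v.2 0 - v.1 0 * u.2 0) - ρ * (u.1 2 * v.2 2 - v.1 2 * u.2 2),
        ρ * (u.1 0 * v.1 2 - u.1 2 * v.1 0) + ρ * (u.1 2 * v.2 1 - v.1 2 * u.2 1)],
       ![(u.2 0 * v.2 1 - u.2 1 * v.2 0) + (u.1 1 * v.2 1 - v.1 1 * u.2 1) + ρ * (u.1 2 * v.2 2 - v.1 2 * u.2 2),
        -(u.1 0 * v.2 1 - v.1 0 * u.2 1),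
        ρ * (u.2 1 * v.2 2 - u.2 2 * v.2 1) - ρ * (u.1 0 * v.2 2 - v.1 0 * u.2 2)]) := by
  apply Prod.ext <;> funext k <;> fin_cases k <;>
    simp [doubleBracket, r3, skewConst, Fin.sum_univ_three] <;> ring

/-- The first Lie bialgebra `(𝔯₃(ρ), 𝔯₃(-ρ))`, with `[X_0, X_1] = X_0` and `[X_1, X_2] = ρ X_2`
on the dual. -/
def bialgB (ρ : ℝ) : LieBialgebra where
  f := r3 ρ
  c := skewConst ![1, 0, 0] 0 ![0, 0, ρ]
  f_skew := skewConst_skew _ _ _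
  c_skew := skewConst_skew _ _ _
  jacobi u v w := by
    simp only [doubleBracket_B]
    apply Prod.ext <;> funext k <;> fin_cases k <;> simp <;> ring

lemma doubleBracket_C (ρ l : ℝ) (u v : (Fin 3 → ℝ) × (Fin 3 → ℝ)) :
    doubleBracket (r3 ρ) (skewConst ![0, l, 0] ![0, 0, -(l * ρ)] 0) u v =
      (![-(l * (u.1 1 * v.2 1 - v.1 1 * u.2 1)) + l * ρ * (u.1 2 * v.2 2 - v.1 2 * u.2 2),
        (u.1 0 * v.1 1 - u.1 1 * v.1 0) + l * (u.1 1 * v.2 0 - v.1 1 * u.2 0),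
        ρ * (u.1 0 * v.1 2 - u.1 2 * v.1 0) - l * ρ * (u.1 2 * v.2 0 - v.1 2 * u.2 0)],
       ![(u.1 1 * v.2 1 - v.1 1 * u.2 1) + ρ * (u.1 2 * v.2 2 - v.1 2 * u.2 2),
        l * (u.2 0 * v.2 1 - u.2 1 * v.2 0) - (u.1 0 * v.2 1 - v.1 0 * u.2 1),
        -(l * ρ * (u.2 0 * v.2 2 - u.2 2 * v.2 0)) - ρ * (u.1 0 * v.2 2 - v.1 0 * u.2 2)]) := by
  apply Prod.ext <;> funext k <;> fin_cases k <;>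
    simp [doubleBracket, r3, skewConst, Fin.sum_univ_three] <;> ring

/-- The second Lie bialgebra `(𝔯₃(ρ), 𝔯₃(-ρ))`, with `[X_0, X_1] = l X_1` and
`[X_0, X_2] = -l ρ X_2` on the dual. -/
def bialgC (ρ l : ℝ) : LieBialgebra where
  f := r3 ρ
  c := skewConst ![0, l, 0] ![0, 0, -(l * ρ)] 0
  f_skew := skewConst_skew _ _ _
  c_skew := skewConst_skew _ _ _
  jacobi u v w := by
    simp only [doubleBracket_C]
    apply Prod.ext <;> funext k <;> fin_cases k <;> simp <;> ring

/-- The quantum algebra for `(𝔯₃(ρ), 𝔫₃)`. -/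
def quantumA (ρ : ℝ) : QuantumData where
  rels :=
    { -- subalgebras
      comm (xz 0) (xz 1) - xz 1,
      comm (xz 0) (xz 2) - ρ • xz 2,
      comm (xz 1) (xz 2),
      comm (Xz 0) (Xz 1),
      comm (Xz 0) (Xz 2),
      comm (Xz 1) (Xz 2) - sinhDivZ ((1 + ρ) • X 0),
      -- crossed relations
      comm (xz 0) (Xz 0),
      comm (xz 1) (Xz 0),
      comm (xz 2) (Xz 0),
      comm (xz 0) (Xz 1) - ((1 + ρ) • (xz 2 * coshZ (X 0)) - Xz 1),
      comm (xz 1) (Xz 1) - sinhDivZ (X 0),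
      comm (xz 2) (Xz 1),
      comm (xz 0) (Xz 2) - (-((1 + ρ) • (xz 1 * coshZ (ρ • X 0))) - ρ • Xz 2),
      comm (xz 1) (Xz 2),
      comm (xz 2) (Xz 2) - sinhDivZ (ρ • X 0) }
  coprod := Sum.elim
    ![1 ⊗ₜ xz 0 + xz 0 ⊗ₜ 1 -
        (z * PowerSeries.C (1 + ρ)) • (xz 1 ⊗ₜ xz 2 - xz 2 ⊗ₜ xz 1),
      1 ⊗ₜ xz 1 + xz 1 ⊗ₜ 1,
      1 ⊗ₜ xz 2 + xz 2 ⊗ₜ 1]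
    ![1 ⊗ₜ Xz 0 + Xz 0 ⊗ₜ 1,
      expZ (X 0) ⊗ₜ Xz 1 + Xz 1 ⊗ₜ expZ (-X 0),
      expZ (ρ • X 0) ⊗ₜ Xz 2 + Xz 2 ⊗ₜ expZ (-(ρ • X 0))]

/-- The quantum algebra for the first `(𝔯₃(ρ), 𝔯₃(-ρ))`. -/
def quantumB (ρ : ℝ) : QuantumData where
  rels :=
    { -- subalgebras
      comm (xz 0) (xz 1) - sinhDivZ (x 1),
      comm (xz 0) (xz 2) - ρ • (xz 2 * coshZ (x 1)),
      comm (xz 1) (xz 2),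
      comm (Xz 0) (Xz 1) - sinhDivZ (X 0),
      comm (Xz 0) (Xz 2),
      comm (Xz 1) (Xz 2) - ρ • (Xz 2 * coshZ (X 0)),
      -- crossed relations
      comm (xz 0) (Xz 0) - sinhDivZ (x 1),
      comm (xz 1) (Xz 0),
      comm (xz 2) (Xz 0),
      comm (xz 0) (Xz 1) - (-(coshZ (X 0) * xz 0) - coshZ (x 1) * Xz 1),
      comm (xz 1) (Xz 1) - sinhDivZ (X 0),
      comm (xz 2) (Xz 1) - ρ • (xz 2 * coshZ (X 0)),
      comm (xz 0) (Xz 2) - (-(ρ • (Xz 2 * coshZ (x 1)))),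
      comm (xz 1) (Xz 2),
      comm (xz 2) (Xz 2) - sinhDivZ (ρ • (-x 1 + X 0)) }
  coprod := Sum.elim
    ![expZ (x 1) ⊗ₜ xz 0 + xz 0 ⊗ₜ expZ (-x 1),
      1 ⊗ₜ xz 1 + xz 1 ⊗ₜ 1,
      expZ (-(ρ • x 1)) ⊗ₜ xz 2 + xz 2 ⊗ₜ expZ (ρ • x 1)]
    ![1 ⊗ₜ Xz 0 + Xz 0 ⊗ₜ 1,
      expZ (X 0) ⊗ₜ Xz 1 + Xz 1 ⊗ₜ expZ (-X 0),
      expZ (ρ • X 0) ⊗ₜ Xz 2 + Xz 2 ⊗ₜ expZ (-(ρ • X 0))]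

/-- The quantum algebra for the second `(𝔯₃(ρ), 𝔯₃(-ρ))`. -/
def quantumC (ρ l : ℝ) : QuantumData where
  rels :=
    { -- subalgebras
      comm (xz 0) (xz 1) - xz 1,
      comm (xz 0) (xz 2) - ρ • xz 2,
      comm (xz 1) (xz 2),
      comm (Xz 0) (Xz 1) - l • Xz 1,
      comm (Xz 0) (Xz 2) - (-((l * ρ) • Xz 2)),
      comm (Xz 1) (Xz 2),
      -- crossed relations
      comm (xz 0) (Xz 0),
      comm (xz 1) (Xz 0) - l • xz 1,
      comm (xz 2) (Xz 0) - (-((l * ρ) • xz 2)),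
      comm (xz 0) (Xz 1) - (-Xz 1),
      comm (xz 1) (Xz 1) - sinhDivZ (-(l • x 0) + X 0),
      comm (xz 2) (Xz 1),
      comm (xz 0) (Xz 2) - (-(ρ • Xz 2)),
      comm (xz 1) (Xz 2),
      comm (xz 2) (Xz 2) - sinhDivZ (ρ • (l • x 0 + X 0)) }
  coprod := Sum.elim
    ![1 ⊗ₜ xz 0 + xz 0 ⊗ₜ 1,
      expZ (-(l • x 0)) ⊗ₜ xz 1 + xz 1 ⊗ₜ expZ (l • x 0),
      expZ ((l * ρ) • x 0) ⊗ₜ xz 2 + xz 2 ⊗ₜ expZ (-((l * ρ) • x 0))]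
    ![1 ⊗ₜ Xz 0 + Xz 0 ⊗ₜ 1,
      expZ (X 0) ⊗ₜ Xz 1 + Xz 1 ⊗ₜ expZ (-X 0),
      expZ (ρ • X 0) ⊗ₜ Xz 2 + Xz 2 ⊗ₜ expZ (-(ρ • X 0))]

end QuantumDouble

end

open scoped PowerSeries TensorProduct

noncomputable section

set_option linter.unusedSimpArgs false

namespace QuantumDouble

/-! The delicate assertion is that the presented algebra A has no z-torsion and that A/zA is all of
U(D): relations containing power series could well make A collapse. Both facts follow, without any
Poincaré–Birkhoff–Witt basis of A, from a deforming map, that is, an algebra homomorphism φ : A →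
U(D)⟦z⟧ which is the identity on generators modulo z. Setting z = 0 in φ gives π : A → U(D). Modulo
z the relations of A are those of D, so there is a map U(D) → A/zA in the other direction, and ker π
= zA (`classicalMap_properties`). If z a = 0, then φ(a) = 0 because U(D)⟦z⟧ has no torsion; hence
π(a) = 0, so a = z b, and again φ(b) = 0. Repeating this, a is divisible by all powers of z and
vanishes, A being separated (`zTorsionFree_of_deformingMap`). Completeness is built into A, since
the relation ideal is closed.

To find φ is to solve the quantum relations inside U(D)⟦z⟧. In (1), X_0 is central; X_1 and X_2 are
rescaled by values of sinh t / t and corrected by multiples of x^2 and x^1 (`LieRelA.deform`). In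
(3), D is made of two commuting triples of 𝔰𝔩₂ type, and each is deformed by a divided difference of
cosh involving its Casimir element (`mul_quantE`, `LieRelC.deform`). In (2), x^1 - X_0 is central;
the images of x^0 and X_1 are found first (`BorelRel.borelY_mul_borelW`), and then x^2 and X_2 are
multiplied by (sinh t / t)^ρ and its inverse, a power defined by a linear differential equation
(`LieRelB.deform`).

For the Hopf structure, coproduct, counit and antipode (a homomorphism to the opposite algebra)
exist by the universal property of A as soon as their values on generators satisfy the relations,
and the axioms need only be tested on generators (`topHopfOfGenerators`). Apart from x^0 in (1),
every generator a is twisted primitive, Δ(a) = e^{zh} ⊗ a + a ⊗ e^{-zh} with h primitive, and the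
axioms hold uniformly (`HopfAxiomsAt.of_twistedPrimitive`). In (2) and (3) the relations between
coproducts come from general commutation formulas (`twist_mul_twist`, `twist_mul_twist_of_comm`).
Torsion-freeness is already known at that stage and allows division by z in identities for
sinh(zh)/z.

The isomorphism in (3) matches the two commuting triples with two copies of 𝔰𝔩₂ (`doubleEquivSl`).
-/

instance algebraNatK : Algebra ℕ K := Semiring.toNatAlgebra

instance algebraIntK : Algebra ℤ K := Ring.toIntAlgebra _

/-! ## Complete algebras and convergent `z`-series -/

/-- An `ℝ⟦z⟧`-algebra is `z`-adically complete and separated: zero is the only element divisible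
by all powers of `z`, and every series `∑ z ^ n • c n` converges, the `s n` being its tails. -/
class ZComplete (B : Type) [Ring B] [Algebra K B] : Prop where
  sep : ∀ b : B, (∀ n, ∃ c : B, b = z ^ n • c) → b = 0
  exists_sum : ∀ c : ℕ → B, ∃ s : ℕ → B, ∀ n, s n = c n + z • s (n + 1)

lemma eq_zpow_smul_of_step {ι M : Type} [AddCommGroup M] [Module K M] {d : ι → M}
    (h : ∀ i, ∃ j, d i = z • d j) (n : ℕ) (i : ι) : ∃ j, d i = z ^ n • d j := by
  induction n generalizing i with
  | zero => exact ⟨i, by simp⟩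
  | succ n ih =>
    obtain ⟨j, hj⟩ := h i
    obtain ⟨k, hk⟩ := ih j
    exact ⟨k, by rw [hj, hk, smul_smul, pow_succ']⟩

section ZComplete

variable {B : Type} [Ring B] [Algebra K B] [ZComplete B]

/-- Coinduction: in a family closed under division by z every member is divisible by all z ^ n.
Identities between series are proved below by exhibiting one step of such a division, without
handling partial sums. -/
lemma eq_zero_of_step {ι : Type} (d : ι → B) (h : ∀ i, ∃ j, d i = z • d j) (i : ι) : d i = 0 :=
  ZComplete.sep _ fun n => let ⟨_, hj⟩ := eq_zpow_smul_of_step h n i; ⟨_, hj⟩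

lemma eq_of_step {ι : Type} (d e : ι → B) (h : ∀ i, ∃ j, d i - e i = z • (d j - e j)) (i : ι) :
    d i = e i :=
  sub_eq_zero.1 (eq_zero_of_step (fun i => d i - e i) h i)

/-- The sum of the series `∑ z ^ n • c n`. -/
def zsum (c : ℕ → B) : B := (ZComplete.exists_sum c).choose 0

lemma zsum_eq {c s : ℕ → B} (h : ∀ n, s n = c n + z • s (n + 1)) : zsum c = s 0 := by
  have h' := (ZComplete.exists_sum c).choose_spec
  exact eq_of_step (ZComplete.exists_sum c).choose s
    (fun n => ⟨n + 1, by rw [h' n, h n, smul_sub]; abel⟩) 0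

lemma zsum_succ (c : ℕ → B) : zsum c = c 0 + z • zsum fun n => c (n + 1) := by
  have h' := (ZComplete.exists_sum c).choose_spec
  rw [zsum_eq (c := fun n => c (n + 1))
    (s := fun n => (ZComplete.exists_sum c).choose (n + 1)) fun n => h' (n + 1)]
  exact h' 0

lemma zsum_add (c d : ℕ → B) : (zsum fun n => c n + d n) = zsum c + zsum d := by
  refine eq_of_step (ι := (ℕ → B) × (ℕ → B)) (fun i => zsum fun n => i.1 n + i.2 n)
    (fun i => zsum i.1 + zsum i.2)
    (fun i => ⟨(fun n => i.1 (n + 1), fun n => i.2 (n + 1)), ?_⟩) (c, d)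
  dsimp only
  rw [zsum_succ, zsum_succ i.1, zsum_succ i.2]
  module

/-- Continuity is automatic: a linear map commutes with z, hence respects z-adic limits. -/
lemma map_zsum {B' : Type} [Ring B'] [Algebra K B'] [ZComplete B'] (F : B →ₗ[K] B') (c : ℕ → B) :
    F (zsum c) = zsum fun n => F (c n) := by
  refine eq_of_step (fun i : ℕ → B => F (zsum i)) (fun i => zsum fun n => F (i n))
    (fun i => ⟨fun n => i (n + 1), ?_⟩) c
  dsimp only
  rw [zsum_succ, zsum_succ fun n => F (i n), map_add, map_smul, smul_sub]
  abel

lemma zsum_zero : (zsum fun _ => (0 : B)) = 0 := zsum_eq (s := fun _ => 0) (by simp)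

lemma mul_zsum (a : B) (c : ℕ → B) : a * zsum c = zsum fun n => a * c n :=
  map_zsum (LinearMap.mulLeft K a) c

lemma zsum_mul (c : ℕ → B) (a : B) : zsum c * a = zsum fun n => c n * a :=
  map_zsum (LinearMap.mulRight K a) c

/-- Substitution of the parameter `z` for the variable of a power series. -/
def zev : B⟦X⟧ →+* B where
  toFun g := zsum fun n => PowerSeries.coeff n g
  map_zero' := by simpa using zsum_zero
  map_one' := by
    rw [zsum_succ]
    simp [PowerSeries.coeff_one, zsum_zero]
  map_add' f g := by simpa using zsum_add _ _
  map_mul' f g := by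
    refine eq_of_step (fun f : B⟦X⟧ => zsum fun n => PowerSeries.coeff n (f * g))
      (fun f : B⟦X⟧ => zsum (fun n => PowerSeries.coeff n f) * zsum fun n => PowerSeries.coeff n g)
      (fun f => ⟨PowerSeries.mk fun n => PowerSeries.coeff (n + 1) f, ?_⟩) f
    -- The coinduction runs over f with g fixed: f' is f with its constant term removed and shifted,
    -- so that f = f₀ + X f'.
    set f' : B⟦X⟧ := PowerSeries.mk fun n => PowerSeries.coeff (n + 1) f with hf'
    have hf : f = PowerSeries.C (PowerSeries.coeff 0 f) + PowerSeries.X * f' := by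
      ext n
      cases n <;> simp [hf', PowerSeries.coeff_succ_X_mul]
    have h1 : (zsum fun n => PowerSeries.coeff n (f * g)) =
        PowerSeries.coeff 0 f * (zsum fun n => PowerSeries.coeff n g) +
          z • zsum fun n => PowerSeries.coeff n (f' * g) := by
      rw [mul_zsum]
      conv_lhs => rw [hf]
      simp only [add_mul, map_add, PowerSeries.coeff_C_mul, mul_assoc]
      rw [zsum_add, zsum_succ fun n => PowerSeries.coeff n (PowerSeries.X * (f' * g))]
      simp [PowerSeries.coeff_succ_X_mul]
    have h2 : (zsum fun n => PowerSeries.coeff n f) =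
        PowerSeries.coeff 0 f + z • zsum fun n => PowerSeries.coeff n f' := by
      rw [zsum_succ]; simp [hf']
    rw [h1, h2, add_mul, smul_mul_assoc, smul_sub]
    abel

lemma zev_apply (g : B⟦X⟧) : zev g = zsum fun n => PowerSeries.coeff n g := rfl

lemma zev_C (a : B) : zev (PowerSeries.C a) = a := by
  rw [zev_apply, zsum_succ]
  simp [PowerSeries.coeff_succ_C, zsum_zero]

lemma zev_X_mul (g : B⟦X⟧) : zev (PowerSeries.X * g) = z • zev g := by
  rw [zev_apply, zsum_succ]
  simp [PowerSeries.coeff_succ_X_mul, zev_apply]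

lemma zev_X : zev (PowerSeries.X : B⟦X⟧) = algebraMap K B z := by
  rw [← mul_one PowerSeries.X, zev_X_mul, map_one, Algebra.algebraMap_eq_smul_one]

/-- Scalars in `K` are themselves series in z; this compatibility is what makes `freeLift` linear
over `K` and not only over ℝ. -/
lemma zev_map_algebraMap (r : K) :
    zev (PowerSeries.map ((algebraMap K B).comp PowerSeries.C) r) = algebraMap K B r := by
  refine eq_of_step
    (fun r : K => zev (PowerSeries.map ((algebraMap K B).comp PowerSeries.C) r))
    (fun r => algebraMap K B r)
    (fun r => ⟨PowerSeries.mk fun n => PowerSeries.coeff (n + 1) r, ?_⟩) r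
  set r' : K := PowerSeries.mk fun n => PowerSeries.coeff (n + 1) r with hr'
  have hr : r = PowerSeries.C (PowerSeries.coeff 0 r) + PowerSeries.X * r' := by
    ext n
    cases n <;> simp [hr', PowerSeries.coeff_succ_X_mul]
  conv_lhs => rw [hr]
  simp only [map_add, map_mul, PowerSeries.map_C, PowerSeries.map_X, zev_C, zev_X]
  simp only [RingHom.comp_apply, Algebra.smul_def]
  noncomm_ring

end ZComplete

/-! ## Functional calculus: `fc b f = f (z b)` -/

section Calculus

variable {B : Type} [Ring B] [Algebra K B]

/-- The power series `f (X b)`. -/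
def fcSeries (b : B) : ℝ⟦X⟧ →+* B⟦X⟧ where
  toFun f := PowerSeries.mk fun n => (PowerSeries.C (PowerSeries.coeff n f) : K) • b ^ n
  map_zero' := by ext n; simp
  map_one' := by
    ext n
    cases n <;> simp [PowerSeries.coeff_one]
  map_add' f g := by ext n; simp [add_smul]
  map_mul' f g := by
    ext n
    simp only [PowerSeries.coeff_mk, PowerSeries.coeff_mul, map_sum, map_mul, Finset.sum_smul]
    refine Finset.sum_congr rfl fun p hp => ?_
    rw [smul_mul_smul_comm, ← pow_add, Finset.HasAntidiagonal.mem_antidiagonal.1 hp]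

@[simp] lemma coeff_fcSeries (b : B) (f : ℝ⟦X⟧) (n : ℕ) :
    PowerSeries.coeff n (fcSeries b f) = (PowerSeries.C (PowerSeries.coeff n f) : K) • b ^ n := by
  simp [fcSeries]

variable [ZComplete B]

/-- The value `f (z b)` of a power series `f`. -/
def fc (b : B) : ℝ⟦X⟧ →+* B := zev.comp (fcSeries b)

lemma fc_apply (b : B) (f : ℝ⟦X⟧) :
    fc b f = zsum fun n => (PowerSeries.C (PowerSeries.coeff n f) : K) • b ^ n := by
  simp [fc, zev_apply]

lemma fc_C (b : B) (r : ℝ) : fc b (PowerSeries.C r) = algebraMap K B (PowerSeries.C r) := by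
  rw [fc_apply, zsum_succ]
  simp [PowerSeries.coeff_succ_C, zsum_zero, Algebra.algebraMap_eq_smul_one]

lemma fc_X (b : B) : fc b PowerSeries.X = z • b := by
  have h : fcSeries b PowerSeries.X = PowerSeries.X * PowerSeries.C b := by
    ext n
    rcases n with _ | _ | n <;>
      simp [PowerSeries.coeff_X]
  rw [fc, RingHom.comp_apply, h, zev_X_mul, zev_C]

lemma fc_C_mul (b : B) (r : ℝ) (f : ℝ⟦X⟧) :
    fc b (PowerSeries.C r * f) = (PowerSeries.C r : K) • fc b f := by
  rw [map_mul, fc_C, Algebra.smul_def]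

lemma fc_X_mul (b : B) (f : ℝ⟦X⟧) : fc b (PowerSeries.X * f) = z • (b * fc b f) := by
  rw [map_mul, fc_X, smul_mul_assoc]

lemma fc_rescale (b : B) (r : ℝ) (f : ℝ⟦X⟧) :
    fc b (PowerSeries.rescale r f) = fc ((PowerSeries.C r : K) • b) f := by
  rw [fc_apply, fc_apply]
  congr 1
  funext n
  rw [PowerSeries.coeff_rescale, smul_pow, map_mul, map_pow, smul_smul, mul_comm]

lemma fc_neg (b : B) (f : ℝ⟦X⟧) : fc (-b) f = fc b (PowerSeries.rescale (-1) f) := by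
  rw [fc_rescale]; simp

lemma fc_zero (f : ℝ⟦X⟧) :
    fc (0 : B) f = algebraMap K B (PowerSeries.C (PowerSeries.constantCoeff f)) := by
  rw [fc_apply, zsum_succ]
  simp [zsum_zero, Algebra.algebraMap_eq_smul_one]

lemma map_fc {B' : Type} [Ring B'] [Algebra K B'] [ZComplete B'] (F : B →ₐ[K] B') (b : B)
    (f : ℝ⟦X⟧) : F (fc b f) = fc (F b) f := by
  rw [fc_apply, fc_apply]
  simpa using map_zsum F.toLinearMap fun n => (PowerSeries.C (PowerSeries.coeff n f) : K) • b ^ n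

lemma semiconjBy_fc {a b b' : B} (h : SemiconjBy a b b') (f : ℝ⟦X⟧) :
    SemiconjBy a (fc b f) (fc b' f) := by
  rw [SemiconjBy, fc_apply, fc_apply, mul_zsum, zsum_mul]
  congr 1
  funext n
  rw [mul_smul_comm, smul_mul_assoc, (h.pow_right n).eq]

lemma commute_fc {a b : B} (h : Commute a b) (f : ℝ⟦X⟧) : Commute a (fc b f) :=
  semiconjBy_fc h f

lemma commute_fc_fc {a b : B} (h : Commute a b) (f g : ℝ⟦X⟧) : Commute (fc a f) (fc b g) :=
  (commute_fc (commute_fc h g).symm f).symm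

/-- If `[a, b] = c` commutes with `b` then `[a, f (z b)] = z c f' (z b)`. -/
lemma mul_fc_of_comm {a b c : B} (h : a * b = b * a + c) (hc : Commute c b) (f : ℝ⟦X⟧) :
    a * fc b f = fc b f * a + z • (c * fc b (PowerSeries.derivative ℝ f)) := by
  -- The truncated exponent at n = 0 is harmless: its coefficient is zero.
  have hpow : ∀ n : ℕ, a * b ^ n = b ^ n * a + (n : K) • (c * b ^ (n - 1)) := by
    intro n
    induction n with
    | zero => simp
    | succ n ih =>
      rw [pow_succ, ← mul_assoc, ih, add_mul, mul_assoc, h, mul_add, ← mul_assoc,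
        ← (hc.pow_right n).eq, smul_mul_assoc, add_assoc, mul_assoc (b ^ n)]
      rcases n with _ | n
      · simp
      · rw [Nat.add_sub_cancel, Nat.add_sub_cancel, mul_assoc, ← pow_succ]
        push_cast
        module
  have h1 : (zsum fun n => (PowerSeries.C (PowerSeries.coeff n f) : K) •
        ((n : K) • (c * b ^ (n - 1)))) =
      z • (c * fc b (PowerSeries.derivative ℝ f)) := by
    rw [zsum_succ, fc_apply, mul_zsum]
    simp only [Nat.cast_zero, zero_smul, smul_zero, zero_add, mul_smul_comm,
      Nat.add_sub_cancel, PowerSeries.coeff_derivative]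
    congr 3
    funext n
    rw [smul_smul, map_mul]
    simp
  rw [← h1, fc_apply, mul_zsum, zsum_mul, ← zsum_add]
  congr 1
  funext n
  rw [mul_smul_comm, hpow, smul_add, smul_mul_assoc]

end Calculus

/-! ## Exponential and hyperbolic functions -/

/-- The power series of the hyperbolic cosine. -/
def coshSeries : ℝ⟦X⟧ := PowerSeries.mk fun n => if Even n then ((n.factorial : ℝ)⁻¹) else 0

/-- The power series of `sinh X / X`. -/
def sinhcSeries : ℝ⟦X⟧ :=
  PowerSeries.mk fun n => if Even n then (((n + 1).factorial : ℝ)⁻¹) else 0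

lemma X_mul_sinhcSeries : PowerSeries.X * sinhcSeries =
    PowerSeries.mk fun n => if Even n then 0 else ((n.factorial : ℝ)⁻¹) := by
  ext n
  cases n with
  | zero => simp
  | succ n =>
    by_cases h : Even n <;>
      simp [PowerSeries.coeff_succ_X_mul, sinhcSeries, Nat.even_add_one, h]

lemma exp_eq_cosh_add_sinh :
    PowerSeries.exp ℝ = coshSeries + PowerSeries.X * sinhcSeries := by
  rw [X_mul_sinhcSeries]
  ext n
  by_cases h : Even n <;> simp [coshSeries, PowerSeries.coeff_exp, h]

lemma rescale_neg_one_coshSeries : PowerSeries.rescale (-1) coshSeries = coshSeries := by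
  ext n
  by_cases h : Even n <;> simp [coshSeries, h]

lemma rescale_neg_one_sinhcSeries : PowerSeries.rescale (-1) sinhcSeries = sinhcSeries := by
  ext n
  by_cases h : Even n <;> simp [sinhcSeries, h]

lemma constantCoeff_coshSeries : PowerSeries.constantCoeff coshSeries = 1 := by
  rw [← PowerSeries.coeff_zero_eq_constantCoeff_apply]; simp [coshSeries]

lemma constantCoeff_sinhcSeries : PowerSeries.constantCoeff sinhcSeries = 1 := by
  rw [← PowerSeries.coeff_zero_eq_constantCoeff_apply]; simp [sinhcSeries]

lemma derivative_coshSeries :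
    PowerSeries.derivative ℝ coshSeries = PowerSeries.X * sinhcSeries := by
  rw [X_mul_sinhcSeries]
  ext n
  rw [PowerSeries.coeff_derivative]
  by_cases h : Even n <;> simp [coshSeries, h, Nat.even_add_one, Nat.factorial_succ]
  have : (n : ℝ) + 1 ≠ 0 := by positivity
  field_simp

lemma derivative_X_mul_sinhcSeries :
    PowerSeries.derivative ℝ (PowerSeries.X * sinhcSeries) = coshSeries := by
  rw [X_mul_sinhcSeries]
  ext n
  rw [PowerSeries.coeff_derivative]
  by_cases h : Even n <;> simp [coshSeries, h, Nat.even_add_one, Nat.factorial_succ]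
  have : (n : ℝ) + 1 ≠ 0 := by positivity
  field_simp

/-- An `ℝ⟦z⟧`-module has no `z`-torsion. -/
class ZTorsionFree (M : Type) [AddCommGroup M] [Module K M] : Prop where
  eq_zero : ∀ a : M, z • a = 0 → a = 0

lemma z_smul_cancel {M : Type} [AddCommGroup M] [Module K M] [ZTorsionFree M] {a b : M}
    (h : z • a = z • b) : a = b :=
  sub_eq_zero.1 (ZTorsionFree.eq_zero _ (by rw [smul_sub, h, sub_self]))

lemma two_smul_cancel {M : Type} [AddCommGroup M] [Module K M] {a b : M}
    (h : (2 : K) • a = (2 : K) • b) : a = b := by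
  have h2 : (PowerSeries.C (2⁻¹ : ℝ) : K) * 2 = 1 := by
    rw [← map_ofNat PowerSeries.C 2, ← map_mul]; norm_num
  rw [← one_smul K a, ← one_smul K b, ← h2, mul_smul, h, mul_smul]

section Exp

variable {B : Type} [Ring B] [Algebra K B] [ZComplete B]

/-- `exp (z b)` -/
def E (b : B) : B := fc b (PowerSeries.exp ℝ)

/-- `cosh (z b)` -/
def Ch (b : B) : B := fc b coshSeries

/-- `sinh (z b) / z` -/
def Sh (b : B) : B := b * fc b sinhcSeries

lemma E_eq (b : B) : E b = Ch b + z • Sh b := by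
  rw [E, exp_eq_cosh_add_sinh, map_add, fc_X_mul, Ch, Sh]

lemma Ch_neg (b : B) : Ch (-b) = Ch b := by
  rw [Ch, fc_neg, rescale_neg_one_coshSeries, Ch]

lemma Sh_neg (b : B) : Sh (-b) = -Sh b := by
  rw [Sh, fc_neg, rescale_neg_one_sinhcSeries, Sh, neg_mul]

lemma E_neg (b : B) : E (-b) = Ch b - z • Sh b := by
  rw [E_eq, Ch_neg, Sh_neg, smul_neg, sub_eq_add_neg]

lemma E_zero : E (0 : B) = 1 := by rw [E, fc_zero]; simp

lemma Sh_zero : Sh (0 : B) = 0 := by simp [Sh]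

/-- The identity already holds between formal series in X before the substitution X = z, where it is
the binomial theorem for commuting elements. -/
lemma E_add {a b : B} (h : Commute a b) : E (a + b) = E a * E b := by
  simp only [E, fc, RingHom.comp_apply, ← map_mul]
  congr 1
  ext n
  rw [coeff_fcSeries, PowerSeries.coeff_mul, h.add_pow', Finset.smul_sum]
  refine Finset.sum_congr rfl fun p hp => ?_
  rw [coeff_fcSeries, coeff_fcSeries, smul_mul_smul_comm, ← map_mul, ← Nat.cast_smul_eq_nsmul K,
    smul_smul]
  congr 1
  rw [← map_natCast PowerSeries.C, ← map_mul]
  congr 1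
  have hn : p.1 + p.2 = n := Finset.HasAntidiagonal.mem_antidiagonal.1 hp
  subst hn
  rw [Nat.cast_add_choose]
  simp only [PowerSeries.coeff_exp, map_div₀, map_one, map_natCast]
  have h1 : ((p.1 + p.2).factorial : ℝ) ≠ 0 := by positivity
  have h2 : (p.1.factorial : ℝ) ≠ 0 := by positivity
  have h3 : (p.2.factorial : ℝ) ≠ 0 := by positivity
  field_simp

lemma E_mul_E_neg (b : B) : E b * E (-b) = 1 := by
  rw [← E_add (Commute.refl b).neg_right, add_neg_cancel, E_zero]

lemma E_neg_mul_E (b : B) : E (-b) * E b = 1 := by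
  rw [← E_add (Commute.refl b).neg_left, neg_add_cancel, E_zero]

lemma two_smul_Ch (b : B) : (2 : K) • Ch b = E b + E (-b) := by
  rw [E_eq, E_neg]; module

lemma two_z_smul_Sh (b : B) : (2 : K) • z • Sh b = E b - E (-b) := by
  rw [E_eq, E_neg]; module

lemma Ch_add {a b : B} (h : Commute a b) :
    Ch (a + b) = Ch a * Ch b + (z * z) • (Sh a * Sh b) := by
  refine two_smul_cancel ?_
  rw [two_smul_Ch, neg_add, E_add h, E_add h.neg_left.neg_right, E_neg, E_neg, E_eq, E_eq]
  simp only [mul_add, add_mul, mul_sub, sub_mul, smul_mul_assoc, mul_smul_comm]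
  module

/-- The addition theorem for exponentials only gives the formula multiplied by 2 z, and z has to be
cancelled. This is why torsion-freeness is established before the coproduct is constructed. -/
lemma Sh_add [ZTorsionFree B] {a b : B} (h : Commute a b) :
    Sh (a + b) = Sh a * Ch b + Ch a * Sh b := by
  refine z_smul_cancel (two_smul_cancel ?_)
  rw [two_z_smul_Sh, neg_add, E_add h, E_add h.neg_left.neg_right, E_neg, E_neg, E_eq, E_eq]
  simp only [mul_add, add_mul, mul_sub, sub_mul, smul_mul_assoc, mul_smul_comm]
  module

lemma commute_E {a b : B} (h : Commute a b) : Commute a (E b) := commute_fc h _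

lemma commute_Ch {a b : B} (h : Commute a b) : Commute a (Ch b) := commute_fc h _

lemma commute_Sh {a b : B} (h : Commute a b) : Commute a (Sh b) := h.mul_right (commute_fc h _)

lemma E_comm_E {a b : B} (h : Commute a b) : Commute (E a) (E b) := commute_fc_fc h _ _

variable {B' : Type} [Ring B'] [Algebra K B'] [ZComplete B'] (F : B →ₐ[K] B')

lemma map_E (b : B) : F (E b) = E (F b) := map_fc F b _

lemma map_Ch (b : B) : F (Ch b) = Ch (F b) := map_fc F b _

lemma map_Sh (b : B) : F (Sh b) = Sh (F b) := by rw [Sh, map_mul, map_fc, Sh]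

/-- If `a b = (b + μ) a` for a scalar `μ`, then `a exp (z b) = exp (z μ) exp (z b) a`. -/
lemma mul_E_of_shift {a b : B} {μ : K} (h : a * b = b * a + μ • a) :
    a * E b = E (μ • (1 : B)) * (E b * a) := by
  have h' : SemiconjBy a b (μ • (1 : B) + b) := by
    rw [SemiconjBy, h, add_mul, smul_mul_assoc, one_mul, add_comm]
  have h2 := (semiconjBy_fc h' (PowerSeries.exp ℝ)).eq
  change a * E b = E (μ • (1 : B) + b) * a at h2
  rw [h2, E_add ((Commute.one_left b).smul_left μ), mul_assoc]

/-- If `[a, b] = c` commutes with `b` then `[a, exp (z b)] = z c exp (z b)`. -/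
lemma mul_E_of_comm {a b c : B} (h : a * b = b * a + c) (hc : Commute c b) :
    a * E b = E b * a + z • (c * E b) := by
  rw [E, mul_fc_of_comm h hc, PowerSeries.derivative_exp]

/-- Second-order Taylor expansion, from which the first-order part of the twisted coproducts is read
off. -/
lemma exists_E_eq (b : B) : ∃ c : B, E b = 1 + z • b + z ^ 2 • c := by
  refine ⟨b * b * fc b (PowerSeries.mk fun n => PowerSeries.coeff (n + 2) (PowerSeries.exp ℝ)), ?_⟩
  have h : PowerSeries.exp ℝ = 1 + PowerSeries.X + PowerSeries.X * (PowerSeries.X *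
      PowerSeries.mk fun n => PowerSeries.coeff (n + 2) (PowerSeries.exp ℝ)) := by
    ext n
    rcases n with _ | _ | n <;>
      simp [PowerSeries.coeff_succ_X_mul, PowerSeries.coeff_X, PowerSeries.coeff_one]
  rw [E]
  conv_lhs => rw [h]
  rw [map_add, map_add, map_one, fc_X, fc_X_mul, fc_X_mul, mul_smul_comm, smul_smul, mul_assoc,
    pow_two]

end Exp

/-! ## Complete algebras: power series, quotients, opposites, completions -/

/-- The `ℝ⟦z⟧`-algebra structure on power series over a real algebra, with `z` acting as the
variable. -/
abbrev seriesAlgebra (R : Type) [Ring R] [Algebra ℝ R] : Algebra K R⟦X⟧ :=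
  RingHom.toAlgebra' (PowerSeries.map (algebraMap ℝ R)) fun r a => by
    ext n
    rw [PowerSeries.coeff_mul, PowerSeries.coeff_mul, ← Finset.Nat.sum_antidiagonal_swap]
    refine Finset.sum_congr rfl fun p _ => ?_
    simp only [PowerSeries.coeff_map, Prod.fst_swap, Prod.snd_swap]
    exact Algebra.commutes _ _

/-- The scalar action is left arbitrary, subject to z acting as X, so as to cover the completed free
algebra, series over an enveloping algebra, and `K` itself. -/
lemma zComplete_powerSeries {R : Type} [Ring R] [Algebra K R⟦X⟧]
    (hz : ∀ f : R⟦X⟧, z • f = PowerSeries.X * f) : ZComplete R⟦X⟧ where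
  sep b hb := by
    have hzn : ∀ (n : ℕ) (f : R⟦X⟧), z ^ n • f = PowerSeries.X ^ n * f := by
      intro n f
      induction n with
      | zero => simp
      | succ n ih => rw [pow_succ', mul_smul, ih, hz, pow_succ', mul_assoc]
    ext n
    obtain ⟨c, hc⟩ := hb (n + 1)
    rw [hc, hzn, PowerSeries.coeff_X_pow_mul']
    simp
  exists_sum c := by
    -- The tail ∑ X ^ j c (n + j), written coefficientwise so that every sum is finite.
    refine ⟨fun n => PowerSeries.mk fun m =>
      ∑ p ∈ Finset.HasAntidiagonal.antidiagonal m, PowerSeries.coeff p.2 (c (n + p.1)),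
      fun n => ?_⟩
    rw [hz]
    ext m
    cases m with
    | zero => simp
    | succ m =>
      simp only [PowerSeries.coeff_mk, map_add, PowerSeries.coeff_succ_X_mul,
        Finset.Nat.sum_antidiagonal_succ, add_zero]
      simp only [add_assoc, add_comm 1]

lemma zTorsionFree_powerSeries {R : Type} [Ring R] [Algebra K R⟦X⟧]
    (hz : ∀ f : R⟦X⟧, z • f = PowerSeries.X * f) : ZTorsionFree R⟦X⟧ where
  eq_zero f hf := by
    rw [hz] at hf
    ext n
    rw [← PowerSeries.coeff_succ_X_mul, hf]; simp

lemma z_smul_freeZ (f : FreeZ) : z • f = PowerSeries.X * f := by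
  rw [Algebra.smul_def]
  change PowerSeries.map (algebraMap ℝ Free) PowerSeries.X * f = _
  rw [PowerSeries.map_X]

instance : ZComplete FreeZ := zComplete_powerSeries z_smul_freeZ

section Op

variable {B : Type} [Ring B] [Algebra K B]

instance [ZComplete B] : ZComplete Bᵐᵒᵖ where
  sep b hb := MulOpposite.unop_injective <| ZComplete.sep b.unop fun n =>
    let ⟨c, hc⟩ := hb n
    ⟨c.unop, by rw [hc, MulOpposite.unop_smul]⟩
  exists_sum c := by
    obtain ⟨s, hs⟩ := ZComplete.exists_sum fun n => (c n).unop
    exact ⟨fun n => MulOpposite.op (s n), fun n => MulOpposite.unop_injective (hs n)⟩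

variable [ZComplete B]

lemma fc_op (b : B) (f : ℝ⟦X⟧) : fc (MulOpposite.op b) f = MulOpposite.op (fc b f) := by
  rw [fc_apply, fc_apply]
  have h : ∀ c : ℕ → B, (zsum fun n => MulOpposite.op (c n)) = MulOpposite.op (zsum c) := by
    refine eq_of_step (fun c : ℕ → B => zsum fun n => MulOpposite.op (c n))
      (fun c => MulOpposite.op (zsum c)) fun c => ⟨fun n => c (n + 1), ?_⟩
    rw [zsum_succ, zsum_succ c, MulOpposite.op_add, MulOpposite.op_smul, smul_sub]
    abel
  rw [← h]
  rfl

lemma E_op (b : B) : E (MulOpposite.op b) = MulOpposite.op (E b) := fc_op b _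

lemma Ch_op (b : B) : Ch (MulOpposite.op b) = MulOpposite.op (Ch b) := fc_op b _

lemma Sh_op (b : B) : Sh (MulOpposite.op b) = MulOpposite.op (Sh b) := by
  rw [Sh, fc_op, ← MulOpposite.op_mul, (commute_fc (Commute.refl b) _).symm.eq, Sh]

end Op

/-! ### Truncations modulo powers of z, and completions -/

section Level

variable {S : Type} [Ring S] [Algebra K S]

lemma level_eq_iff {n : ℕ} {a b : S} :
    (a : Level S n) = b ↔ ∃ c : S, a - b = z ^ n • c := RingCon.eq _

/-- Makes A/zA an admissible target for the universal property of A and for the functional calculus,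
where every series reduces to its constant term. -/
lemma zComplete_of_z_smul {B : Type} [Ring B] [Algebra K B] (h : ∀ b : B, z • b = 0) :
    ZComplete B where
  sep b hb := by
    obtain ⟨c, hc⟩ := hb 1
    rw [hc, pow_one, h]
  exists_sum c := ⟨c, fun n => by rw [h, add_zero]⟩

instance : ZComplete (Level S 1) :=
  zComplete_of_z_smul fun b => by simpa using zpow_smul_level 1 b

lemma level_zero_eq_zero (c : Level S 0) : c = 0 := by
  simpa using zpow_smul_level 0 c

lemma Completion.ext_level {u v : Completion S} (h : ∀ n, u.1 n = v.1 n) : u = v :=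
  Subtype.ext (funext h)

instance : ZComplete (Completion S) where
  sep b hb := Completion.ext_level fun n => by
    obtain ⟨c, hc⟩ := hb n
    rw [hc]
    exact zpow_smul_level n (c.1 n)
  exists_sum c := by
    -- At level m only the terms j < m of the tail ∑ z ^ j c (k + j) survive. The extra term present
    -- at level m + 1 carries z ^ m, so the truncations are compatible.
    refine ⟨fun k => ⟨fun m => ∑ j ∈ Finset.range m, z ^ j • (c (k + j)).1 m, fun m => ?_⟩,
      fun k => Completion.ext_level fun m => ?_⟩
    · choose a ha ha' using fun j => (c (k + j)).2 m
      have hsum : ∀ n : ℕ, ((∑ j ∈ Finset.range (m + 1), z ^ j • a j : S) : Level S n) =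
          ∑ j ∈ Finset.range (m + 1), z ^ j • (a j : Level S n) := fun n =>
        map_sum (RingCon.mkₐ K (zCon S n)) (fun j => z ^ j • a j) _
      refine ⟨∑ j ∈ Finset.range (m + 1), z ^ j • a j, ?_, ?_⟩
      · simp only [ha]
        rw [hsum, Finset.sum_range_succ _ m, zpow_smul_level, add_zero]
      · simp only [ha']
        rw [hsum]
    · change ∑ j ∈ Finset.range m, z ^ j • (c (k + j)).1 m = (c k).1 m +
        z • ∑ j ∈ Finset.range m, z ^ j • (c (k + 1 + j)).1 m
      cases m with
      | zero => exact (level_zero_eq_zero _).trans (level_zero_eq_zero _).symm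
      | succ m =>
        rw [Finset.sum_range_succ', Finset.smul_sum, Finset.sum_range_succ _ m]
        simp only [smul_smul, ← pow_succ']
        rw [zpow_smul_level, add_zero, add_comm ((c k).1 (m + 1)), pow_zero, one_smul, add_zero]
        simp only [add_assoc, add_comm 1]

/-- Density in a strong form: the remainder is z ^ n times an element of the completion, not merely
zero at level n. This is what lets linear maps be compared on S alone. -/
lemma Completion.exists_eq_of_add (u : Completion S) (n : ℕ) :
    ∃ (a : S) (v : Completion S), u = Completion.of S a + z ^ n • v := by
  choose b hb hb' using u.2
  have hstep : ∀ m, ∃ d : S, b (m + 1) - b m = z ^ (m + 1) • d := fun m =>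
    level_eq_iff.1 ((hb (m + 1)).symm.trans (hb' m))
  choose d hd using hstep
  -- Consecutive representatives differ by multiples of z ^ (m + 1). The telescoping sum makes t
  -- independent of n, while t m visibly agrees with u at level m.
  let t : ℕ → Completion S := fun n => Completion.of S (b n) +
    z ^ (n + 1) • zsum fun j => Completion.of S (d (n + j))
  have ht : ∀ n, t (n + 1) = t n := by
    intro n
    change Completion.of S (b (n + 1)) + z ^ (n + 1 + 1) • (zsum fun j =>
      Completion.of S (d (n + 1 + j))) = Completion.of S (b n) + z ^ (n + 1) • zsum fun j =>
        Completion.of S (d (n + j))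
    rw [zsum_succ fun j => Completion.of S (d (n + j)), sub_eq_iff_eq_add.1 (hd n), map_add,
      map_smul]
    simp only [add_zero, add_assoc, add_comm 1]
    module
  have ht' : ∀ m n, t n = t m := by
    have h0 : ∀ n, t n = t 0 := fun n => by
      induction n with
      | zero => rfl
      | succ n ih => rw [ht, ih]
    exact fun m n => (h0 n).trans (h0 m).symm
  have hu : u = t n := Completion.ext_level fun m => by
    rw [ht' m n, hb m]
    change _ = ((b m : S) : Level S m) + z ^ (m + 1) • (zsum fun j =>
      Completion.of S (d (m + j))).1 m
    rw [pow_succ', mul_smul, zpow_smul_level, smul_zero, add_zero]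
  refine ⟨b n, z • zsum fun j => Completion.of S (d (n + j)), hu.trans ?_⟩
  rw [smul_smul, ← pow_succ]

/-- Two `ℝ⟦z⟧`-linear maps on a completion which agree on the original algebra are equal. -/
lemma Completion.linearMap_ext {B : Type} [Ring B] [Algebra K B] [ZComplete B]
    {f g : Completion S →ₗ[K] B} (h : ∀ a, f (Completion.of S a) = g (Completion.of S a)) :
    f = g := by
  ext u
  rw [← sub_eq_zero]
  refine ZComplete.sep _ fun n => ?_
  obtain ⟨a, v, rfl⟩ := Completion.exists_eq_of_add u n
  exact ⟨f v - g v, by rw [map_add, map_add, h, map_smul, map_smul]; module⟩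

instance [ZTorsionFree S] : ZTorsionFree (Completion S) where
  eq_zero u hu := Completion.ext_level fun n => by
    -- The representative a serves levels n and n + 1 at once: from z a ∈ z ^ (n + 1) S, cancelling
    -- z loses exactly one level.
    obtain ⟨a, ha, ha'⟩ := u.2 n
    have h : z • u.1 (n + 1) = 0 := congrArg (fun v : Completion S => v.1 (n + 1)) hu
    rw [ha'] at h
    obtain ⟨c, hc⟩ := level_eq_iff.1 (show ((z • a : S) : Level S (n + 1)) = (0 : S) from h)
    rw [sub_zero, pow_succ', mul_smul] at hc
    rw [ha, z_smul_cancel hc]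
    exact level_eq_iff.2 ⟨c, by simp⟩

/-- The continuous extension to the completion of an algebra homomorphism. -/
def Completion.extendAlgHom {T : Type} [Ring T] [Algebra K T] (f : S →ₐ[K] Completion T) :
    Completion S →ₐ[K] Completion T :=
  AlgHom.ofLinearMap (Completion.extend f.toLinearMap)
    ((Completion.extend_of f.toLinearMap 1).trans (map_one f)) fun u v => by
    refine Completion.ext_level fun n => ?_
    obtain ⟨a, ha, -⟩ := u.2 n
    obtain ⟨b, hb, -⟩ := v.2 n
    change Completion.extendLevel f.toLinearMap n (u.1 n * v.1 n) =
      Completion.extendLevel f.toLinearMap n (u.1 n) *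
        Completion.extendLevel f.toLinearMap n (v.1 n)
    rw [ha, hb]
    exact congrArg (fun u : Completion T => u.1 n) (map_mul f a b)

end Level

/-! ## The universal properties of the free algebra and of its quotients -/

/-- The real algebra underlying an `ℝ⟦z⟧`-algebra. -/
abbrev realAlgebra (B : Type) [Ring B] [Algebra K B] : Algebra ℝ B :=
  Algebra.compHom B (PowerSeries.C : ℝ →+* K)

lemma C_smul_freeZ (r : ℝ) (f : FreeZ) :
    (PowerSeries.C r : K) • f = PowerSeries.C (algebraMap ℝ Free r) * f := by
  rw [Algebra.smul_def]
  change PowerSeries.map (algebraMap ℝ Free) (PowerSeries.C r) * f = _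
  rw [PowerSeries.map_C]

section FreeLift

variable {B : Type} [Ring B] [Algebra K B]

/-- The real algebra homomorphism from the free algebra with given values on the generators, as a
ring homomorphism. -/
def wordLift (G : Gen → B) : Free →+* B :=
  letI := realAlgebra B
  (FreeAlgebra.lift ℝ G).toRingHom

lemma wordLift_ι (G : Gen → B) (g : Gen) : wordLift G (FreeAlgebra.ι ℝ g) = G g :=
  letI := realAlgebra B
  FreeAlgebra.lift_ι_apply G g

lemma wordLift_algebraMap (G : Gen → B) (r : ℝ) :
    wordLift G (algebraMap ℝ Free r) = algebraMap K B (PowerSeries.C r) :=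
  letI := realAlgebra B
  (FreeAlgebra.lift ℝ G).commutes r

lemma wordLift_smul (G : Gen → B) (r : ℝ) (w : Free) :
    wordLift G (r • w) = (PowerSeries.C r : K) • wordLift G w := by
  rw [Algebra.smul_def, map_mul, wordLift_algebraMap, Algebra.smul_def]

lemma wordLift_x (G : Gen → B) (i : Fin 3) : wordLift G (x i) = G (Sum.inl i) := wordLift_ι G _

lemma wordLift_X (G : Gen → B) (i : Fin 3) : wordLift G (X i) = G (Sum.inr i) := wordLift_ι G _

variable [ZComplete B]

/-- The continuous homomorphism from the completed free algebra with given values on the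
generators. -/
def freeLift (G : Gen → B) : FreeZ →ₐ[K] B :=
  { zev.comp (PowerSeries.map (wordLift G)) with
    commutes' := fun r => by
      change zev (PowerSeries.map (wordLift G) (PowerSeries.map (algebraMap ℝ Free) r)) = _
      rw [← zev_map_algebraMap]
      congr 1
      ext n
      simp [wordLift_algebraMap] }

lemma freeLift_apply (G : Gen → B) (f : FreeZ) :
    freeLift G f = zev (PowerSeries.map (wordLift G) f) := rfl

lemma freeLift_C (G : Gen → B) (w : Free) : freeLift G (PowerSeries.C w) = wordLift G w := by
  rw [freeLift_apply, PowerSeries.map_C, zev_C]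

lemma freeLift_xz (G : Gen → B) (i : Fin 3) : freeLift G (xz i) = G (Sum.inl i) := by
  rw [xz, freeLift_C, x, wordLift_ι]

lemma freeLift_Xz (G : Gen → B) (i : Fin 3) : freeLift G (Xz i) = G (Sum.inr i) := by
  rw [Xz, freeLift_C, X, wordLift_ι]

lemma freeLift_comm (G : Gen → B) (f g : FreeZ) : freeLift G (comm f g) =
    freeLift G f * freeLift G g - freeLift G g * freeLift G f := by
  simp [comm]

lemma freeLift_smul (G : Gen → B) (r : ℝ) (f : FreeZ) :
    freeLift G (r • f) = (PowerSeries.C r : K) • freeLift G f := by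
  rw [← map_smul]
  congr 1
  rw [C_smul_freeZ]
  ext n
  rw [PowerSeries.coeff_C_mul]
  exact Algebra.smul_def r (PowerSeries.coeff n f)

lemma freeLift_expZ (G : Gen → B) (w : Free) : freeLift G (expZ w) = E (wordLift G w) := by
  rw [freeLift_apply, E, fc, RingHom.comp_apply]
  congr 1
  ext n
  simp [expZ, wordLift_smul, PowerSeries.coeff_exp]

lemma freeLift_coshZ (G : Gen → B) (w : Free) : freeLift G (coshZ w) = Ch (wordLift G w) := by
  rw [freeLift_apply, Ch, fc, RingHom.comp_apply]
  congr 1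
  ext n
  by_cases h : Even n <;> simp [coshZ, coshSeries, wordLift_smul, h]

lemma freeLift_sinhDivZ (G : Gen → B) (w : Free) :
    freeLift G (sinhDivZ w) = Sh (wordLift G w) := by
  rw [freeLift_apply, Sh, fc, RingHom.comp_apply]
  rw [show ∀ g : B⟦X⟧, wordLift G w * zev g = zev (PowerSeries.C (wordLift G w) * g) from
    fun g => by rw [map_mul, zev_C]]
  congr 1
  ext n
  by_cases h : Even n <;> simp [sinhDivZ, sinhcSeries, wordLift_smul, h, pow_succ']

end FreeLift

lemma freeZ_eq_zsum (f : FreeZ) : f = zsum fun n => PowerSeries.C (PowerSeries.coeff n f) := by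
  refine eq_of_step (fun f : FreeZ => f) (fun f => zsum fun n =>
    PowerSeries.C (PowerSeries.coeff n f))
    (fun f => ⟨PowerSeries.mk fun n => PowerSeries.coeff (n + 1) f, ?_⟩) f
  rw [zsum_succ]
  have hf : f = PowerSeries.C (PowerSeries.coeff 0 f) + z •
      (PowerSeries.mk fun n => PowerSeries.coeff (n + 1) f) := by
    rw [z_smul_freeZ]
    ext n
    cases n <;> simp [PowerSeries.coeff_succ_X_mul]
  simp only [PowerSeries.coeff_mk]
  conv_lhs => enter [1]; rw [hf]
  rw [smul_sub]
  abel

/-- Stated for linear maps because the antipode identities compare maps that are not multiplicative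
a priori. The induction over words is carried out for all left factors v simultaneously; continuity
then passes to series. -/
lemma freeZ_induction {B : Type} [Ring B] [Algebra K B] [ZComplete B] {f g : FreeZ →ₗ[K] B}
    (hs : f 1 = g 1)
    (hg : ∀ (w : FreeZ) (a : Gen), f w = g w →
      f (w * PowerSeries.C (FreeAlgebra.ι ℝ a)) = g (w * PowerSeries.C (FreeAlgebra.ι ℝ a))) :
    f = g := by
  have key : ∀ (u : Free) (v : FreeZ), f v = g v →
      f (v * PowerSeries.C u) = g (v * PowerSeries.C u) := by
    intro u
    induction u using FreeAlgebra.induction with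
    | grade0 r =>
      intro v hv
      have h : v * PowerSeries.C (algebraMap ℝ Free r) = (PowerSeries.C r : K) • v := by
        rw [← mul_one v, ← mul_smul_comm, C_smul_freeZ, mul_one, mul_one]
      rw [h, map_smul, map_smul, hv]
    | grade1 a => exact fun v hv => hg v a hv
    | add u u' hu hu' =>
      intro v hv
      rw [map_add, mul_add, map_add, map_add, hu v hv, hu' v hv]
    | mul u u' hu hu' =>
      intro v hv
      rw [map_mul PowerSeries.C, ← mul_assoc]
      exact hu' _ (hu v hv)
  ext w
  rw [freeZ_eq_zsum w, map_zsum, map_zsum]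
  congr 1
  funext n
  simpa using key (PowerSeries.coeff n w) 1 hs

lemma freeZ_algHom_ext {B : Type} [Ring B] [Algebra K B] [ZComplete B] {f g : FreeZ →ₐ[K] B}
    (h : ∀ a : Gen, f (PowerSeries.C (FreeAlgebra.ι ℝ a)) =
      g (PowerSeries.C (FreeAlgebra.ι ℝ a))) : f = g := by
  refine AlgHom.toLinearMap_injective (freeZ_induction ?_ fun w a hw => ?_)
  · simp
  · simp only [AlgHom.toLinearMap_apply] at hw ⊢
    rw [map_mul, map_mul, h, hw]

namespace QuantumData

variable (P : QuantumData)

lemma proj_surjective : Function.Surjective P.proj :=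
  fun b => RingCon.mkₐ_surjective _ b

lemma mem_relIdeal_of_mem_rels {r : FreeZ} (hr : r ∈ P.rels) : r ∈ P.relIdeal := by
  rw [relIdeal, TwoSidedIdeal.mem_iInf]
  exact fun n => TwoSidedIdeal.subset_span (Or.inl hr)

lemma proj_eq_zero_iff {f : FreeZ} : P.proj f = 0 ↔ f ∈ P.relIdeal := by
  rw [TwoSidedIdeal.mem_iff]
  exact RingCon.eq _

lemma proj_rel {r : FreeZ} (hr : r ∈ P.rels) : P.proj r = 0 :=
  P.proj_eq_zero_iff.2 (P.mem_relIdeal_of_mem_rels hr)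

lemma zpow_smul_freeZ (n : ℕ) (f : FreeZ) : z ^ n • f = PowerSeries.X ^ n * f := by
  induction n with
  | zero => simp
  | succ n ih => rw [pow_succ', mul_smul, ih, z_smul_freeZ, pow_succ', mul_assoc]

/-- Separatedness is the closedness of the relation ideal: an element divisible by every z ^ n lies
in every J + z ^ n. Convergence is lifted to the free algebra. -/
instance : ZComplete P.Alg where
  sep b hb := by
    obtain ⟨f, rfl⟩ := P.proj_surjective b
    rw [proj_eq_zero_iff, relIdeal, TwoSidedIdeal.mem_iInf]
    intro n
    obtain ⟨c, hc⟩ := hb n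
    obtain ⟨g, rfl⟩ := P.proj_surjective c
    rw [← map_smul, ← sub_eq_zero, ← map_sub, proj_eq_zero_iff, relIdeal,
      TwoSidedIdeal.mem_iInf, zpow_smul_freeZ] at hc
    have h1 := hc n
    have h2 : (PowerSeries.X : FreeZ) ^ n * g ∈
        TwoSidedIdeal.span (P.rels ∪ {(PowerSeries.X : FreeZ) ^ n}) :=
      TwoSidedIdeal.mul_mem_right _ _ _ (TwoSidedIdeal.subset_span (Or.inr rfl))
    simpa using TwoSidedIdeal.add_mem _ h1 h2
  exists_sum c := by
    choose f hf using fun n => P.proj_surjective (c n)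
    obtain ⟨s, hs⟩ := ZComplete.exists_sum f
    exact ⟨fun n => P.proj (s n), fun n => by dsimp only; rw [hs n, map_add, map_smul, hf]⟩

variable {P} {B : Type} [Ring B] [Algebra K B] [ZComplete B]

/-- The homomorphism from the algebra presented by `P` with given values on the generators. -/
def lift (G : Gen → B) (h : ∀ r ∈ P.rels, freeLift G r = 0) : P.Alg →ₐ[K] B :=
  RingCon.liftₐ P.relIdeal.ringCon (freeLift G) fun f g hfg => by
    rw [TwoSidedIdeal.rel_iff, relIdeal, TwoSidedIdeal.mem_iInf] at hfg
    rw [RingCon.ker_apply]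
    change freeLift G f = freeLift G g
    rw [← sub_eq_zero, ← map_sub]
    refine ZComplete.sep _ fun n => ?_
    -- The preimage of z ^ n B contains both the relations and z ^ n, hence the n-th ideal in the
    -- intersection; separatedness of B concludes.
    have hle : TwoSidedIdeal.span (P.rels ∪ {(PowerSeries.X : FreeZ) ^ n}) ≤
        TwoSidedIdeal.comap (freeLift G) (TwoSidedIdeal.ofRingCon (zCon B n)) := by
      rw [TwoSidedIdeal.span_le]
      rintro r (hr | rfl)
      · rw [SetLike.mem_coe, TwoSidedIdeal.mem_comap, h r hr]
        exact TwoSidedIdeal.zero_mem _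
      · rw [SetLike.mem_coe, TwoSidedIdeal.mem_comap]
        refine ⟨1, ?_⟩
        rw [← mul_one ((PowerSeries.X : FreeZ) ^ n), ← zpow_smul_freeZ, map_smul, map_one,
          sub_zero]
    obtain ⟨c, hc⟩ := (TwoSidedIdeal.mem_comap _).1 (hle (hfg n))
    exact ⟨c, by rw [← hc, sub_zero]⟩

lemma lift_proj (G : Gen → B) (h : ∀ r ∈ P.rels, freeLift G r = 0) (f : FreeZ) :
    lift G h (P.proj f) = freeLift G f := rfl

lemma lift_gen (G : Gen → B) (h : ∀ r ∈ P.rels, freeLift G r = 0) (g : Gen) :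
    lift G h (P.gen g) = G g := by
  rw [gen, lift_proj, freeLift_C, wordLift_ι]

lemma proj_eq_freeLift : P.proj = freeLift P.gen :=
  freeZ_algHom_ext fun a => by rw [freeLift_C, wordLift_ι]; rfl

lemma alg_induction {f g : P.Alg →ₗ[K] B} (hs : f 1 = g 1)
    (hg : ∀ (w : P.Alg) (a : Gen), f w = g w → f (w * P.gen a) = g (w * P.gen a)) :
    f = g := by
  have h : f ∘ₗ P.proj.toLinearMap = g ∘ₗ P.proj.toLinearMap := by
    refine freeZ_induction (by simpa using hs) fun w a hw => ?_
    simp only [LinearMap.comp_apply, AlgHom.toLinearMap_apply, map_mul] at hw ⊢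
    exact hg _ a hw
  ext b
  obtain ⟨w, rfl⟩ := P.proj_surjective b
  exact LinearMap.congr_fun h w

lemma alg_hom_ext {f g : P.Alg →ₐ[K] B} (h : ∀ a : Gen, f (P.gen a) = g (P.gen a)) : f = g := by
  refine AlgHom.toLinearMap_injective (alg_induction ?_ fun w a hw => ?_)
  · simp
  · simp only [AlgHom.toLinearMap_apply] at hw ⊢
    rw [map_mul, map_mul, h, hw]

end QuantumData

/-! ## Topological Hopf algebra structures from generators -/

section Tensor

variable (A : Type) [Ring A] [Algebra K A]

lemma zpow_smul_eq_zero {M : Type} [AddCommGroup M] [Module K M] [ZTorsionFree M] {n : ℕ} {a : M}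
    (h : z ^ n • a = 0) : a = 0 := by
  induction n with
  | zero => simpa using h
  | succ n ih =>
    rw [pow_succ', mul_smul] at h
    exact ih (ZTorsionFree.eq_zero _ h)

instance zTorsionFree_tensor [ZTorsionFree A] : ZTorsionFree (A ⊗[K] A) := by
  -- `K` is a discrete valuation ring with uniformizer z, so absence of z-torsion is absence of all
  -- torsion; over such a ring this passes to tensor products.
  have : Module.IsTorsionFree K A := by
    refine ⟨fun r hr => ?_⟩
    obtain ⟨n, u, rfl⟩ := IsDiscreteValuationRing.eq_unit_mul_pow_irreducible hr.ne_zero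
      (PowerSeries.X_irreducible (R := ℝ))
    intro a b hab
    dsimp only at hab
    rw [mul_smul, mul_smul, ← Units.smul_def, ← Units.smul_def] at hab
    have h := smul_left_cancel u hab
    rw [← sub_eq_zero, ← smul_sub] at h
    exact sub_eq_zero.1 (zpow_smul_eq_zero h)
  refine ⟨fun a ha => ?_⟩
  exact (smul_eq_zero.1 ha).resolve_left PowerSeries.X_ne_zero

/-- `a ↦ a ⊗ 1` -/
def inl2 : A →ₐ[K] CTensor2 A := (Completion.of _).comp Algebra.TensorProduct.includeLeft

/-- `a ↦ 1 ⊗ a` -/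
def inr2 : A →ₐ[K] CTensor2 A := (Completion.of _).comp Algebra.TensorProduct.includeRight

variable {A}

lemma of_tmul (a b : A) : Completion.of (A ⊗[K] A) (a ⊗ₜ b) = inl2 A a * inr2 A b := by
  simp [inl2, inr2, ← map_mul]

lemma commute_inl2_inr2 (a b : A) : Commute (inl2 A a) (inr2 A b) := by
  simp [Commute, SemiconjBy, inl2, inr2, ← map_mul]

/-- `a ↦ a ⊗ 1 ⊗ 1` -/
def in1 : A →ₐ[K] CTensor3 A := (Completion.of _).comp
  ((Algebra.TensorProduct.includeLeft : A ⊗[K] A →ₐ[K] (A ⊗[K] A) ⊗[K] A).comp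
    (Algebra.TensorProduct.includeLeft : A →ₐ[K] A ⊗[K] A))

/-- `a ↦ 1 ⊗ a ⊗ 1` -/
def in2 : A →ₐ[K] CTensor3 A := (Completion.of _).comp
  ((Algebra.TensorProduct.includeLeft : A ⊗[K] A →ₐ[K] (A ⊗[K] A) ⊗[K] A).comp
    (Algebra.TensorProduct.includeRight : A →ₐ[K] A ⊗[K] A))

/-- `a ↦ 1 ⊗ 1 ⊗ a` -/
def in3 : A →ₐ[K] CTensor3 A := (Completion.of _).comp
  (Algebra.TensorProduct.includeRight : A →ₐ[K] (A ⊗[K] A) ⊗[K] A)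

lemma commute_in1_in2 (a b : A) : Commute (in1 a) (in2 b) := by
  simp [Commute, SemiconjBy, in1, in2, ← map_mul]

lemma commute_in1_in3 (a b : A) : Commute (in1 a) (in3 b) := by
  simp [Commute, SemiconjBy, in1, in3, ← map_mul]

lemma commute_in2_in3 (a b : A) : Commute (in2 a) (in3 b) := by
  simp [Commute, SemiconjBy, in2, in3, ← map_mul]

/-- `a ⊗ b ↦ a ⊗ b ⊗ 1` -/
def in12 : CTensor2 A →ₐ[K] CTensor3 A :=
  Completion.extendAlgHom ((Completion.of _).comp
    (Algebra.TensorProduct.includeLeft : A ⊗[K] A →ₐ[K] (A ⊗[K] A) ⊗[K] A))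

/-- `a ⊗ b ↦ 1 ⊗ a ⊗ b` -/
def in23 : CTensor2 A →ₐ[K] CTensor3 A :=
  Completion.extendAlgHom ((Completion.of _).comp
    (Algebra.TensorProduct.map (Algebra.TensorProduct.includeRight : A →ₐ[K] A ⊗[K] A)
        (AlgHom.id K A)))

lemma in12_inl2 (a : A) : in12 (inl2 A a) = in1 a := rfl

lemma in12_inr2 (a : A) : in12 (inr2 A a) = in2 a := rfl

lemma in23_inl2 (a : A) : in23 (inl2 A a) = in2 a := rfl

lemma in23_inr2 (a : A) : in23 (inr2 A a) = in3 a := by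
  change Completion.of _ ((1 : A ⊗[K] A) ⊗ₜ[K] a) = _
  rfl

/-- An element commuting with both tensor factors commutes with the tensor square. -/
lemma commute_of_commute_inl2_inr2 {B : Type} [Ring B] [Algebra K B] [ZComplete B]
    (F : CTensor2 A →ₐ[K] B) (b : B) (hl : ∀ a, Commute (F (inl2 A a)) b)
    (hr : ∀ a, Commute (F (inr2 A a)) b) (u : CTensor2 A) : Commute (F u) b := by
  have h : LinearMap.mulRight K b ∘ₗ F.toLinearMap = LinearMap.mulLeft K b ∘ₗ F.toLinearMap := by
    refine Completion.linearMap_ext fun t => ?_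
    induction t with
    | zero => simp
    | add s t hs ht => simp only [map_add, hs, ht]
    | tmul a c =>
      change F (Completion.of (A ⊗[K] A) (a ⊗ₜ c)) * b = b * F (Completion.of (A ⊗[K] A) (a ⊗ₜ c))
      rw [of_tmul, map_mul]
      exact ((hl a).mul_left (hr c)).eq
  exact LinearMap.congr_fun h u

variable (D : A →ₐ[K] CTensor2 A)

lemma commute_in12_in3 (u : CTensor2 A) (b : A) : Commute (in12 u) (in3 b) :=
  commute_of_commute_inl2_inr2 in12 _ (fun c => by rw [in12_inl2]; exact commute_in1_in3 c b)
    (fun c => by rw [in12_inr2]; exact commute_in2_in3 c b) u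

lemma commute_in1_in23 (a : A) (u : CTensor2 A) : Commute (in1 a) (in23 u) :=
  (commute_of_commute_inl2_inr2 in23 _ (fun c => by rw [in23_inl2]; exact
    (commute_in1_in2 a c).symm)
    (fun c => by rw [in23_inr2]; exact (commute_in1_in3 a c).symm) u).symm

/-- `a ⊗ b ↦ D a ⊗ b` as a homomorphism of algebras. -/
def comulTensorIdHom : A ⊗[K] A →ₐ[K] CTensor3 A :=
  Algebra.TensorProduct.lift (in12.comp D) in3 fun a b => commute_in12_in3 (D a) b

/-- `a ⊗ b ↦ a ⊗ D b` as a homomorphism of algebras. -/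
def idTensorComulHom : A ⊗[K] A →ₐ[K] CTensor3 A :=
  Algebra.TensorProduct.lift in1 (in23.comp D) fun a b => commute_in1_in23 a (D b)

lemma comulTensorIdHom_tmul (a b : A) :
    comulTensorIdHom D (a ⊗ₜ b) = in12 (D a) * in3 b :=
  Algebra.TensorProduct.lift_tmul _ _ _ _ _

lemma idTensorComulHom_tmul (a b : A) :
    idTensorComulHom D (a ⊗ₜ b) = in1 a * in23 (D b) :=
  Algebra.TensorProduct.lift_tmul _ _ _ _ _

/-- `D ⊗ id` as a homomorphism of algebras. -/
def comulTensorIdAlg : CTensor2 A →ₐ[K] CTensor3 A := Completion.extendAlgHom (comulTensorIdHom D)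

/-- `id ⊗ D` as a homomorphism of algebras. -/
def idTensorComulAlg : CTensor2 A →ₐ[K] CTensor3 A := Completion.extendAlgHom (idTensorComulHom D)

/-- The linear map in the definition is multiplicative because the images of the two factors
commute. Coassociativity thereby becomes an equality of algebra homomorphisms, to be tested on
generators. -/
lemma comulTensorId_eq : comulTensorId D.toLinearMap = (comulTensorIdAlg D).toLinearMap := by
  have h : LinearMap.mul' K (CTensor3 A) ∘ₗ TensorProduct.map
      (in12.toLinearMap ∘ₗ D.toLinearMap) in3.toLinearMap =
      (comulTensorIdHom D).toLinearMap :=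
    TensorProduct.ext' fun a b => (comulTensorIdHom_tmul D a b).symm
  exact congrArg Completion.extend h

lemma idTensorComul_eq : idTensorComul D.toLinearMap = (idTensorComulAlg D).toLinearMap := by
  have h : LinearMap.mul' K (CTensor3 A) ∘ₗ TensorProduct.map
      in1.toLinearMap (in23.toLinearMap ∘ₗ D.toLinearMap) =
      (idTensorComulHom D).toLinearMap :=
    TensorProduct.ext' fun a b => (idTensorComulHom_tmul D a b).symm
  exact congrArg Completion.extend h

lemma comulTensorIdAlg_inl2 (a : A) : comulTensorIdAlg D (inl2 A a) = in12 (D a) :=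
  (comulTensorIdHom_tmul D a 1).trans (by rw [map_one, mul_one])

lemma comulTensorIdAlg_inr2 (a : A) : comulTensorIdAlg D (inr2 A a) = in3 a :=
  (comulTensorIdHom_tmul D 1 a).trans (by rw [map_one, map_one, one_mul])

lemma idTensorComulAlg_inl2 (a : A) : idTensorComulAlg D (inl2 A a) = in1 a :=
  (idTensorComulHom_tmul D a 1).trans (by rw [map_one, map_one, mul_one])

lemma idTensorComulAlg_inr2 (a : A) : idTensorComulAlg D (inr2 A a) = in23 (D a) :=
  (idTensorComulHom_tmul D 1 a).trans (by rw [map_one, one_mul])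

end Tensor

instance : ZComplete K := zComplete_powerSeries fun _ => rfl

/-! ### Counit and antipode maps on the completed tensor square -/

section Antipode

variable {A : Type} [Ring A] [Algebra K A]

/-- `a ⊗ b ↦ ε a • b` -/
def counitLeft (ε : A →ₐ[K] K) : CTensor2 A →ₐ[K] Completion A :=
  Completion.extendAlgHom ((Completion.of A).comp
    ((Algebra.TensorProduct.lid K A : K ⊗[K] A →ₐ[K] A).comp
      (Algebra.TensorProduct.map ε (AlgHom.id K A))))

/-- `a ⊗ b ↦ ε b • a` -/
def counitRight (ε : A →ₐ[K] K) : CTensor2 A →ₐ[K] Completion A :=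
  Completion.extendAlgHom ((Completion.of A).comp
    ((Algebra.TensorProduct.rid K K A : A ⊗[K] K →ₐ[K] A).comp
      (Algebra.TensorProduct.map (AlgHom.id K A) ε)))

lemma counitLeft_eq (ε : A →ₐ[K] K) : Completion.map
    ((TensorProduct.lid K A).toLinearMap ∘ₗ ε.toLinearMap.rTensor A) =
      (counitLeft ε).toLinearMap := rfl

lemma counitRight_eq (ε : A →ₐ[K] K) : Completion.map
    ((TensorProduct.rid K A).toLinearMap ∘ₗ ε.toLinearMap.lTensor A) =
      (counitRight ε).toLinearMap := rfl

lemma counitLeft_inl2 (ε : A →ₐ[K] K) (a : A) :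
    counitLeft ε (inl2 A a) = algebraMap K _ (ε a) := by
  change Completion.of A ((TensorProduct.lid K A) (ε a ⊗ₜ 1)) = _
  rw [TensorProduct.lid_tmul, map_smul, map_one, Algebra.algebraMap_eq_smul_one]

lemma counitLeft_inr2 (ε : A →ₐ[K] K) (a : A) :
    counitLeft ε (inr2 A a) = Completion.of A a := by
  change Completion.of A ((TensorProduct.lid K A) (ε 1 ⊗ₜ a)) = _
  rw [TensorProduct.lid_tmul, map_one, one_smul]

lemma counitRight_inl2 (ε : A →ₐ[K] K) (a : A) :
    counitRight ε (inl2 A a) = Completion.of A a := by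
  change Completion.of A ((TensorProduct.rid K A) (a ⊗ₜ ε 1)) = _
  rw [TensorProduct.rid_tmul, map_one, one_smul]

lemma counitRight_inr2 (ε : A →ₐ[K] K) (a : A) :
    counitRight ε (inr2 A a) = algebraMap K _ (ε a) := by
  change Completion.of A ((TensorProduct.rid K A) (1 ⊗ₜ ε a)) = _
  rw [TensorProduct.rid_tmul, map_smul, map_one, Algebra.algebraMap_eq_smul_one]

/-- An antihomomorphism as a linear endomorphism. -/
def antiLin (S : A →ₐ[K] Aᵐᵒᵖ) : A →ₗ[K] A :=
  (MulOpposite.opLinearEquiv K).symm.toLinearMap ∘ₗ S.toLinearMap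

/-- `a ⊗ b ↦ S a * b` -/
def antipodeLeft (S : A →ₐ[K] Aᵐᵒᵖ) : CTensor2 A →ₗ[K] Completion A :=
  Completion.map (LinearMap.mul' K A ∘ₗ (antiLin S).rTensor A)

/-- `a ⊗ b ↦ a * S b` -/
def antipodeRight (S : A →ₐ[K] Aᵐᵒᵖ) : CTensor2 A →ₗ[K] Completion A :=
  Completion.map (LinearMap.mul' K A ∘ₗ (antiLin S).lTensor A)

lemma antipodeLeft_mul_tmul (S : A →ₐ[K] Aᵐᵒᵖ) (a b : A) :
    antipodeLeft S (inl2 A a * inr2 A b) = Completion.of A ((S a).unop * b) := by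
  rw [← of_tmul]; rfl

lemma antipodeRight_mul_tmul (S : A →ₐ[K] Aᵐᵒᵖ) (a b : A) :
    antipodeRight S (inl2 A a * inr2 A b) = Completion.of A (a * (S b).unop) := by
  rw [← of_tmul]; rfl

lemma linearMap_ext_tmul {B : Type} [Ring B] [Algebra K B] [ZComplete B]
    {f g : CTensor2 A →ₗ[K] B}
    (h : ∀ a b, f (inl2 A a * inr2 A b) = g (inl2 A a * inr2 A b)) : f = g := by
  refine Completion.linearMap_ext fun t => ?_
  induction t with
  | zero => simp only [map_zero]
  | add s t hs ht => simp only [map_add, hs, ht]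
  | tmul a b => rw [of_tmul, h]

lemma mul_inl2_mul_inr2 (a b c d : A) : inl2 A a * inr2 A b * (inl2 A c * inr2 A d) =
    inl2 A (a * c) * inr2 A (b * d) := by
  rw [map_mul, map_mul, mul_assoc, ← mul_assoc (inr2 A b), ← (commute_inl2_inr2 c b).eq]
  simp only [mul_assoc]

/-- For antimultiplicative S, applying m(S ⊗ id) to u (c ⊗ d) gives S(c) · m(S ⊗ id)(u) · d, and a
scalar in the middle can be pulled out. So the antipode axiom passes from two elements to their
product although the map is not multiplicative. -/
lemma antipodeLeft_mul (S : A →ₐ[K] Aᵐᵒᵖ) {u : CTensor2 A} {e : K}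
    (hu : antipodeLeft S u = algebraMap K _ e) (v : CTensor2 A) :
    antipodeLeft S (u * v) = e • antipodeLeft S v := by
  have h1 : ∀ c d : A, antipodeLeft S (u * (inl2 A c * inr2 A d)) =
      Completion.of A (S c).unop * antipodeLeft S u * Completion.of A d := by
    intro c d
    have h : antipodeLeft S ∘ₗ LinearMap.mulRight K (inl2 A c * inr2 A d) =
        LinearMap.mulLeft K (Completion.of A (S c).unop) ∘ₗ
          LinearMap.mulRight K (Completion.of A d) ∘ₗ antipodeLeft S := by
      refine linearMap_ext_tmul fun a b => ?_
      simp only [LinearMap.comp_apply, LinearMap.mulRight_apply, LinearMap.mulLeft_apply]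
      rw [mul_inl2_mul_inr2, antipodeLeft_mul_tmul, antipodeLeft_mul_tmul, map_mul S,
        MulOpposite.unop_mul]
      simp only [map_mul, mul_assoc]
    rw [mul_assoc]
    exact LinearMap.congr_fun h u
  have h2 : antipodeLeft S ∘ₗ LinearMap.mulLeft K u = e • antipodeLeft S := by
    refine linearMap_ext_tmul fun c d => ?_
    rw [LinearMap.comp_apply, LinearMap.mulLeft_apply, h1, hu, LinearMap.smul_apply,
      antipodeLeft_mul_tmul, ← Algebra.commutes, mul_assoc, ← map_mul, Algebra.smul_def]
  exact LinearMap.congr_fun h2 v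

lemma antipodeRight_mul (S : A →ₐ[K] Aᵐᵒᵖ) {v : CTensor2 A} {e : K}
    (hv : antipodeRight S v = algebraMap K _ e) (u : CTensor2 A) :
    antipodeRight S (u * v) = e • antipodeRight S u := by
  have h1 : ∀ c d : A, antipodeRight S (inl2 A c * inr2 A d * v) =
      Completion.of A c * antipodeRight S v * Completion.of A (S d).unop := by
    intro c d
    have h : antipodeRight S ∘ₗ LinearMap.mulLeft K (inl2 A c * inr2 A d) =
        LinearMap.mulLeft K (Completion.of A c) ∘ₗ
          LinearMap.mulRight K (Completion.of A (S d).unop) ∘ₗ antipodeRight S := by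
      refine linearMap_ext_tmul fun a b => ?_
      simp only [LinearMap.comp_apply, LinearMap.mulRight_apply, LinearMap.mulLeft_apply]
      rw [mul_inl2_mul_inr2, antipodeRight_mul_tmul, antipodeRight_mul_tmul, map_mul S,
        MulOpposite.unop_mul]
      simp only [map_mul, mul_assoc]
    rw [mul_assoc (Completion.of A c)]
    exact LinearMap.congr_fun h v
  have h2 : antipodeRight S ∘ₗ LinearMap.mulRight K v = e • antipodeRight S := by
    refine linearMap_ext_tmul fun c d => ?_
    rw [LinearMap.comp_apply, LinearMap.mulRight_apply, h1, hv, LinearMap.smul_apply,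
      antipodeRight_mul_tmul, ← Algebra.commutes, mul_assoc, ← map_mul, Algebra.smul_def]
  exact LinearMap.congr_fun h2 u

end Antipode

/-! ### Hopf algebra axioms on an element -/

section Axioms

variable {A : Type} [Ring A] [Algebra K A]

/-- The Hopf algebra axioms for the element `a`. -/
structure HopfAxiomsAt (D : A →ₐ[K] CTensor2 A) (ε : A →ₐ[K] K) (S : A →ₐ[K] Aᵐᵒᵖ) (a : A) :
    Prop where
  coassoc : comulTensorIdAlg D (D a) = idTensorComulAlg D (D a)
  counit_left : counitLeft ε (D a) = Completion.of A a
  counit_right : counitRight ε (D a) = Completion.of A a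
  antipode_left : antipodeLeft S (D a) = algebraMap K _ (ε a)
  antipode_right : antipodeRight S (D a) = algebraMap K _ (ε a)

/-- A topological Hopf algebra structure on a presented algebra can be checked on generators. -/
def topHopfOfGenerators {P : QuantumData} (D : P.Alg →ₐ[K] CTensor2 P.Alg) (ε : P.Alg →ₐ[K] K)
    (S : P.Alg →ₐ[K] P.Algᵐᵒᵖ) (h : ∀ g, HopfAxiomsAt D ε S (P.gen g)) :
    TopHopfStructure P.Alg where
  comul := D
  counit := ε
  antipode := antiLin S
  coassoc a := by
    rw [comulTensorId_eq, idTensorComul_eq]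
    exact AlgHom.congr_fun (QuantumData.alg_hom_ext (f := (comulTensorIdAlg D).comp D)
      (g := (idTensorComulAlg D).comp D) fun g => (h g).coassoc) a
  counit_left a := by
    rw [counitLeft_eq]
    exact AlgHom.congr_fun (QuantumData.alg_hom_ext (f := (counitLeft ε).comp D)
      (g := Completion.of P.Alg) fun g => (h g).counit_left) a
  counit_right a := by
    rw [counitRight_eq]
    exact AlgHom.congr_fun (QuantumData.alg_hom_ext (f := (counitRight ε).comp D)
      (g := Completion.of P.Alg) fun g => (h g).counit_right) a
  antipode_left a := by
    have key : antipodeLeft S ∘ₗ D.toLinearMap =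
        Algebra.linearMap K (Completion P.Alg) ∘ₗ ε.toLinearMap := by
      refine QuantumData.alg_induction ?_ fun w g hw => ?_
      · simpa using antipodeLeft_mul_tmul S 1 1
      · simp only [LinearMap.comp_apply, AlgHom.toLinearMap_apply, Algebra.linearMap_apply,
          map_mul] at hw ⊢
        rw [antipodeLeft_mul S hw, (h g).antipode_left, Algebra.smul_def]
    rw [AlgHom.commutes]
    exact LinearMap.congr_fun key a
  antipode_right a := by
    have key : antipodeRight S ∘ₗ D.toLinearMap =
        Algebra.linearMap K (Completion P.Alg) ∘ₗ ε.toLinearMap := by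
      refine QuantumData.alg_induction ?_ fun w g hw => ?_
      · simpa using antipodeRight_mul_tmul S 1 1
      · simp only [LinearMap.comp_apply, AlgHom.toLinearMap_apply, Algebra.linearMap_apply,
          map_mul] at hw ⊢
        rw [antipodeRight_mul S (h g).antipode_right, hw, Algebra.smul_def, Algebra.commutes]
    rw [AlgHom.commutes]
    exact LinearMap.congr_fun key a

variable [ZComplete A] {D : A →ₐ[K] CTensor2 A} {ε : A →ₐ[K] K} {S : A →ₐ[K] Aᵐᵒᵖ}

/-- The Hopf algebra axioms for a twisted primitive element. -/
lemma HopfAxiomsAt.of_twistedPrimitive {a h : A} (hDh : D h = inl2 A h + inr2 A h)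
    (hDa : D a = E (inl2 A h) * inr2 A a + inl2 A a * E (-inr2 A h)) (hεh : ε h = 0)
    (hεa : ε a = 0) (hSh : S h = MulOpposite.op (-h))
    (hSa : S a = MulOpposite.op (-(E (-h) * a * E h))) : HopfAxiomsAt D ε S a where
  coassoc := by
    rw [hDa]
    simp only [map_add, map_mul, map_neg, map_E, comulTensorIdAlg_inl2, comulTensorIdAlg_inr2,
      idTensorComulAlg_inl2, idTensorComulAlg_inr2, hDh, hDa, in12_inl2, in12_inr2, in23_inl2,
      in23_inr2]
    -- As h is primitive, its exponentials are grouplike, and both sides are e^{zh} ⊗ e^{zh} ⊗ a +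
    -- e^{zh} ⊗ a ⊗ e^{-zh} + a ⊗ e^{-zh} ⊗ e^{-zh}.
    rw [E_add (commute_in1_in2 h h), neg_add, E_add (commute_in2_in3 h h).neg_left.neg_right]
    noncomm_ring
  counit_left := by
    rw [hDa]
    simp only [map_add, map_mul, map_neg, map_E, counitLeft_inl2, counitLeft_inr2, hεh, hεa,
      map_zero, E_zero, one_mul, zero_mul, add_zero]
  counit_right := by
    rw [hDa]
    simp only [map_add, map_mul, map_neg, map_E, counitRight_inl2, counitRight_inr2, hεh, hεa,
      map_zero, E_zero, mul_one, mul_zero, zero_add, neg_zero]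
  antipode_left := by
    rw [hDa, ← map_E, ← map_neg, ← map_E, map_add, antipodeLeft_mul_tmul, antipodeLeft_mul_tmul,
      map_E, hSh, hSa, E_op, MulOpposite.unop_op, MulOpposite.unop_op, neg_mul, mul_assoc _ (E h),
      E_mul_E_neg, mul_one, ← map_add, add_neg_cancel, hεa, map_zero, map_zero]
  antipode_right := by
    rw [hDa, ← map_E, ← map_neg, ← map_E, map_add, antipodeRight_mul_tmul, antipodeRight_mul_tmul,
      map_E, map_neg, hSh, hSa, ← MulOpposite.op_neg, E_op, MulOpposite.unop_op,
      MulOpposite.unop_op, neg_neg, mul_neg, ← mul_assoc, ← mul_assoc, E_mul_E_neg, one_mul,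
      ← map_add, neg_add_cancel, hεa, map_zero, map_zero]

/-- The Hopf algebra axioms for a primitive element. -/
lemma HopfAxiomsAt.of_primitive {a : A} (hDa : D a = inl2 A a + inr2 A a) (hεa : ε a = 0)
    (hSa : S a = MulOpposite.op (-a)) : HopfAxiomsAt D ε S a :=
  HopfAxiomsAt.of_twistedPrimitive (h := 0) (by simp) (by simp [hDa, E_zero, add_comm])
    (by simp) hεa (by simp) (by simp [hSa, E_zero])

end Axioms

/-! ## Quantizations from deforming maps -/

lemma mem_span_z_pow_smul_top {M : Type} [AddCommGroup M] [Module K M] {n : ℕ} {a : M} :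
    a ∈ ((Ideal.span {z}) ^ n • ⊤ : Submodule K M) ↔ ∃ b : M, a = z ^ n • b := by
  rw [Ideal.span_singleton_pow, Submodule.ideal_span_singleton_smul,
    Submodule.mem_smul_pointwise_iff_exists]
  exact ⟨fun ⟨b, _, hb⟩ => ⟨b, hb.symm⟩, fun ⟨b, hb⟩ => ⟨b, trivial, hb.symm⟩⟩

lemma isAdicComplete_of_zComplete (B : Type) [Ring B] [Algebra K B] [ZComplete B] :
    IsAdicComplete (Ideal.span {z}) B where
  haus' b hb := ZComplete.sep b fun n => by
    simpa [SModEq.sub_mem, mem_span_z_pow_smul_top] using hb n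
  prec' f hf := by
    have h : ∀ n, ∃ d : B, f (n + 1) - f n = z ^ n • d := fun n =>
      mem_span_z_pow_smul_top.1 (SModEq.sub_mem.1 (hf n.le_succ).symm)
    choose d hd using h
    -- Telescoping: correcting f n by the tail of its increments gives the same element for every n,
    -- which is the limit.
    have ht : ∀ n, f n + z ^ n • (zsum fun j => d (n + j)) = f 0 + zsum d := by
      intro n
      induction n with
      | zero => simp
      | succ n ih =>
        rw [← ih, zsum_succ fun j => d (n + j), sub_eq_iff_eq_add.1 (hd n)]
        simp only [add_zero, add_assoc, add_comm 1]
        module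
    refine ⟨f 0 + zsum d, fun n => ?_⟩
    rw [SModEq.comm, SModEq.sub_mem, mem_span_z_pow_smul_top]
    exact ⟨_, by rw [← ht n, add_sub_cancel_left]⟩

lemma topFree_of_zComplete (B : Type) [Ring B] [Algebra K B] [ZComplete B] [ZTorsionFree B] :
    TopFree B :=
  ⟨isAdicComplete_of_zComplete B, ZTorsionFree.eq_zero⟩

lemma algebraMap_of_z_smul {L : Type} [Ring L] [Algebra K L] (hz : ∀ b : L, z • b = 0) (r : K) :
    algebraMap K L (PowerSeries.C (PowerSeries.constantCoeff r)) = algebraMap K L r := by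
  have h : r = PowerSeries.C (PowerSeries.constantCoeff r) + z *
      PowerSeries.mk fun n => PowerSeries.coeff (n + 1) r := by
    ext n
    cases n <;> simp [PowerSeries.coeff_succ_X_mul, PowerSeries.coeff_succ_C]
  conv_rhs => rw [h]
  rw [map_add, map_mul, Algebra.algebraMap_eq_smul_one z, smul_mul_assoc, hz, add_zero]

lemma z_smul_level_one {S : Type} [Ring S] [Algebra K S] (b : Level S 1) : z • b = 0 := by
  simpa using zpow_smul_level 1 b

/-- The linear combination of the images of the generators with the coordinates of an element of
the double. -/
def evalDouble (B : LieBialgebra) {L : Type} [AddCommGroup L] [Module K L] (G : Gen → L)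
    (u : B.Double) : L :=
  ∑ i, (PowerSeries.C (u.1 i) : K) • G (Sum.inl i) +
    ∑ i, (PowerSeries.C (u.2 i) : K) • G (Sum.inr i)

lemma evalDouble_gen (B : LieBialgebra) {L : Type} [AddCommGroup L] [Module K L] (G : Gen → L)
    (g : Gen) : evalDouble B G (B.gen g) = G g := by
  rcases g with i | i <;> fin_cases i <;>
    simp [evalDouble, LieBialgebra.gen, Fin.sum_univ_three]

lemma double_eq_sum (B : LieBialgebra) (u : B.Double) :
    u = ∑ i, u.1 i • B.gen (Sum.inl i) +
    ∑ i, u.2 i • B.gen (Sum.inr i) := by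
  have h1 : ∀ v : Fin 3 → ℝ, v = ∑ i, v i • Pi.single i (1 : ℝ) := fun v => by
    ext j; fin_cases j <;> simp [Fin.sum_univ_three]
  have key : ∀ v w : Fin 3 → ℝ, ((v, w) : (Fin 3 → ℝ) × (Fin 3 → ℝ)) =
      ∑ i, v i • ((Pi.single i 1, 0) : (Fin 3 → ℝ) × (Fin 3 → ℝ)) +
        ∑ i, w i • ((0, Pi.single i 1) : (Fin 3 → ℝ) × (Fin 3 → ℝ)) := fun v w => by
    ext j <;> fin_cases j <;> simp [Fin.sum_univ_three]
  exact key u.1 u.2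

/-! ### From a deforming map to the classical limit and torsion-freeness -/

section UEA

attribute [local instance] seriesAlgebra

variable (B : LieBialgebra)

lemma z_smul_series {R : Type} [Ring R] [Algebra ℝ R] (f : R⟦X⟧) :
    z • f = PowerSeries.X * f := by
  rw [Algebra.smul_def]
  change PowerSeries.map (algebraMap ℝ R) PowerSeries.X * f = _
  rw [PowerSeries.map_X]

instance zComplete_series {R : Type} [Ring R] [Algebra ℝ R] : ZComplete R⟦X⟧ :=
  zComplete_powerSeries z_smul_series

instance zTorsionFree_series {R : Type} [Ring R] [Algebra ℝ R] : ZTorsionFree R⟦X⟧ :=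
  zTorsionFree_powerSeries z_smul_series

lemma constantCoeff_smul_series {R : Type} [Ring R] [Algebra ℝ R] (r : K) (f : R⟦X⟧) :
    PowerSeries.constantCoeff (r • f) =
      PowerSeries.constantCoeff r • PowerSeries.constantCoeff f := by
  rw [Algebra.smul_def]
  change PowerSeries.constantCoeff (PowerSeries.map (algebraMap ℝ R) r * f) = _
  rw [map_mul, Algebra.smul_def, ← PowerSeries.coeff_zero_eq_constantCoeff_apply,
    PowerSeries.coeff_map, PowerSeries.coeff_zero_eq_constantCoeff_apply]

variable {B} {P : QuantumData} (φ : P.Alg →ₐ[K] (UniversalEnvelopingAlgebra ℝ B.Double)⟦X⟧)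

/-- The classical limit of a deforming map. -/
def classicalMap : P.Alg →+* UniversalEnvelopingAlgebra ℝ B.Double :=
  PowerSeries.constantCoeff.comp φ.toRingHom

lemma classicalMap_smul (r : K) (a : P.Alg) :
    classicalMap φ (r • a) = PowerSeries.constantCoeff r • classicalMap φ a := by
  change PowerSeries.constantCoeff (φ (r • a)) = _
  rw [map_smul, constantCoeff_smul_series]
  rfl

lemma classicalMap_z_smul (a : P.Alg) : classicalMap φ (z • a) = 0 := by
  rw [classicalMap_smul]; simp

attribute [local instance] LieRing.ofAssociativeRing

/-- The images of the generators in `A / z A`. -/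
def levelGen (P : QuantumData) (g : Gen) : Level P.Alg 1 := RingCon.mkₐ K (zCon P.Alg 1) (P.gen g)

/-- The homomorphism from the enveloping algebra of the double to `A / z A`. -/
lemma exists_section
    (hlie : ∀ u v : B.Double, evalDouble B (levelGen P) ⁅u, v⁆ =
      evalDouble B (levelGen P) u * evalDouble B (levelGen P) v -
        evalDouble B (levelGen P) v * evalDouble B (levelGen P) u) :
    ∃ ψ : UniversalEnvelopingAlgebra ℝ B.Double →+* Level P.Alg 1,
      (∀ r : ℝ, ψ (algebraMap ℝ _ r) = algebraMap K _ (PowerSeries.C r)) ∧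
      ∀ g, ψ (UniversalEnvelopingAlgebra.ι ℝ (B.gen g)) = levelGen P g := by
  let _ := realAlgebra (Level P.Alg 1)
  have hadd : ∀ u v : B.Double, evalDouble B (levelGen P) (u + v) =
      evalDouble B (levelGen P) u + evalDouble B (levelGen P) v := by
    intro u v
    change ∑ i, (PowerSeries.C (u.1 i + v.1 i) : K) • levelGen P (Sum.inl i) +
      ∑ i, (PowerSeries.C (u.2 i + v.2 i) : K) • levelGen P (Sum.inr i) = _
    simp only [evalDouble, map_add, add_smul, Finset.sum_add_distrib]
    abel
  have hsmul : ∀ (r : ℝ) (u : B.Double), evalDouble B (levelGen P) (r • u) =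
      r • evalDouble B (levelGen P) u := by
    intro r u
    change ∑ i, (PowerSeries.C (r * u.1 i) : K) • levelGen P (Sum.inl i) +
      ∑ i, (PowerSeries.C (r * u.2 i) : K) • levelGen P (Sum.inr i) =
        (PowerSeries.C r : K) • evalDouble B (levelGen P) u
    simp only [evalDouble, map_mul, mul_smul, Finset.smul_sum, smul_add]
  let f : B.Double →ₗ⁅ℝ⁆ Level P.Alg 1 :=
    { toFun := evalDouble B (levelGen P)
      map_add' := hadd
      map_smul' := hsmul
      map_lie' := fun {u v} => hlie u v }
  refine ⟨(UniversalEnvelopingAlgebra.lift ℝ f).toRingHom,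
    fun r => (UniversalEnvelopingAlgebra.lift ℝ f).commutes r, fun g => ?_⟩
  exact (UniversalEnvelopingAlgebra.lift_ι_apply ℝ f (B.gen g)).trans (evalDouble_gen B _ g)

/-- The map U(D) → A/zA of `exists_section`, composed with π, agrees with the reduction A → A/zA on
generators, hence everywhere; so π(a) = 0 forces a ∈ zA. Surjectivity holds because U(D) is
generated by D. -/
lemma classicalMap_properties
    (hφ : ∀ g, PowerSeries.constantCoeff (φ (P.gen g)) =
      UniversalEnvelopingAlgebra.ι ℝ (B.gen g))
    (hlie : ∀ u v : B.Double, evalDouble B (levelGen P) ⁅u, v⁆ =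
      evalDouble B (levelGen P) u * evalDouble B (levelGen P) v -
        evalDouble B (levelGen P) v * evalDouble B (levelGen P) u) :
    Function.Surjective (classicalMap φ) ∧
      ∀ a : P.Alg, classicalMap φ a = 0 ↔ ∃ b : P.Alg, a = z • b := by
  obtain ⟨ψ, hψr, hψ⟩ := exists_section hlie
  have hπg : ∀ g, classicalMap φ (P.gen g) = UniversalEnvelopingAlgebra.ι ℝ (B.gen g) := hφ
  let F : P.Alg →ₐ[K] Level P.Alg 1 :=
    { ψ.comp (classicalMap φ) with
      commutes' := fun r => by
        change ψ (classicalMap φ (algebraMap K P.Alg r)) = _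
        rw [Algebra.algebraMap_eq_smul_one, classicalMap_smul, map_one,
          ← Algebra.algebraMap_eq_smul_one, hψr, algebraMap_of_z_smul z_smul_level_one] }
  have hF : F = RingCon.mkₐ K (zCon P.Alg 1) := by
    refine QuantumData.alg_hom_ext fun g => ?_
    change ψ (classicalMap φ (P.gen g)) = _
    rw [hπg, hψ]
    rfl
  refine ⟨fun u => ?_, fun a => ⟨fun ha => ?_, ?_⟩⟩
  · let R : Subalgebra ℝ (UniversalEnvelopingAlgebra ℝ B.Double) :=
      { (classicalMap φ).range with
        algebraMap_mem' := fun r => ⟨algebraMap K _ (PowerSeries.C r), by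
          rw [Algebra.algebraMap_eq_smul_one, classicalMap_smul, map_one,
            PowerSeries.constantCoeff_C, ← Algebra.algebraMap_eq_smul_one]⟩ }
    have hR : ∀ v : B.Double, UniversalEnvelopingAlgebra.ι ℝ v ∈ R := by
      intro v
      rw [double_eq_sum B v]
      simp only [map_add, map_sum, map_smul]
      refine R.add_mem (R.sum_mem fun i _ => R.smul_mem ⟨P.gen _, hπg _⟩ _)
        (R.sum_mem fun i _ => R.smul_mem ⟨P.gen _, hπg _⟩ _)
    let f : B.Double →ₗ⁅ℝ⁆ R :=
      { toFun := fun v => ⟨UniversalEnvelopingAlgebra.ι ℝ v, hR v⟩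
        map_add' := fun v w => Subtype.ext (map_add (UniversalEnvelopingAlgebra.ι ℝ) v w)
        map_smul' := fun r v => Subtype.ext (map_smul (UniversalEnvelopingAlgebra.ι ℝ) r v)
        map_lie' := fun {v w} => Subtype.ext (LieHom.map_lie (UniversalEnvelopingAlgebra.ι ℝ) v w) }
    -- The image R of π contains D, so ι factors through R; by uniqueness in the universal property
    -- the lift followed by the inclusion is the identity, and R is everything.
    have hid : R.val.comp (UniversalEnvelopingAlgebra.lift ℝ f) =
        AlgHom.id ℝ (UniversalEnvelopingAlgebra ℝ B.Double) := by
      refine UniversalEnvelopingAlgebra.hom_ext ℝ ?_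
      ext v
      change ((UniversalEnvelopingAlgebra.lift ℝ f (UniversalEnvelopingAlgebra.ι ℝ v) : R) :
        UniversalEnvelopingAlgebra ℝ B.Double) = UniversalEnvelopingAlgebra.ι ℝ v
      rw [UniversalEnvelopingAlgebra.lift_ι_apply]
      rfl
    obtain ⟨a, ha⟩ := (UniversalEnvelopingAlgebra.lift ℝ f u).2
    exact ⟨a, ha.trans (AlgHom.congr_fun hid u)⟩
  · have h : RingCon.mkₐ K (zCon P.Alg 1) a = 0 := by
      rw [← hF]
      change ψ (classicalMap φ a) = 0
      rw [ha, map_zero]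
    obtain ⟨b, hb⟩ := level_eq_iff.1 (show (a : Level P.Alg 1) = (0 : P.Alg) from h)
    exact ⟨b, by simpa using hb⟩
  · rintro ⟨b, rfl⟩
    exact classicalMap_z_smul φ b

/-- The kernel of φ is stable under division by z: if φ(a) = 0 then a = z b by the description of
ker π, and φ(b) = 0 because the target has no torsion. Separatedness makes φ injective, so torsion
cannot survive. -/
lemma zTorsionFree_of_deformingMap
    (hker : ∀ a : P.Alg, classicalMap φ a = 0 ↔ ∃ b : P.Alg, a = z • b) : ZTorsionFree P.Alg where
  eq_zero a ha := by
    have hφa : φ a = 0 := ZTorsionFree.eq_zero _ (by rw [← map_smul, ha, map_zero])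
    have hstep : ∀ i : {a : P.Alg // φ a = 0}, ∃ j : {a : P.Alg // φ a = 0},
        (i : P.Alg) = z • (j : P.Alg) := by
      rintro ⟨a, ha⟩
      obtain ⟨b, rfl⟩ := (hker a).1 (by change PowerSeries.constantCoeff (φ a) = 0; simp [ha])
      exact ⟨⟨b, ZTorsionFree.eq_zero _ (by rw [← map_smul, ha])⟩, rfl⟩
    exact eq_zero_of_step (fun i : {a : P.Alg // φ a = 0} => (i : P.Alg)) hstep ⟨a, hφa⟩

/-- A deforming map to `U(D)⟦z⟧` and the values of the structure maps on the generators yield a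
Hopf quantization. -/
theorem isHopfQuantization_of_deformingMap
    (hφ : ∀ g, PowerSeries.constantCoeff (φ (P.gen g)) =
      UniversalEnvelopingAlgebra.ι ℝ (B.gen g))
    (hlie : ∀ u v : B.Double, evalDouble B (levelGen P) ⁅u, v⁆ =
      evalDouble B (levelGen P) u * evalDouble B (levelGen P) v -
        evalDouble B (levelGen P) v * evalDouble B (levelGen P) u)
    (hHopf : ZTorsionFree P.Alg → ∃ (D : P.Alg →ₐ[K] CTensor2 P.Alg) (ε : P.Alg →ₐ[K] K)
      (S : P.Alg →ₐ[K] P.Algᵐᵒᵖ), ∀ g, HopfAxiomsAt D ε S (P.gen g) ∧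
        D (P.gen g) = Completion.of _ (Algebra.TensorProduct.map P.proj P.proj (P.coprod g)) ∧
        ε (P.gen g) = 0 ∧ ∃ b : CTensor2 P.Alg, D (P.gen g) =
          inr2 _ (P.gen g) + inl2 _ (P.gen g) - z • ∑ l : Gen, ∑ m : Gen,
            (PowerSeries.C (B.cocomm g l m) : K) • (inl2 _ (P.gen l) * inr2 _ (P.gen m)) +
              z ^ 2 • b) :
    IsHopfQuantization B P := by
  obtain ⟨hsurj, hker⟩ := classicalMap_properties φ hφ hlie
  have htf := zTorsionFree_of_deformingMap φ hker
  obtain ⟨D, ε, S, h⟩ := hHopf htf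
  refine ⟨topFree_of_zComplete _, ⟨classicalMap φ, classicalMap_smul φ, hsurj, hker, hφ⟩,
    topHopfOfGenerators D ε S fun g => (h g).1, fun g => (h g).2.1, fun g => (h g).2.2.1,
    fun g => ?_⟩
  obtain ⟨b, hb⟩ := (h g).2.2.2
  refine ⟨b, hb.trans ?_⟩
  simp only [map_add, map_sub, map_smul, map_sum, of_tmul, map_one, mul_one, one_mul]

end UEA

/-! ## The quantum double of `(𝔯₃(ρ), 𝔫₃)` -/

lemma mul_mul_of_mul_eq {B : Type} [Ring B] {a b c : B} (h : a * b = c) (d : B) :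
    a * (b * d) = c * d := by rw [← mul_assoc, h]

lemma comm_sub_eq_zero_iff {B : Type} [Ring B] {a b c : B} :
    a * b - b * a - c = 0 ↔ a * b = b * a + c := by
  rw [sub_eq_zero, sub_eq_iff_eq_add, add_comm c]

lemma comm_eq_zero_iff {B : Type} [Ring B] {a b : B} : a * b - b * a = 0 ↔ a * b = b * a :=
  sub_eq_zero

lemma mul_left_comm_of_comm {B : Type} [Ring B] {a b : B} (h : a * b = b * a) (d : B) :
    a * (b * d) = b * (a * d) := by rw [← mul_assoc, h, mul_assoc]

section RelA

variable {B : Type} [Ring B] [Algebra K B] [ZComplete B]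

/-- The relations of the quantum double of `(𝔯₃(κ), 𝔫₃)`. -/
structure RelA (κ : K) (G : Gen → B) : Prop where
  x0x1 : G (.inl 0) * G (.inl 1) = G (.inl 1) * G (.inl 0) + G (.inl 1)
  x0x2 : G (.inl 0) * G (.inl 2) = G (.inl 2) * G (.inl 0) + κ • G (.inl 2)
  x1x2 : G (.inl 1) * G (.inl 2) = G (.inl 2) * G (.inl 1)
  X0X1 : G (.inr 0) * G (.inr 1) = G (.inr 1) * G (.inr 0)
  X0X2 : G (.inr 0) * G (.inr 2) = G (.inr 2) * G (.inr 0)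
  X1X2 : G (.inr 1) * G (.inr 2) = G (.inr 2) * G (.inr 1) + Sh ((1 + κ) • G (.inr 0))
  x0X0 : G (.inl 0) * G (.inr 0) = G (.inr 0) * G (.inl 0)
  x1X0 : G (.inl 1) * G (.inr 0) = G (.inr 0) * G (.inl 1)
  x2X0 : G (.inl 2) * G (.inr 0) = G (.inr 0) * G (.inl 2)
  x0X1 : G (.inl 0) * G (.inr 1) = G (.inr 1) * G (.inl 0) +
    ((1 + κ) • (G (.inl 2) * Ch (G (.inr 0))) - G (.inr 1))
  x1X1 : G (.inl 1) * G (.inr 1) = G (.inr 1) * G (.inl 1) + Sh (G (.inr 0))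
  x2X1 : G (.inl 2) * G (.inr 1) = G (.inr 1) * G (.inl 2)
  x0X2 : G (.inl 0) * G (.inr 2) = G (.inr 2) * G (.inl 0) +
    (-((1 + κ) • (G (.inl 1) * Ch (κ • G (.inr 0)))) - κ • G (.inr 2))
  x1X2 : G (.inl 1) * G (.inr 2) = G (.inr 2) * G (.inl 1)
  x2X2 : G (.inl 2) * G (.inr 2) = G (.inr 2) * G (.inl 2) + Sh (κ • G (.inr 0))

lemma relA_iff (ρ : ℝ) (G : Gen → B) :
    (∀ r ∈ (quantumA ρ).rels, freeLift G r = 0) ↔ RelA (PowerSeries.C ρ) G := by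
  simp only [quantumA, Set.mem_insert_iff, Set.mem_singleton_iff, forall_eq_or_imp, forall_eq,
    map_sub, map_mul, map_neg, freeLift_comm, freeLift_xz, freeLift_Xz, freeLift_smul,
    freeLift_coshZ, freeLift_sinhDivZ, wordLift_smul, wordLift_X, comm_sub_eq_zero_iff,
    map_add, map_one, comm_eq_zero_iff]
  constructor
  · rintro ⟨h1, h2, h3, h4, h5, h6, h7, h8, h9, h10, h11, h12, h13, h14, h15⟩
    exact ⟨h1, h2, h3, h4, h5, h6, h7, h8, h9, h10, h11, h12, h13, h14, h15⟩
  · rintro ⟨h1, h2, h3, h4, h5, h6, h7, h8, h9, h10, h11, h12, h13, h14, h15⟩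
    exact ⟨h1, h2, h3, h4, h5, h6, h7, h8, h9, h10, h11, h12, h13, h14, h15⟩

lemma relA_gen (ρ : ℝ) : RelA (PowerSeries.C ρ) (quantumA ρ).gen :=
  (relA_iff ρ _).1 fun r hr => by
    rw [← QuantumData.proj_eq_freeLift, QuantumData.proj_rel _ hr]

lemma RelA.map {κ : K} {G : Gen → B} (h : RelA κ G) {B' : Type} [Ring B'] [Algebra K B']
    [ZComplete B'] (F : B →ₐ[K] B') : RelA κ fun g => F (G g) := by
  constructor
  all_goals simp only [← map_mul, h.x0x1, h.x0x2, h.x1x2, h.X0X1, h.X0X2, h.X1X2, h.x0X0, h.x1X0,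
    h.x2X0, h.x0X1, h.x1X1, h.x2X1, h.x0X2, h.x1X2, h.x2X2]
  all_goals simp only [map_mul, map_add, map_sub, map_neg, map_smul, map_Sh, map_Ch]

lemma RelA.commute_X0 {κ : K} {G : Gen → B} (h : RelA κ G) (g : Gen) :
    Commute (G g) (G (.inr 0)) := by
  rcases g with i | i <;> fin_cases i
  exacts [h.x0X0, h.x1X0, h.x2X0, Commute.refl _, h.X0X1.symm, h.X0X2.symm]

/-- The values of the coproduct on the generators, in terms of two copies of the generators. -/
def comulA (κ : K) (G H : Gen → B) : Gen → B := Sum.elim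
  ![H (.inl 0) + G (.inl 0) - (z * (1 + κ)) • (G (.inl 1) * H (.inl 2) - G (.inl 2) * H (.inl 1)),
    H (.inl 1) + G (.inl 1), H (.inl 2) + G (.inl 2)]
  ![H (.inr 0) + G (.inr 0),
    E (G (.inr 0)) * H (.inr 1) + G (.inr 1) * E (-H (.inr 0)),
    E (κ • G (.inr 0)) * H (.inr 2) + G (.inr 2) * E (-(κ • H (.inr 0)))]

set_option maxHeartbeats 4000000 in
-- X_0 is central, so in both copies its hyperbolic functions behave as commuting central
-- parameters. Once the addition theorems have been applied, nothing more about them is needed, and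
-- each relation is an identity between normally ordered words.
lemma RelA.comul [ZTorsionFree B] {κ : K} {G H : Gen → B} (hG : RelA κ G) (hH : RelA κ H)
    (hGH : ∀ a b, Commute (G a) (H b)) : RelA κ (comulA κ G H) := by
  have hGG := fun g => hG.commute_X0 g
  have hHH := fun g => hH.commute_X0 g
  let c : Fin 2 → B := ![G (.inr 0), H (.inr 0)]
  have hGc : ∀ g i, Commute (G g) (c i) := by
    intro g i; fin_cases i
    exacts [hGG g, hGH g _]
  have hHc : ∀ g i, Commute (H g) (c i) := by
    intro g i; fin_cases i
    exacts [(hGH _ g).symm, hHH g]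
  have hcc : ∀ i j, Commute (c i) (c j) := by
    intro i j; fin_cases i
    exacts [hGc _ j, hHc _ j]
  -- All central elements that occur, indexed by the function and by the copy of X_0, so that one
  -- commutation rule serves them all. Their values are cleared below, once the addition formulas
  -- are recorded.
  let Z : Fin 5 × Fin 2 → B := fun p =>
    ![Ch (c p.2), Sh (c p.2), Ch (κ • c p.2), Sh (κ • c p.2), c p.2] p.1
  have hZ : ∀ {a : B}, (∀ i, Commute a (c i)) → ∀ p, Commute a (Z p) := by
    rintro a ha ⟨p, i⟩
    fin_cases p
    exacts [commute_Ch (ha i), commute_Sh (ha i), commute_Ch ((ha i).smul_right κ),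
      commute_Sh ((ha i).smul_right κ), ha i]
  have hGZ : ∀ g p, G g * Z p = Z p * G g := fun g p => (hZ (hGc g) p).eq
  have hHZ : ∀ g p, H g * Z p = Z p * H g := fun g p => (hZ (hHc g) p).eq
  have hZZ : ∀ p q, Z p * Z q = Z q * Z p := fun p q =>
    (hZ (fun i => (hZ (fun j => hcc i j) p).symm) q).eq
  have hHG : ∀ a b, H b * G a = G a * H b := fun a b => (hGH a b).symm.eq
  have e1 : Sh ((1 + κ) • c 0) = Z (1, 0) * Z (2, 0) + Z (0, 0) * Z (3, 0) := by
    rw [add_smul, one_smul, Sh_add ((Commute.refl _).smul_right κ)]; rfl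
  have e2 : Sh ((1 + κ) • c 1) = Z (1, 1) * Z (2, 1) + Z (0, 1) * Z (3, 1) := by
    rw [add_smul, one_smul, Sh_add ((Commute.refl _).smul_right κ)]; rfl
  have e3 : Sh (c 1 + c 0) = Z (1, 1) * Z (0, 0) + Z (0, 1) * Z (1, 0) := Sh_add (hcc 1 0)
  have e4 : Ch (c 1 + c 0) = Z (0, 1) * Z (0, 0) + (z * z) • (Z (1, 1) * Z (1, 0)) :=
    Ch_add (hcc 1 0)
  have hk := ((hcc 1 0).smul_left κ).smul_right κ
  have e5 : Sh (κ • (c 1 + c 0)) = Z (3, 1) * Z (2, 0) + Z (2, 1) * Z (3, 0) := by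
    rw [smul_add]; exact Sh_add hk
  have e6 : Ch (κ • (c 1 + c 0)) = Z (2, 1) * Z (2, 0) + (z * z) • (Z (3, 1) * Z (3, 0)) := by
    rw [smul_add]; exact Ch_add hk
  have e7 : Sh ((1 + κ) • (c 1 + c 0)) = Sh (c 1 + c 0) * Ch (κ • (c 1 + c 0)) +
      Ch (c 1 + c 0) * Sh (κ • (c 1 + c 0)) := by
    rw [add_smul, one_smul, Sh_add ((Commute.refl _).smul_right κ)]
  have f1 : E (G (.inr 0)) = Z (0, 0) + z • Z (1, 0) := E_eq _
  have f2 : E (-H (.inr 0)) = Z (0, 1) - z • Z (1, 1) := E_neg _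
  have f3 : E (κ • G (.inr 0)) = Z (2, 0) + z • Z (3, 0) := E_eq _
  have f4 : E (-(κ • H (.inr 0))) = Z (2, 1) - z • Z (3, 1) := E_neg _
  have g1 : G (.inr 0) = Z (4, 0) := rfl
  have g2 : H (.inr 0) = Z (4, 1) := rfl
  have g3 : Ch (Z (4, 0)) = Z (0, 0) := rfl
  have g4 : Ch (Z (4, 1)) = Z (0, 1) := rfl
  have g5 : Sh (Z (4, 0)) = Z (1, 0) := rfl
  have g6 : Sh (Z (4, 1)) = Z (1, 1) := rfl
  have g7 : Ch (κ • Z (4, 0)) = Z (2, 0) := rfl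
  have g8 : Ch (κ • Z (4, 1)) = Z (2, 1) := rfl
  have g9 : Sh (κ • Z (4, 0)) = Z (3, 0) := rfl
  have g10 : Sh (κ • Z (4, 1)) = Z (3, 1) := rfl
  rw [e3, e4, e5, e6] at e7
  change Sh ((1 + κ) • Z (4, 0)) = _ at e1
  change Sh ((1 + κ) • Z (4, 1)) = _ at e2
  change Sh (Z (4, 1) + Z (4, 0)) = _ at e3
  change Ch (Z (4, 1) + Z (4, 0)) = _ at e4
  change Sh (κ • (Z (4, 1) + Z (4, 0))) = _ at e5
  change Ch (κ • (Z (4, 1) + Z (4, 0))) = _ at e6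
  change Sh ((1 + κ) • (Z (4, 1) + Z (4, 0))) = _ at e7
  clear_value Z c
  obtain ⟨h1, h2, h3, h4, h5, h6, h7, h8, h9, h10, h11, h12, h13, h14, h15⟩ := hG
  obtain ⟨k1, k2, k3, k4, k5, k6, k7, k8, k9, k10, k11, k12, k13, k14, k15⟩ := hH
  constructor
  all_goals simp only [comulA, Sum.elim_inl, Sum.elim_inr, Matrix.cons_val, f1, f2, f3, f4]
  all_goals simp only [g1, g2, g3, g4, g5, g6, g7, g8, g9, g10, e1, e2] at *
  all_goals try simp only [e3, e4, e5, e6, e7]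
  -- Normal ordering: central elements to the left, then the first copy, then the second, with the
  -- generators of each copy in a fixed order. What remains is linear.
  all_goals simp only [mul_add, add_mul, mul_sub, sub_mul, smul_mul_assoc,
    mul_smul_comm, mul_assoc, smul_add, smul_sub, mul_neg, neg_mul,
    h1, h2, h3, h6, h10, h11, h12, h13, h14, h15, k1, k2, k3, k6, k10, k11, k12, k13, k14, k15,
    mul_mul_of_mul_eq h1, mul_mul_of_mul_eq h2, mul_mul_of_mul_eq h3, mul_mul_of_mul_eq h6,
    mul_mul_of_mul_eq h10, mul_mul_of_mul_eq h11, mul_mul_of_mul_eq h12, mul_mul_of_mul_eq h13,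
    mul_mul_of_mul_eq h14, mul_mul_of_mul_eq h15,
    mul_mul_of_mul_eq k1, mul_mul_of_mul_eq k2, mul_mul_of_mul_eq k3, mul_mul_of_mul_eq k6,
    mul_mul_of_mul_eq k10, mul_mul_of_mul_eq k11, mul_mul_of_mul_eq k12, mul_mul_of_mul_eq k13,
    mul_mul_of_mul_eq k14, mul_mul_of_mul_eq k15,
    hGZ, hHZ, hHG, fun g p => mul_mul_of_mul_eq (hGZ g p), fun g p => mul_mul_of_mul_eq (hHZ g p),
    fun g p => mul_mul_of_mul_eq (hHG g p), hZZ, fun p q => mul_left_comm_of_comm (hZZ p q)]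
  all_goals module

end RelA

/-! ### Antipode, counit, classical limit and deforming map for `(𝔯₃(ρ), 𝔫₃)` -/

section LieRelA

variable {B : Type} [Ring B] [Algebra K B]

lemma Ch_of_z_smul [ZComplete B] (hz : ∀ b : B, z • b = 0) (b : B) : Ch b = 1 := by
  rw [Ch, fc_apply, zsum_succ, hz, add_zero]
  simp [constantCoeff_coshSeries]

lemma Sh_of_z_smul [ZComplete B] (hz : ∀ b : B, z • b = 0) (b : B) : Sh b = b := by
  rw [Sh, fc_apply, zsum_succ, hz, add_zero]
  simp [constantCoeff_sinhcSeries]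

/-- Since X_0 is central, conjugation by its exponentials is trivial and the antipode is y ↦ -y on
all generators. -/
lemma RelA.op [ZComplete B] {κ : K} {G : Gen → B} (h : RelA κ G) :
    RelA κ fun g => MulOpposite.op (-G g) := by
  have hc := fun g => (commute_Ch (h.commute_X0 g)).eq
  have hc' := fun g => (commute_Ch ((h.commute_X0 g).smul_right κ)).eq
  obtain ⟨h1, h2, h3, h4, h5, h6, h7, h8, h9, h10, h11, h12, h13, h14, h15⟩ := h
  constructor
  all_goals simp only [← MulOpposite.op_smul, Sh_op, Ch_op, ← MulOpposite.op_neg,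
    ← MulOpposite.op_add, ← MulOpposite.op_sub, ← MulOpposite.op_mul, MulOpposite.op_inj,
    smul_neg, Sh_neg, Ch_neg, neg_mul_neg, mul_neg, neg_mul, h1, h2, h3, h4, h5, h6, h7, h8, h9,
    h10, h11, h12, h13, h14, h15, hc, hc']
  all_goals try module

lemma relA_zero (κ : K) : RelA κ fun _ => (0 : K) := by
  constructor <;> simp [Sh_zero]

/-- The relations of the enveloping algebra of the double of `(𝔯₃(κ), 𝔫₃)`. -/
structure LieRelA (κ : K) (G : Gen → B) : Prop where
  x0x1 : G (.inl 0) * G (.inl 1) = G (.inl 1) * G (.inl 0) + G (.inl 1)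
  x0x2 : G (.inl 0) * G (.inl 2) = G (.inl 2) * G (.inl 0) + κ • G (.inl 2)
  x1x2 : G (.inl 1) * G (.inl 2) = G (.inl 2) * G (.inl 1)
  X0X1 : G (.inr 0) * G (.inr 1) = G (.inr 1) * G (.inr 0)
  X0X2 : G (.inr 0) * G (.inr 2) = G (.inr 2) * G (.inr 0)
  X1X2 : G (.inr 1) * G (.inr 2) = G (.inr 2) * G (.inr 1) + (1 + κ) • G (.inr 0)
  x0X0 : G (.inl 0) * G (.inr 0) = G (.inr 0) * G (.inl 0)
  x1X0 : G (.inl 1) * G (.inr 0) = G (.inr 0) * G (.inl 1)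
  x2X0 : G (.inl 2) * G (.inr 0) = G (.inr 0) * G (.inl 2)
  x0X1 : G (.inl 0) * G (.inr 1) = G (.inr 1) * G (.inl 0) +
    ((1 + κ) • G (.inl 2) - G (.inr 1))
  x1X1 : G (.inl 1) * G (.inr 1) = G (.inr 1) * G (.inl 1) + G (.inr 0)
  x2X1 : G (.inl 2) * G (.inr 1) = G (.inr 1) * G (.inl 2)
  x0X2 : G (.inl 0) * G (.inr 2) = G (.inr 2) * G (.inl 0) +
    (-((1 + κ) • G (.inl 1)) - κ • G (.inr 2))
  x1X2 : G (.inl 1) * G (.inr 2) = G (.inr 2) * G (.inl 1)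
  x2X2 : G (.inl 2) * G (.inr 2) = G (.inr 2) * G (.inl 2) + κ • G (.inr 0)

lemma RelA.lieRel [ZComplete B] (hz : ∀ b : B, z • b = 0) {κ : K} {G : Gen → B} (h : RelA κ G) :
    LieRelA κ G := by
  obtain ⟨h1, h2, h3, h4, h5, h6, h7, h8, h9, h10, h11, h12, h13, h14, h15⟩ := h
  simp only [Ch_of_z_smul hz, Sh_of_z_smul hz, mul_one] at *
  exact ⟨h1, h2, h3, h4, h5, h6, h7, h8, h9, h10, h11, h12, h13, h14, h15⟩

lemma LieRelA.evalDouble_lie {ρ : ℝ} {G : Gen → B} (h : LieRelA (PowerSeries.C ρ) G)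
    (u v : (bialgA ρ).Double) : evalDouble (bialgA ρ) G ⁅u, v⁆ =
      evalDouble (bialgA ρ) G u * evalDouble (bialgA ρ) G v -
        evalDouble (bialgA ρ) G v * evalDouble (bialgA ρ) G u := by
  have hb : ⁅u, v⁆ = _ := doubleBracket_A ρ u v
  obtain ⟨h1, h2, h3, h4, h5, h6, h7, h8, h9, h10, h11, h12, h13, h14, h15⟩ := h
  rw [hb]
  simp only [evalDouble, Fin.sum_univ_three, Matrix.cons_val, map_add, map_sub, map_mul, map_neg,
    map_one, map_zero, mul_add, add_mul, smul_mul_assoc, mul_smul_comm,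
    h1, h2, h3, h4, h5, h6, h7, h8, h9, h10, h11, h12, h13, h14, h15]
  module

lemma evalDouble_C_ι (B : LieBialgebra) {R : Type} [Ring R] [Algebra ℝ R] [Algebra K R⟦X⟧]
    (hK : ∀ (r : ℝ) (a : R), (PowerSeries.C r : K) • PowerSeries.C a =
      (PowerSeries.C (r • a) : R⟦X⟧)) (ι : B.Double →ₗ[ℝ] R) (u : B.Double) :
    evalDouble B (fun g => (PowerSeries.C (ι (B.gen g)) : R⟦X⟧)) u = PowerSeries.C (ι u) := by
  conv_rhs => rw [double_eq_sum B u]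
  simp only [evalDouble, hK, map_add, map_sum, map_smul]

attribute [local instance] seriesAlgebra

lemma C_smul_series {R : Type} [Ring R] [Algebra ℝ R] (r : ℝ) (a : R) :
    (PowerSeries.C r : K) • PowerSeries.C a = (PowerSeries.C (r • a) : R⟦X⟧) := by
  rw [Algebra.smul_def]
  change PowerSeries.map (algebraMap ℝ R) (PowerSeries.C r) * _ = _
  rw [PowerSeries.map_C, ← map_mul, Algebra.smul_def]

attribute [local instance] LieRing.ofAssociativeRing

/-- The generators of the enveloping algebra of the double, as constant series. -/
def ueaGen (B : LieBialgebra) (g : Gen) : (UniversalEnvelopingAlgebra ℝ B.Double)⟦X⟧ :=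
  PowerSeries.C (UniversalEnvelopingAlgebra.ι ℝ (B.gen g))

lemma ueaGen_mul (B : LieBialgebra) (a b : Gen) : ueaGen B a * ueaGen B b =
    ueaGen B b * ueaGen B a + evalDouble B (ueaGen B) ⁅B.gen a, B.gen b⁆ := by
  have h := evalDouble_C_ι B C_smul_series
    (UniversalEnvelopingAlgebra.ι ℝ (L := B.Double)).toLinearMap ⁅B.gen a, B.gen b⁆
  have h2 : evalDouble B (ueaGen B) ⁅B.gen a, B.gen b⁆ =
    PowerSeries.C (UniversalEnvelopingAlgebra.ι ℝ ⁅B.gen a, B.gen b⁆) := h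
  rw [h2, LieHom.map_lie, LieRing.of_associative_ring_bracket, ueaGen, ueaGen, map_sub, map_mul,
    map_mul]
  abel

lemma lieRelA_ueaGen (ρ : ℝ) : LieRelA (PowerSeries.C ρ) (ueaGen (bialgA ρ)) := by
  have hb : ∀ u v : (bialgA ρ).Double, ⁅u, v⁆ = _ := fun u v => doubleBracket_A ρ u v
  constructor
  all_goals rw [ueaGen_mul, hb]
  all_goals simp [evalDouble, Fin.sum_univ_three, LieBialgebra.gen, sub_eq_add_neg]
  module

/-- The generators of the quantum double in terms of those of the enveloping algebra. -/
def deformA [ZComplete B] (κ : K) (G : Gen → B) : Gen → B := Sum.elim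
  ![G (.inl 0), G (.inl 1), G (.inl 2)]
  ![G (.inr 0),
    fc (G (.inr 0)) sinhcSeries * G (.inr 1) +
      (Ch (G (.inr 0)) - fc (G (.inr 0)) sinhcSeries) * G (.inl 2),
    fc (κ • G (.inr 0)) sinhcSeries * G (.inr 2) +
      (fc (κ • G (.inr 0)) sinhcSeries - Ch (κ • G (.inr 0))) * G (.inl 1)]

/-- Write σ for `sinhcSeries`. The brackets [x^1, X_1] and [x^2, X_2] force the factors σ(zX_0) and
σ(zκX_0). Adding p x^2 to the image of X_1 replaces σ by σ + p in the x^2-term of its bracket with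
x^0, so p = cosh - σ; likewise for X_2 with the opposite sign. The bracket [X_1, X_2] then comes out
as σ(zX_0) cosh(zκX_0) + κ cosh(zX_0) σ(zκX_0) times X_0, which is the addition theorem for sinh. -/
lemma LieRelA.deform [ZComplete B] [ZTorsionFree B] {κ : K} {G : Gen → B} (h : LieRelA κ G) :
    RelA κ (deformA κ G) := by
  have hG : ∀ g, Commute (G g) (G (.inr 0)) := by
    intro g
    rcases g with i | i <;> fin_cases i
    exacts [h.x0X0, h.x1X0, h.x2X0, Commute.refl _, h.X0X1.symm, h.X0X2.symm]
  let c := G (.inr 0)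
  let Z : Fin 5 → B := ![fc c sinhcSeries, Ch c, fc (κ • c) sinhcSeries, Ch (κ • c), c]
  have hZ : ∀ {a : B}, Commute a c → ∀ p, Commute a (Z p) := by
    intro a ha p
    fin_cases p
    exacts [commute_fc ha _, commute_Ch ha, commute_fc (ha.smul_right κ) _,
      commute_Ch (ha.smul_right κ), ha]
  have hGZ : ∀ g p, G g * Z p = Z p * G g := fun g p => (hZ (hG g) p).eq
  have hZZ : ∀ p q, Z p * Z q = Z q * Z p := fun p q => (hZ (hZ (hG (.inr 0)) p).symm q).eq
  have e1 : Sh (Z 4) = Z 4 * Z 0 := rfl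
  have e2 : Sh (κ • Z 4) = κ • (Z 4 * Z 2) := smul_mul_assoc _ _ _
  have e3 : Sh ((1 + κ) • Z 4) = Sh (Z 4) * Z 3 + Z 1 * Sh (κ • Z 4) := by
    rw [add_smul, one_smul, Sh_add ((Commute.refl _).smul_right κ)]; rfl
  rw [e1, e2] at e3
  have f1 : fc (Z 4) sinhcSeries = Z 0 := rfl
  have f2 : Ch (Z 4) = Z 1 := rfl
  have f3 : fc (κ • Z 4) sinhcSeries = Z 2 := rfl
  have f4 : Ch (κ • Z 4) = Z 3 := rfl
  have f5 : G (.inr 0) = Z 4 := rfl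
  clear_value Z c
  obtain ⟨h1, h2, h3, h4, h5, h6, h7, h8, h9, h10, h11, h12, h13, h14, h15⟩ := h
  constructor
  all_goals simp only [deformA, Sum.elim_inl, Sum.elim_inr, Matrix.cons_val]
  all_goals simp only [f5] at *
  all_goals try simp only [e1, e2, e3, f1, f2, f3, f4]
  all_goals simp only [mul_add, add_mul, mul_sub, sub_mul, smul_mul_assoc,
    mul_smul_comm, mul_assoc, smul_add, smul_sub, mul_neg, neg_mul,
    h1, h2, h3, h6, h10, h11, h12, h13, h14, h15,
    mul_mul_of_mul_eq h1, mul_mul_of_mul_eq h2, mul_mul_of_mul_eq h3, mul_mul_of_mul_eq h6,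
    mul_mul_of_mul_eq h10, mul_mul_of_mul_eq h11, mul_mul_of_mul_eq h12, mul_mul_of_mul_eq h13,
    mul_mul_of_mul_eq h14, mul_mul_of_mul_eq h15,
    hGZ, fun g p => mul_mul_of_mul_eq (hGZ g p), hZZ, fun p q => mul_left_comm_of_comm (hZZ p q)]
  all_goals module

end LieRelA

/-! ### Structure maps on a presented algebra -/

section HopfData

/-- Structure maps on a presented algebra with given values on the generators. -/
lemma exists_hopfData {B : LieBialgebra} {P : QuantumData} {G : Gen → CTensor2 P.Alg}
    {s : Gen → P.Alg} (hG : ∀ r ∈ P.rels, freeLift G r = 0)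
    (hε : ∀ r ∈ P.rels, freeLift (fun _ => (0 : K)) r = 0)
    (hs : ∀ r ∈ P.rels, freeLift (fun g => MulOpposite.op (s g)) r = 0)
    (hcoprod : ∀ g, Completion.of _ (Algebra.TensorProduct.map P.proj P.proj (P.coprod g)) = G g)
    (hax : ∀ (D : P.Alg →ₐ[K] CTensor2 P.Alg) (ε : P.Alg →ₐ[K] K) (S : P.Alg →ₐ[K] P.Algᵐᵒᵖ),
      (∀ g, D (P.gen g) = G g) → (∀ g, ε (P.gen g) = 0) →
      (∀ g, S (P.gen g) = MulOpposite.op (s g)) → ∀ g, HopfAxiomsAt D ε S (P.gen g))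
    (hfirst : ∀ g, ∃ b : CTensor2 P.Alg, G g =
      inr2 _ (P.gen g) + inl2 _ (P.gen g) - z • ∑ l : Gen, ∑ m : Gen,
        (PowerSeries.C (B.cocomm g l m) : K) • (inl2 _ (P.gen l) * inr2 _ (P.gen m)) + z ^ 2 • b) :
    ∃ (D : P.Alg →ₐ[K] CTensor2 P.Alg) (ε : P.Alg →ₐ[K] K)
      (S : P.Alg →ₐ[K] P.Algᵐᵒᵖ), ∀ g, HopfAxiomsAt D ε S (P.gen g) ∧
        D (P.gen g) = Completion.of _ (Algebra.TensorProduct.map P.proj P.proj (P.coprod g)) ∧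
        ε (P.gen g) = 0 ∧ ∃ b : CTensor2 P.Alg, D (P.gen g) =
          inr2 _ (P.gen g) + inl2 _ (P.gen g) - z • ∑ l : Gen, ∑ m : Gen,
            (PowerSeries.C (B.cocomm g l m) : K) • (inl2 _ (P.gen l) * inr2 _ (P.gen m)) +
              z ^ 2 • b := by
  have hD := QuantumData.lift_gen G hG
  have hε' := QuantumData.lift_gen _ hε
  refine ⟨QuantumData.lift G hG, QuantumData.lift _ hε, QuantumData.lift _ hs, fun g =>
    ⟨hax _ _ _ hD hε' (QuantumData.lift_gen _ hs) g, ?_, hε' g, ?_⟩⟩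
  · rw [hD, hcoprod]
  · rw [hD]; exact hfirst g

lemma coprod_tmul {P : QuantumData} (a b : FreeZ) :
    Completion.of _ (Algebra.TensorProduct.map P.proj P.proj (a ⊗ₜ b)) =
      inl2 _ (P.proj a) * inr2 _ (P.proj b) := by
  rw [Algebra.TensorProduct.map_tmul, of_tmul]

lemma proj_expZ {P : QuantumData} (w : Free) : P.proj (expZ w) = E (wordLift P.gen w) := by
  rw [QuantumData.proj_eq_freeLift, freeLift_expZ]

lemma proj_xz {P : QuantumData} (i : Fin 3) : P.proj (xz i) = P.gen (.inl i) := rfl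

lemma proj_Xz {P : QuantumData} (i : Fin 3) : P.proj (Xz i) = P.gen (.inr i) := rfl

lemma exists_twisted_eq {B : Type} [Ring B] [Algebra K B] [ZComplete B] (a b g h : B) :
    ∃ c, E a * h + g * E b = h + g + z • (a * h + g * b) + z ^ 2 • c := by
  obtain ⟨c, hc⟩ := exists_E_eq a
  obtain ⟨d, hd⟩ := exists_E_eq b
  refine ⟨c * h + g * d, ?_⟩
  rw [hc, hd]
  simp only [add_mul, mul_add, smul_mul_assoc, mul_smul_comm, one_mul, mul_one]
  module

end HopfData

section

attribute [local instance] seriesAlgebra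

lemma constantCoeff_fc {R : Type} [Ring R] [Algebra ℝ R] (a : R⟦X⟧) (f : ℝ⟦X⟧) :
    PowerSeries.constantCoeff (fc a f) = algebraMap ℝ R (PowerSeries.constantCoeff f) := by
  rw [fc_apply, zsum_succ, map_add, z_smul_series, map_mul, PowerSeries.constantCoeff_X, zero_mul,
    add_zero, pow_zero, constantCoeff_smul_series, map_one, PowerSeries.constantCoeff_C,
    PowerSeries.coeff_zero_eq_constantCoeff_apply, Algebra.algebraMap_eq_smul_one]

end

section HopfA

lemma coprod_quantumA (ρ : ℝ) (P : QuantumData) (g : Gen) :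
    Completion.of _ (Algebra.TensorProduct.map P.proj P.proj ((quantumA ρ).coprod g)) =
      comulA (PowerSeries.C ρ) (fun g => inl2 _ (P.gen g)) (fun g => inr2 _ (P.gen g)) g := by
  rcases g with i | i <;> fin_cases i
  all_goals
    simp [quantumA, comulA, coprod_tmul, -Algebra.TensorProduct.map_tmul, proj_expZ, wordLift_X,
      wordLift_smul, map_E, proj_xz, proj_Xz]

lemma first_order_comulA {A : Type} [Ring A] [Algebra K A] [ZComplete A] (ρ : ℝ) (G H : Gen → A)
    (g : Gen) : ∃ b : A, comulA (PowerSeries.C ρ) G H g =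
      H g + G g - z • ∑ l : Gen, ∑ m : Gen,
        (PowerSeries.C ((bialgA ρ).cocomm g l m) : K) • (G l * H m) + z ^ 2 • b := by
  rcases g with i | i <;> fin_cases i
  all_goals
    simp only [comulA, Sum.elim_inl, Sum.elim_inr, Matrix.cons_val, Fin.zero_eta, Fin.mk_one,
      Fin.reduceFinMk]
  · refine ⟨0, ?_⟩
    simp [LieBialgebra.cocomm, bialgA, r3, skewConst, Fin.sum_univ_three]
    module
  iterate 3
    refine ⟨0, ?_⟩
    simp [LieBialgebra.cocomm, bialgA, r3, skewConst, Fin.sum_univ_three]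
  all_goals
    obtain ⟨c, hc⟩ := exists_twisted_eq (B := A) _ _ _ _
    refine ⟨c, hc.trans ?_⟩
    simp [LieBialgebra.cocomm, bialgA, r3, skewConst, Fin.sum_univ_three]
    module

/-- Only x^0 is not twisted primitive. For it, coassociativity uses that x^1 and x^2 are primitive,
and the antipode axioms use that they commute, which kills the extra term x^1 x^2 - x^2 x^1. -/
lemma hopfAxiomsAt_quantumA (ρ : ℝ) {D : (quantumA ρ).Alg →ₐ[K] CTensor2 (quantumA ρ).Alg}
    {ε : (quantumA ρ).Alg →ₐ[K] K} {S : (quantumA ρ).Alg →ₐ[K] (quantumA ρ).Algᵐᵒᵖ}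
    (hD : ∀ g, D ((quantumA ρ).gen g) = comulA (PowerSeries.C ρ)
      (fun g => inl2 _ ((quantumA ρ).gen g)) (fun g => inr2 _ ((quantumA ρ).gen g)) g)
    (hε : ∀ g, ε ((quantumA ρ).gen g) = 0)
    (hS : ∀ g, S ((quantumA ρ).gen g) = MulOpposite.op (-(quantumA ρ).gen g)) (g : Gen) :
    HopfAxiomsAt D ε S ((quantumA ρ).gen g) := by
  have h := relA_gen ρ
  set G := (quantumA ρ).gen
  have hp : ∀ g, D (G g) = inr2 _ (G g) + inl2 _ (G g) → HopfAxiomsAt D ε S (G g) :=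
    fun g hg => .of_primitive (by rw [hg, add_comm]) (hε g) (hS g)
  -- Conjugation by the central exponential is inserted to reach the shape required of a twisted
  -- primitive element.
  have hS1 : S (G (.inr 1)) =
      MulOpposite.op (-(E (-G (.inr 0)) * G (.inr 1) * E (G (.inr 0)))) := by
    rw [hS, mul_assoc, (commute_E (h.commute_X0 (.inr 1))).eq, ← mul_assoc, E_neg_mul_E, one_mul]
  have hS2 : S (G (.inr 2)) = MulOpposite.op (-(E (-((PowerSeries.C ρ : K) • G (.inr 0))) *
      G (.inr 2) * E ((PowerSeries.C ρ : K) • G (.inr 0)))) := by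
    rw [hS, mul_assoc, (commute_E ((h.commute_X0 (.inr 2)).smul_right _)).eq, ← mul_assoc,
      E_neg_mul_E, one_mul]
  have h12 := h.x1x2
  rcases g with i | i <;> fin_cases i
  · have hD0 := hD (.inl 0)
    simp only [comulA, Sum.elim_inl, Matrix.cons_val] at hD0
    have hD1 := hD (.inl 1)
    simp only [comulA, Sum.elim_inl, Matrix.cons_val] at hD1
    have hD2 := hD (.inl 2)
    simp only [comulA, Sum.elim_inl, Matrix.cons_val] at hD2
    change HopfAxiomsAt D ε S (G (.inl 0))
    constructor
    · rw [hD0]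
      simp only [map_add, map_sub, map_smul, map_mul, comulTensorIdAlg_inl2, comulTensorIdAlg_inr2,
        idTensorComulAlg_inl2, idTensorComulAlg_inr2, hD0, hD1, hD2, in12_inl2, in12_inr2,
        in23_inl2, in23_inr2, add_mul, mul_add]
      module
    · rw [hD0]
      simp [counitLeft_inl2, counitLeft_inr2, hε]
    · rw [hD0]
      simp [counitRight_inl2, counitRight_inr2, hε]
    · rw [hD0]
      have e1 := antipodeLeft_mul_tmul S (G (.inl 0)) 1
      have e2 := antipodeLeft_mul_tmul S 1 (G (.inl 0))
      simp only [map_one, mul_one, one_mul] at e1 e2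
      simp only [map_add, map_sub, map_smul, antipodeLeft_mul_tmul, e1, e2, hS, hε, map_zero]
      simp [← map_mul, h12]
    · rw [hD0]
      have e1 := antipodeRight_mul_tmul S (G (.inl 0)) 1
      have e2 := antipodeRight_mul_tmul S 1 (G (.inl 0))
      simp only [map_one, mul_one, one_mul] at e1 e2
      simp only [map_add, map_sub, map_smul, antipodeRight_mul_tmul, e1, e2, hS, hε, map_zero]
      simp [← map_mul, h12]
  · exact hp _ (hD _)
  · exact hp _ (hD _)
  · exact hp _ (hD _)
  · exact .of_twistedPrimitive ((hD (.inr 0)).trans (add_comm _ _)) (hD (.inr 1)) (hε _) (hε _)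
      (hS _) hS1
  · refine .of_twistedPrimitive (h := (PowerSeries.C ρ : K) • G (.inr 0)) ?_ ?_ ?_ (hε _) ?_ hS2
    · rw [map_smul, map_smul, map_smul, ← smul_add]
      exact congrArg _ ((hD (.inr 0)).trans (add_comm _ _))
    · rw [map_smul, map_smul]; exact hD (.inr 2)
    · rw [map_smul, hε, smul_zero]
    · rw [map_smul, hS, ← MulOpposite.op_smul, smul_neg]

section

attribute [local instance] seriesAlgebra

theorem isHopfQuantization_A (ρ : ℝ) : IsHopfQuantization (bialgA ρ) (quantumA ρ) := by
  refine isHopfQuantization_of_deformingMap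
    (QuantumData.lift _ ((relA_iff ρ _).2 (lieRelA_ueaGen ρ).deform)) (fun g => ?_)
    ((((relA_gen ρ).map (RingCon.mkₐ K (zCon _ 1))).lieRel z_smul_level_one).evalDouble_lie)
    fun htf => ?_
  · rw [QuantumData.lift_gen]
    rcases g with i | i <;> fin_cases i
    all_goals simp [deformA, constantCoeff_fc, ueaGen, Ch, constantCoeff_sinhcSeries,
      constantCoeff_coshSeries]
  · have hc : ∀ a b, Commute (inl2 _ ((quantumA ρ).gen a)) (inr2 _ ((quantumA ρ).gen b)) :=
      fun a b => commute_inl2_inr2 _ _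
    exact exists_hopfData ((relA_iff ρ _).2
      (((relA_gen ρ).map (inl2 _)).comul ((relA_gen ρ).map (inr2 _)) hc))
      ((relA_iff ρ _).2 (relA_zero _)) ((relA_iff ρ _).2 (relA_gen ρ).op)
      (coprod_quantumA ρ _) (fun D ε S => hopfAxiomsAt_quantumA ρ)
      (first_order_comulA ρ _ _)

end

end HopfA

/-! ## The quantum double of the second `(𝔯₃(ρ), 𝔯₃(-ρ))` -/

section RelC

variable {B : Type} [Ring B] [Algebra K B] [ZComplete B]

/-- The relations of the quantum double of the second `(𝔯₃(κ), 𝔯₃(-κ))`. -/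
structure RelC (κ l : K) (G : Gen → B) : Prop where
  x0x1 : G (.inl 0) * G (.inl 1) = G (.inl 1) * G (.inl 0) + G (.inl 1)
  x0x2 : G (.inl 0) * G (.inl 2) = G (.inl 2) * G (.inl 0) + κ • G (.inl 2)
  x1x2 : G (.inl 1) * G (.inl 2) = G (.inl 2) * G (.inl 1)
  X0X1 : G (.inr 0) * G (.inr 1) = G (.inr 1) * G (.inr 0) + l • G (.inr 1)
  X0X2 : G (.inr 0) * G (.inr 2) = G (.inr 2) * G (.inr 0) + -((l * κ) • G (.inr 2))
  X1X2 : G (.inr 1) * G (.inr 2) = G (.inr 2) * G (.inr 1)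
  x0X0 : G (.inl 0) * G (.inr 0) = G (.inr 0) * G (.inl 0)
  x1X0 : G (.inl 1) * G (.inr 0) = G (.inr 0) * G (.inl 1) + l • G (.inl 1)
  x2X0 : G (.inl 2) * G (.inr 0) = G (.inr 0) * G (.inl 2) + -((l * κ) • G (.inl 2))
  x0X1 : G (.inl 0) * G (.inr 1) = G (.inr 1) * G (.inl 0) + -G (.inr 1)
  x1X1 : G (.inl 1) * G (.inr 1) = G (.inr 1) * G (.inl 1) + Sh (-(l • G (.inl 0)) + G (.inr 0))
  x2X1 : G (.inl 2) * G (.inr 1) = G (.inr 1) * G (.inl 2)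
  x0X2 : G (.inl 0) * G (.inr 2) = G (.inr 2) * G (.inl 0) + -(κ • G (.inr 2))
  x1X2 : G (.inl 1) * G (.inr 2) = G (.inr 2) * G (.inl 1)
  x2X2 : G (.inl 2) * G (.inr 2) = G (.inr 2) * G (.inl 2) + Sh (κ • (l • G (.inl 0) + G (.inr 0)))

lemma relC_iff (ρ l : ℝ) (G : Gen → B) :
    (∀ r ∈ (quantumC ρ l).rels, freeLift G r = 0) ↔
      RelC (PowerSeries.C ρ) (PowerSeries.C l) G := by
  simp only [quantumC, Set.mem_insert_iff, Set.mem_singleton_iff, forall_eq_or_imp, forall_eq,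
    map_sub, map_mul, map_neg, freeLift_comm, freeLift_xz, freeLift_Xz, freeLift_smul,
    freeLift_coshZ, freeLift_sinhDivZ, wordLift_smul, wordLift_X, wordLift_x,
    comm_sub_eq_zero_iff, map_add, map_one, comm_eq_zero_iff]
  constructor
  · rintro ⟨h1, h2, h3, h4, h5, h6, h7, h8, h9, h10, h11, h12, h13, h14, h15⟩
    exact ⟨h1, h2, h3, h4, h5, h6, h7, h8, h9, h10, h11, h12, h13, h14, h15⟩
  · rintro ⟨h1, h2, h3, h4, h5, h6, h7, h8, h9, h10, h11, h12, h13, h14, h15⟩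
    exact ⟨h1, h2, h3, h4, h5, h6, h7, h8, h9, h10, h11, h12, h13, h14, h15⟩

lemma relC_gen (ρ l : ℝ) : RelC (PowerSeries.C ρ) (PowerSeries.C l) (quantumC ρ l).gen :=
  (relC_iff ρ l _).1 fun r hr => by
    rw [← QuantumData.proj_eq_freeLift, QuantumData.proj_rel _ hr]

lemma RelC.map {κ l : K} {G : Gen → B} (h : RelC κ l G) {B' : Type} [Ring B'] [Algebra K B']
    [ZComplete B'] (F : B →ₐ[K] B') : RelC κ l fun g => F (G g) := by
  constructor
  all_goals simp only [← map_mul, h.x0x1, h.x0x2, h.x1x2, h.X0X1, h.X0X2, h.X1X2, h.x0X0, h.x1X0,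
    h.x2X0, h.x0X1, h.x1X1, h.x2X1, h.x0X2, h.x1X2, h.x2X2]
  all_goals simp only [map_mul, map_add, map_sub, map_neg, map_smul, map_Sh, map_Ch]

lemma relC_zero (κ l : K) : RelC κ l fun _ => (0 : K) := by
  constructor <;> simp [Sh_zero]

lemma E_smul_one (μ : K) : E (μ • (1 : B)) = algebraMap K B (E μ) := by
  rw [← Algebra.algebraMap_eq_smul_one]
  exact (map_E (Algebra.ofId K B) μ).symm

/-- If `a b = (b + μ) a` for a scalar `μ`, then `a exp (z b) = exp (z μ) exp (z b) a`. -/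
lemma mul_E_of_shift' {a b : B} {μ : K} (h : a * b = b * a + μ • a) :
    a * E b = (E μ : K) • (E b * a) := by
  rw [mul_E_of_shift h, E_smul_one, Algebra.smul_def]

end RelC

/-! ### Twisted primitive elements -/

section Twist

variable {A B : Type} [Ring A] [Algebra K A] [Ring B] [Algebra K B] [ZComplete B]

/-- The coproduct of a twisted primitive element, in terms of two commuting copies of the
algebra. -/
def twist (F₁ F₂ : A →ₐ[K] B) (a h : A) : B := E (F₁ h) * F₂ a + F₁ a * E (-F₂ h)

variable {F₁ F₂ : A →ₐ[K] B}

lemma twist_zero (a : A) : twist F₁ F₂ a 0 = F₂ a + F₁ a := by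
  simp [twist, E_zero]

lemma twist_zero_left (h : A) : twist F₁ F₂ 0 h = 0 := by
  simp [twist]

lemma exists_twist_eq (a h : A) : ∃ c, twist F₁ F₂ a h =
    F₂ a + F₁ a - z • (F₁ a * F₂ h - F₁ h * F₂ a) + z ^ 2 • c := by
  obtain ⟨c, hc⟩ := exists_twisted_eq (F₁ h) (-F₂ h) (F₁ a) (F₂ a)
  refine ⟨c, hc.trans ?_⟩
  rw [mul_neg]
  module

lemma twist_smul (μ : K) (a h : A) : twist F₁ F₂ (μ • a) h = μ • twist F₁ F₂ a h := by
  simp only [twist, map_smul, smul_mul_assoc, mul_smul_comm, smul_add]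

lemma twist_neg (a h : A) : twist F₁ F₂ (-a) h = -twist F₁ F₂ a h := by
  simp only [twist, map_neg, neg_mul, mul_neg, neg_add]

/-- In e^{zh} ⊗ sinh(zh) + sinh(zh) ⊗ e^{-zh} the sinh ⊗ sinh terms cancel and the addition theorem
remains. Thus sinh(zh)/z, with twist h, has the coproduct expected for primitive h. -/
lemma twist_Sh [ZComplete A] [ZTorsionFree B] (hF : ∀ a b, Commute (F₁ a) (F₂ b)) (h : A) :
    twist F₁ F₂ (Sh h) h = Sh (F₁ h + F₂ h) := by
  rw [twist, map_Sh, map_Sh, Sh_add (hF h h), E_eq, E_neg, add_mul, mul_sub, smul_mul_assoc,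
    mul_smul_comm, (commute_Sh (commute_Sh (hF h h).symm).symm).eq]
  abel

/-- The commutation relation of two twisted primitive elements whose twists shift each other by
opposite scalars. -/
lemma twist_mul_twist (hF : ∀ a b, Commute (F₁ a) (F₂ b)) {a b r ha hb : A} {μ : K}
    (hab : a * b = b * a + r)
    (h1 : a * hb = hb * a + μ • a) (h2 : b * ha = ha * b + -μ • b) (hh : Commute ha hb) :
    twist F₁ F₂ a ha * twist F₁ F₂ b hb = twist F₁ F₂ b hb * twist F₁ F₂ a ha +
      twist F₁ F₂ r (ha + hb) := by
  have e1 : F₁ a * E (F₁ hb) = (E μ : K) • (E (F₁ hb) * F₁ a) := mul_E_of_shift' (by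
    rw [← map_mul, h1, map_add, map_mul, map_smul])
  have e2 : F₁ b * E (F₁ ha) = (E (-μ) : K) • (E (F₁ ha) * F₁ b) := mul_E_of_shift' (by
    rw [← map_mul, h2, map_add, map_mul, map_smul])
  have e3 : F₂ a * E (-F₂ hb) = (E (-μ) : K) • (E (-F₂ hb) * F₂ a) := mul_E_of_shift' (by
    rw [← map_neg, ← map_mul, mul_neg, h1, map_neg, map_add, map_mul, map_smul, map_neg,
      neg_mul, neg_smul, neg_add])
  have e4 : F₂ b * E (-F₂ ha) = (E μ : K) • (E (-F₂ ha) * F₂ b) := mul_E_of_shift' (by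
    rw [← map_neg, ← map_mul, mul_neg, h2, map_neg, map_add, map_mul, map_smul, map_neg,
      neg_mul, neg_smul, neg_add, neg_neg])
  have e5 : F₁ a * F₁ b = F₁ b * F₁ a + F₁ r := by rw [← map_mul, hab, map_add, map_mul]
  have e6 : F₂ a * F₂ b = F₂ b * F₂ a + F₂ r := by rw [← map_mul, hab, map_add, map_mul]
  have hE : ∀ c d, Commute (F₂ c) (E (F₁ d)) := fun c d => commute_E (hF d c).symm
  have hE' : ∀ c d, Commute (E (-F₂ c)) (F₁ d) := fun c d => (commute_E (hF d c).neg_right).symm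
  have hEE : ∀ c d, Commute (E (-F₂ c)) (E (F₁ d)) := fun c d => commute_E (hE' c d)
  have h1' : E (F₁ ha) * E (F₁ hb) = E (F₁ (ha + hb)) := by
    rw [map_add, E_add (hh.map F₁)]
  have h2' : E (F₁ hb) * E (F₁ ha) = E (F₁ (ha + hb)) := by
    rw [add_comm, map_add, E_add (hh.symm.map F₁)]
  have h3' : E (-F₂ ha) * E (-F₂ hb) = E (-F₂ (ha + hb)) := by
    rw [map_add, neg_add, E_add (hh.map F₂).neg_left.neg_right]
  have h4' : E (-F₂ hb) * E (-F₂ ha) = E (-F₂ (ha + hb)) := by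
    rw [add_comm, map_add, neg_add, E_add (hh.symm.map F₂).neg_left.neg_right]
  simp only [twist, add_mul, mul_add]
  -- Reversing a cross term such as e^{z h_a} b ⊗ a e^{-z h_b} produces the same scalar e^{-zμ} in
  -- either tensor factor, so the cross terms cancel and only the commutators within one factor
  -- survive.
  rw [(hE a hb).mul_mul_mul_comm, (hF b a).symm.mul_mul_mul_comm,
    (hEE ha hb).mul_mul_mul_comm, (hE' ha b).mul_mul_mul_comm,
    (hE b ha).mul_mul_mul_comm, (hF a b).symm.mul_mul_mul_comm,
    (hEE hb ha).mul_mul_mul_comm, (hE' hb a).mul_mul_mul_comm,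
    e1, e2, e3, e4, e5, e6, h1', h2', h3', h4']
  simp only [mul_add, add_mul, smul_mul_assoc, mul_smul_comm]
  abel

/-- Structure maps on a presented algebra all of whose generators are twisted primitive. -/
lemma exists_hopfData_of_twist {B : LieBialgebra} {P : QuantumData} {h : Gen → P.Alg}
    (hh : ∀ g, ∃ (μ : K) (g₀ : Gen), h g = μ • P.gen g₀ ∧ h g₀ = 0)
    (hG : ∀ r ∈ P.rels, freeLift (fun g => twist (inl2 _) (inr2 _) (P.gen g) (h g)) r = 0)
    (hε : ∀ r ∈ P.rels, freeLift (fun _ => (0 : K)) r = 0)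
    (hs : ∀ r ∈ P.rels,
      freeLift (fun g => MulOpposite.op (-(E (-h g) * P.gen g * E (h g)))) r = 0)
    (hcoprod : ∀ g, Completion.of _ (Algebra.TensorProduct.map P.proj P.proj (P.coprod g)) =
      twist (inl2 _) (inr2 _) (P.gen g) (h g))
    (hfirst : ∀ g, ∑ l : Gen, ∑ m : Gen, (PowerSeries.C (B.cocomm g l m) : K) •
      (inl2 _ (P.gen l) * inr2 _ (P.gen m)) =
        inl2 _ (P.gen g) * inr2 _ (h g) - inl2 _ (h g) * inr2 _ (P.gen g)) :
    ∃ (D : P.Alg →ₐ[K] CTensor2 P.Alg) (ε : P.Alg →ₐ[K] K)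
      (S : P.Alg →ₐ[K] P.Algᵐᵒᵖ), ∀ g, HopfAxiomsAt D ε S (P.gen g) ∧
        D (P.gen g) = Completion.of _ (Algebra.TensorProduct.map P.proj P.proj (P.coprod g)) ∧
        ε (P.gen g) = 0 ∧ ∃ b : CTensor2 P.Alg, D (P.gen g) =
          inr2 _ (P.gen g) + inl2 _ (P.gen g) - z • ∑ l : Gen, ∑ m : Gen,
            (PowerSeries.C (B.cocomm g l m) : K) • (inl2 _ (P.gen l) * inr2 _ (P.gen m)) +
              z ^ 2 • b := by
  refine exists_hopfData hG hε hs hcoprod (fun D ε S hD hε hS g => ?_) fun g => ?_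
  · obtain ⟨μ, g₀, hg, hg₀⟩ := hh g
    refine .of_twistedPrimitive (h := h g) ?_ (hD g) ?_ (hε g) ?_ (hS g)
    -- The twist is a multiple of a generator with zero twist, hence primitive.
    · rw [hg, map_smul, hD, hg₀, twist_zero, map_smul, map_smul, ← smul_add, add_comm]
    · rw [hg, map_smul, hε, smul_zero]
    · rw [hg, map_smul, hS, hg₀, neg_zero, E_zero, one_mul, mul_one, ← MulOpposite.op_smul,
        smul_neg]
  · rw [hfirst]
    exact exists_twist_eq _ _

end Twist

/-! ### Coproduct and antipode for the second `(𝔯₃(ρ), 𝔯₃(-ρ))` -/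

section HopfC

variable {B : Type} [Ring B] [Algebra K B]

/-- The twists of the generators in the coproduct. -/
def twistC (κ l : K) (G : Gen → B) : Gen → B := Sum.elim
  ![0, -(l • G (.inl 0)), (l * κ) • G (.inl 0)] ![0, G (.inr 0), κ • G (.inr 0)]

/-- All twists lie in the span of the commuting elements x^0 and X_0, which act on the other
generators by scalars, so `twist_mul_twist` applies throughout. In [x^1, X_1] and [x^2, X_2] the
argument of sinh is exactly the sum of the two twists, and `twist_Sh` finishes. -/
lemma RelC.comul [ZComplete B] {A : Type} [Ring A] [Algebra K A] [ZComplete A] [ZTorsionFree B]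
    {F₁ F₂ : A →ₐ[K] B} (hF : ∀ a b, Commute (F₁ a) (F₂ b)) {κ l : K} {G : Gen → A}
    (hG : RelC κ l G) : RelC κ l fun g => twist F₁ F₂ (G g) (twistC κ l G g) := by
  have h0 := twist_zero (F₁ := F₁) (F₂ := F₂)
  obtain ⟨h1, h2, h3, h4, h5, h6, h7, h8, h9, h10, h11, h12, h13, h14, h15⟩ := hG
  constructor
  all_goals dsimp only [twistC, Sum.elim_inl, Sum.elim_inr, Matrix.cons_val]
  · refine (twist_mul_twist hF h1 (μ := 0) ?_ ?_ ?_).trans ?_ <;> simp [h0]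
  · refine (twist_mul_twist hF h2 (μ := 0) ?_ ?_ ?_).trans ?_ <;> simp [h0, twist_smul]
  · refine (twist_mul_twist hF (h3.trans (add_zero _).symm) (μ := -(l * κ)) ?_ ?_ ?_).trans ?_
    · simp only [mul_smul_comm, smul_mul_assoc, h1]; module
    · simp only [mul_neg, neg_mul, mul_smul_comm, smul_mul_assoc, h2]; module
    · exact (((Commute.refl _).smul_left _).smul_right _).neg_left
    · rw [twist_zero_left, add_zero]
  · refine (twist_mul_twist hF h4 (μ := 0) ?_ ?_ ?_).trans ?_ <;> simp [h0, twist_smul]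
  · refine (twist_mul_twist hF h5 (μ := 0) ?_ ?_ ?_).trans ?_ <;> simp [h0, twist_smul, twist_neg]
  · refine (twist_mul_twist hF (h6.trans (add_zero _).symm) (μ := -(l * κ)) ?_ ?_ ?_).trans ?_
    · simp only [mul_smul_comm, smul_mul_assoc, h4]; module
    · simp only [mul_neg, neg_mul, mul_smul_comm, smul_mul_assoc, h5]; module
    · exact (Commute.refl _).smul_right _
    · rw [twist_zero_left, add_zero]
  · refine (twist_mul_twist hF (h7.trans (add_zero _).symm) (μ := 0) ?_ ?_ ?_).trans ?_ <;>
      simp [twist_zero_left]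
  · refine (twist_mul_twist hF h8 (μ := 0) ?_ ?_ ?_).trans ?_ <;> simp [h0, twist_smul, h7]
  · refine (twist_mul_twist hF h9 (μ := 0) ?_ ?_ ?_).trans ?_ <;>
      simp [h0, twist_smul, twist_neg, h7]
  · refine (twist_mul_twist hF h10 (μ := 0) ?_ ?_ ?_).trans ?_ <;>
      simp [h0, twist_smul, twist_neg, h7]
  · refine (twist_mul_twist hF h11 (μ := l) h8 ?_ ?_).trans ?_
    · simp only [mul_neg, neg_mul, mul_smul_comm, smul_mul_assoc, h10]; module
    · exact (Commute.smul_left h7 _).neg_left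
    · rw [twist_Sh hF, h0, h0]
      congr 2
      simp only [map_add, map_neg, map_smul]
      module
  · refine (twist_mul_twist hF (h12.trans (add_zero _).symm) (μ := -(l * κ)) ?_ ?_ ?_).trans ?_
    · rw [h9]; module
    · simp only [mul_smul_comm, smul_mul_assoc, h10]; module
    · exact Commute.smul_left h7 _
    · rw [twist_zero_left, add_zero]
  · refine (twist_mul_twist hF h13 (μ := 0) ?_ ?_ ?_).trans ?_ <;>
      simp [h0, twist_smul, twist_neg, h7]
  · refine (twist_mul_twist hF (h14.trans (add_zero _).symm) (μ := κ * l) ?_ ?_ ?_).trans ?_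
    · simp only [mul_smul_comm, smul_mul_assoc, h8]; module
    · simp only [mul_neg, neg_mul, mul_smul_comm, smul_mul_assoc, h13]; module
    · exact ((Commute.smul_left h7 _).smul_right _).neg_left
    · rw [twist_zero_left, add_zero]
  · refine (twist_mul_twist hF h15 (μ := -(l * κ * κ)) ?_ ?_ ?_).trans ?_
    · simp only [mul_smul_comm, smul_mul_assoc, h9]; module
    · simp only [mul_smul_comm, smul_mul_assoc, h13]; module
    · exact (Commute.smul_left h7 _).smul_right _
    · rw [show (l * κ) • G (.inl 0) + κ • G (.inr 0) = κ • (l • G (.inl 0) + G (.inr 0)) by module,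
        twist_Sh hF, h0, h0]
      congr 2
      simp only [map_add, map_smul]
      module

/-- The antipode is y ↦ -y up to scalars, mutually inverse on x^i and X_i. They can matter only in
[x^i, X_i], where their product appears. -/
lemma RelC.op [ZComplete B] {κ l : K} {G : Gen → B} (h : RelC κ l G) {μ ν : K} {μ' ν' : K}
    (hμ : μ * μ' = 1) (hν : ν * ν' = 1) : RelC κ l fun g => 
      MulOpposite.op (-((Sum.elim ![1, μ, ν] ![1, μ', ν'] g : K) • G g)) := by
  obtain ⟨h1, h2, h3, h4, h5, h6, h7, h8, h9, h10, h11, h12, h13, h14, h15⟩ := h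
  have e1 : Sh (-(l • -G (.inl 0)) + -G (.inr 0)) = -Sh (-(l • G (.inl 0)) + G (.inr 0)) := by
    rw [← Sh_neg]; congr 1; module
  have e2 : Sh (κ • (l • -G (.inl 0) + -G (.inr 0))) =
      -Sh (κ • (l • G (.inl 0) + G (.inr 0))) := by
    rw [← Sh_neg]; congr 1; module
  constructor
  all_goals dsimp only [Sum.elim_inl, Sum.elim_inr, Matrix.cons_val]
  all_goals simp only [one_smul, ← MulOpposite.op_smul, ← MulOpposite.op_neg, ← MulOpposite.op_add,
    Sh_op, ← MulOpposite.op_mul, MulOpposite.op_inj, neg_mul_neg, e1, e2, smul_mul_assoc,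
    mul_smul_comm, smul_smul, h1, h2, h3, h4, h5, h6, h7, h8, h9, h10, h11, h12, h13, h14, h15]
  all_goals try module
  · rw [mul_comm μ', hμ]; module
  · rw [mul_comm ν', hν]; module

end HopfC

/-! ### Deformation of `𝔰𝔩₂`-triples -/

section Triple

variable {B : Type} [Ring B] [Algebra K B] [ZComplete B]

/-- The divided difference `∑ z ^ (2 n) (u ^ (2 n + 2) - w ^ (n + 1)) / ((2 n + 2)! (u ^ 2 - w))`
of the hyperbolic cosine. -/
def coshDiff (u w : B) : B := zsum fun m => if Even m then
  (PowerSeries.C (((m + 2).factorial : ℝ)⁻¹) : K) •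
    ∑ i ∈ Finset.range (m / 2 + 1), (u * u) ^ i * w ^ (m / 2 - i) else 0

/-- The series `∑ z ^ (2 n) w ^ n / (2 n)!`. -/
def coshSqrt (w : B) : B := zsum fun m => if Even m then
  (PowerSeries.C ((m.factorial : ℝ)⁻¹) : K) • w ^ (m / 2) else 0

/-- Termwise, (u²)^{n+1} - w^{n+1} is u² - w times a geometric sum. This replaces the division of
cosh(zu) - cosh(z√w) by u² - w and needs neither a square root of w nor an inverse of u² - w. -/
lemma coshDiff_mul {u w : B} (h : Commute u w) :
    z ^ 2 • (coshDiff u w * (u * u - w)) = Ch u - coshSqrt w := by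
  have hC : Ch u = 1 + z • z • zsum fun m => if Even m then
      (PowerSeries.C (((m + 2).factorial : ℝ)⁻¹) : K) • (u * u) ^ (m / 2 + 1) else 0 := by
    rw [Ch, fc_apply, zsum_succ, zsum_succ]
    have : ∀ n : ℕ, (PowerSeries.C (PowerSeries.coeff (n + 1 + 1) coshSeries) : K) •
        u ^ (n + 1 + 1) = if Even n then
      (PowerSeries.C (((n + 2).factorial : ℝ)⁻¹) : K) • (u * u) ^ (n / 2 + 1) else 0 := by
      intro n
      by_cases hn : Even n
      · rw [if_pos hn, ← pow_two, ← pow_mul, mul_add, Nat.two_mul_div_two_of_even hn]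
        simp [coshSeries, Nat.even_add_one, hn]
      · simp [coshSeries, Nat.even_add_one, hn]
    simp only [this]
    simp [coshSeries]
  have hW : coshSqrt w = 1 + z • z • zsum fun m => if Even m then
      (PowerSeries.C (((m + 2).factorial : ℝ)⁻¹) : K) • w ^ (m / 2 + 1) else 0 := by
    rw [coshSqrt, zsum_succ, zsum_succ]
    have : ∀ n : ℕ, (n + 1 + 1) / 2 = n / 2 + 1 := fun n => by omega
    simp [Nat.even_add_one, this]
  rw [hC, hW, add_sub_add_left_eq_sub, ← smul_sub, ← smul_sub, pow_two, mul_smul]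
  congr 2
  rw [coshDiff, zsum_mul, eq_sub_iff_add_eq, ← zsum_add]
  congr 1
  funext m
  split_ifs
  · have hc : Commute (u * u) w := h.mul_left h
    have hg := hc.geom_sum₂_mul (m / 2 + 1)
    simp only [Nat.add_sub_cancel] at hg
    rw [smul_mul_assoc, hg, ← smul_add, sub_add_cancel]
  · simp

lemma semiconjBy_coshDiff {a u u' w : B} (hu : SemiconjBy a u u') (hw : Commute a w) :
    SemiconjBy a (coshDiff u w) (coshDiff u' w) := by
  rw [SemiconjBy, coshDiff, coshDiff, mul_zsum, zsum_mul]
  congr 1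
  funext m
  split_ifs
  · rw [mul_smul_comm, smul_mul_assoc, Finset.mul_sum, Finset.sum_mul]
    congr 1
    exact Finset.sum_congr rfl fun i _ => (((hu.mul_right hu).pow_right i).mul_right
      (hw.pow_right _)).eq
  · simp

lemma coshDiff_zero : coshDiff (0 : B) 0 = algebraMap K B (PowerSeries.C 2⁻¹) := by
  have h : ∀ m : ℕ, (if Even (m + 1) then (PowerSeries.C (((m + 1 + 2).factorial : ℝ)⁻¹) : K) •
      ∑ i ∈ Finset.range ((m + 1) / 2 + 1), ((0 : B) * 0) ^ i * 0 ^ ((m + 1) / 2 - i) else 0) =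
        0 := by
    intro m
    split_ifs with hm
    · have h0 : (m + 1) / 2 ≠ 0 := by
        rintro h0
        rcases m with _ | m
        · simp at hm
        · omega
      rw [Finset.sum_eq_zero, smul_zero]
      intro i _
      rcases i with _ | i
      · rw [Nat.sub_zero, zero_pow h0, mul_zero]
      · rw [mul_zero, zero_pow i.succ_ne_zero, zero_mul]
    · rfl
  rw [coshDiff, zsum_succ]
  simp only [h, zsum_zero]
  simp [Algebra.algebraMap_eq_smul_one]

/-- The quantum analogue of the generator `e` of a triple `[h, e] = 2 l e`, `[h, f] = -2 l f`,
`[f, e] = h`. -/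
def quantE (l : K) (f e h : B) : B := ((2 : K) * fc l sinhcSeries⁻¹) •
  (coshDiff (h - algebraMap K B l)
    ((h - algebraMap K B l) * (h - algebraMap K B l) - (4 * l) • (e * f)) * e)

lemma commute_quantE {l : K} {f e h g : B} (hf : Commute g f) (he : Commute g e)
    (hh : Commute g h) : Commute g (quantE l f e h) := by
  have hu : Commute g (h - algebraMap K B l) := hh.sub_right (Algebra.commutes l g).symm
  exact ((semiconjBy_coshDiff hu ((hu.mul_right hu).sub_right
    ((he.mul_right hf).smul_right _))).mul_right he).smul_right _

lemma mul_quantE_of_shift {l μ : K} {f e h g : B} (hf : g * f = f * g + -μ • f)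
    (he : g * e = e * g + μ • e) (hh : Commute g h) :
    g * quantE l f e h = quantE l f e h * g + μ • quantE l f e h := by
  have hu : Commute g (h - algebraMap K B l) := hh.sub_right (Algebra.commutes l g).symm
  have hef : Commute g (e * f) := by
    rw [Commute, SemiconjBy, ← mul_assoc, he, add_mul, mul_assoc, hf, mul_add, mul_assoc,
      smul_mul_assoc, mul_smul_comm]
    module
  have hR := (semiconjBy_coshDiff hu ((hu.mul_right hu).sub_right (hef.smul_right (4 * l)))).eq
  rw [quantE, mul_smul_comm, ← mul_assoc, hR, mul_assoc, he, mul_add, mul_smul_comm,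
    smul_mul_assoc, mul_assoc]
  module

/-- The degenerate triple, needed when ρ = 0: at u = w = 0 the divided difference is 1/2, which the
normalizing factor 2 compensates. -/
lemma quantE_zero (f e : B) : quantE 0 f e 0 = e := by
  have h2 : (PowerSeries.C (2⁻¹ : ℝ) : K) * 2 = 1 := by
    rw [← map_ofNat PowerSeries.C 2, ← map_mul]; norm_num
  rw [quantE]
  simp only [map_zero, sub_zero, mul_zero, zero_smul]
  rw [coshDiff_zero, fc_zero, ← Algebra.smul_def, smul_smul, PowerSeries.constantCoeff_inv,
    constantCoeff_sinhcSeries]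
  simp only [inv_one, map_one, mul_one]
  rw [mul_comm, h2, one_smul]

/-- With u = h - l, the element w = u² - 4l ef is a Casimir element, commuting with f and h. Moving
f past u turns u into h + l, and (h + l)² - w = 4l fe while u² - w = 4l ef. Hence 4l z² times the
commutator of f with `coshDiff u w * e` is a difference of two numerators in which cosh(z√w) drops
out: cosh z(h + l) - cosh z(h - l) = 2 sinh(zh) sinh(zl). The factor in `quantE` removes the
constant sinh(zl)/(zl) / 2; invertibility of l permits dividing by 4l. -/
lemma mul_quantE [ZTorsionFree B] {l l' : K} (hl : l' * l = 1) {f e h : B}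
    (hfe : f * e = e * f + h) (hfh : f * h = h * f + (2 * l) • f)
    (heh : e * h = h * e - (2 * l) • e) :
    f * quantE l f e h = quantE l f e h * f + Sh h := by
  set m := algebraMap K B l with hm
  have hmc : ∀ b : B, m * b = l • b := fun b => (Algebra.smul_def l b).symm
  have hmc' : ∀ b : B, b * m = l • b := fun b => by rw [← hmc, hm, Algebra.commutes]
  set u := h - m with hu
  set w := u * u - (4 * l) • (e * f) with hw
  have hhc : Commute h (e * f) := by
    have hhe : h * e = e * h + (2 * l) • e := by rw [heh]; abel
    have hhf : h * f = f * h - (2 * l) • f := by rw [hfh]; abel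
    rw [Commute, SemiconjBy, ← mul_assoc, hhe, add_mul, mul_assoc, hhf, mul_sub, mul_smul_comm,
      smul_mul_assoc, mul_assoc]
    abel
  have hmw : ∀ b, Commute m b := fun b => Algebra.commutes l b
  have hhu : Commute h u := (Commute.refl h).sub_right (hmw h).symm
  have hhw : Commute h w := (hhu.mul_right hhu).sub_right (hhc.smul_right _)
  have huw : Commute u w := hhw.sub_left (hmw w)
  have hfu : SemiconjBy f u (h + m) := by
    rw [SemiconjBy, hu, mul_sub, hfh, hmc', add_mul, hmc]
    module
  have hfw : Commute f w := by
    have h1 := (hfu.mul_right hfu).eq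
    rw [Commute, SemiconjBy, hw, mul_sub, h1, mul_smul_comm, ← mul_assoc, hfe, hu]
    simp only [mul_add, add_mul, mul_sub, sub_mul, hmc, hmc', mul_assoc, smul_mul_assoc,
      smul_add, smul_sub, smul_smul]
    module
  have hww : (h + m) * (h + m) - w = (4 * l) • (f * e) := by
    rw [hw, hfe, hu]
    simp only [mul_add, add_mul, mul_sub, sub_mul, hmc, hmc', mul_assoc, smul_mul_assoc,
      smul_add, smul_sub, smul_smul]
    module
  have hwe : u * u - w = (4 * l) • (e * f) := by rw [hw]; abel
  have hR := (semiconjBy_coshDiff hfu hfw).eq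
  have e1 := coshDiff_mul huw
  have e2 : z ^ 2 • (coshDiff (h + m) w * ((h + m) * (h + m) - w)) = Ch (h + m) - coshSqrt w :=
    coshDiff_mul (hhw.add_left (hmw w))
  have e3 : Ch (h + m) - Ch u = z ^ 2 • (2 * l * fc l sinhcSeries) • Sh h := by
    have hS : Sh m = algebraMap K B (l * fc l sinhcSeries) := (map_Sh (Algebra.ofId K B) l).symm
    rw [hu, sub_eq_add_neg h m, Ch_add (hmw h).symm, Ch_add (hmw h).symm.neg_right, Ch_neg, Sh_neg,
      hS, mul_neg, ← Algebra.commutes, ← Algebra.smul_def]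
    module
  -- The series sinh X / X has constant term 1, so its value at z l is invertible in `K`.
  have hσ : fc l sinhcSeries * fc l sinhcSeries⁻¹ = 1 := by
    rw [← map_mul, PowerSeries.mul_inv_cancel _ (by simp [constantCoeff_sinhcSeries]), map_one]
  have key : (2 * fc l sinhcSeries⁻¹) • (f * (coshDiff u w * e) - coshDiff u w * e * f) = Sh h := by
    have h4 : z ^ 2 • (4 * l) • (f * (coshDiff u w * e) - coshDiff u w * e * f) =
        z ^ 2 • (2 * l * fc l sinhcSeries) • Sh h := by
      rw [← e3, ← sub_sub_sub_cancel_right (Ch (h + m)) (Ch u) (coshSqrt w), ← e1, ← e2, hww, hwe,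
        ← mul_assoc f,
        hR, mul_smul_comm, mul_smul_comm]
      simp only [mul_assoc]
      module
    simp only [pow_two, mul_smul z z] at h4
    have h5 := congrArg (l' • ·) (z_smul_cancel (z_smul_cancel h4))
    rw [smul_smul, smul_smul, show l' * (4 * l) = 2 * 2 * (l' * l) by ring,
      show l' * (2 * l * fc l sinhcSeries) = 2 * fc l sinhcSeries * (l' * l) by ring, hl, mul_one,
      mul_one, mul_smul, mul_smul] at h5
    rw [mul_comm, mul_smul, two_smul_cancel h5, smul_smul, mul_comm, hσ, one_smul]
  rw [quantE, ← hm, ← hu, ← hw, mul_smul_comm, smul_mul_assoc, ← key, smul_sub]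
  abel

end Triple

lemma E_neg_mul_mul_E {B : Type} [Ring B] [Algebra K B] [ZComplete B] {a h : B} {μ : K}
    (hah : a * h = h * a + μ • a) : E (-h) * a * E h = (E μ : K) • a := by
  rw [mul_assoc, mul_E_of_shift' hah, mul_smul_comm, ← mul_assoc, E_neg_mul_E, one_mul]

lemma RelC.op_twist {B : Type} [Ring B] [Algebra K B] [ZComplete B] {κ l : K} {G : Gen → B}
    (h : RelC κ l G) : RelC κ l fun g => MulOpposite.op
      (-(E (-twistC κ l G g) * G g * E (twistC κ l G g))) := by
  have hg : ∀ g, E (-twistC κ l G g) * G g * E (twistC κ l G g) =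
      (Sum.elim ![1, E l, E (-(l * κ * κ))] ![1, E (-l), E (l * κ * κ)] g : K) • G g := by
    obtain ⟨h1, h2, h3, h4, h5, h6, h7, h8, h9, h10, h11, h12, h13, h14, h15⟩ := h
    intro g
    rcases g with i | i <;> fin_cases i
    · simp [twistC, E_zero]
    · refine E_neg_mul_mul_E (h := -(l • G (.inl 0))) (a := G (.inl 1)) ?_
      simp only [mul_neg, neg_mul, mul_smul_comm, smul_mul_assoc, h1]; module
    · refine E_neg_mul_mul_E (h := (l * κ) • G (.inl 0)) (a := G (.inl 2)) ?_
      simp only [mul_neg, neg_mul, mul_smul_comm, smul_mul_assoc, h2]; module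
    · simp [twistC, E_zero]
    · refine E_neg_mul_mul_E (h := G (.inr 0)) (a := G (.inr 1)) ?_
      rw [h4]; module
    · refine E_neg_mul_mul_E (h := κ • G (.inr 0)) (a := G (.inr 2)) ?_
      simp only [mul_neg, neg_mul, mul_smul_comm, smul_mul_assoc, h5]; module
  simp only [hg]
  exact h.op (E_mul_E_neg _) (E_neg_mul_E _)

lemma map_twistC {A B : Type} [Ring A] [Algebra K A] [Ring B] [Algebra K B] (F : A →ₐ[K] B)
    (κ l : K) (G : Gen → A) (g : Gen) :
    F (twistC κ l G g) = twistC κ l (fun g => F (G g)) g := by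
  rcases g with i | i <;> fin_cases i <;> simp [twistC]

lemma cocomm_bialgC {A : Type} [Ring A] [Algebra K A] (ρ l : ℝ) (G H : Gen → A) (g : Gen) :
    ∑ a : Gen, ∑ b : Gen, (PowerSeries.C ((bialgC ρ l).cocomm g a b) : K) • (G a * H b) =
      G g * twistC (PowerSeries.C ρ) (PowerSeries.C l) H g -
        twistC (PowerSeries.C ρ) (PowerSeries.C l) G g * H g := by
  rcases g with i | i <;> fin_cases i
  all_goals simp [LieBialgebra.cocomm, bialgC, r3, skewConst, Fin.sum_univ_three, twistC]
  all_goals module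

/-! ### Deforming map for the second `(𝔯₃(ρ), 𝔯₃(-ρ))` -/

section DeformC

variable {B : Type} [Ring B] [Algebra K B]

/-- The relations of the enveloping algebra of the double of the second `(𝔯₃(κ), 𝔯₃(-κ))`. -/
structure LieRelC (κ l : K) (G : Gen → B) : Prop where
  x0x1 : G (.inl 0) * G (.inl 1) = G (.inl 1) * G (.inl 0) + G (.inl 1)
  x0x2 : G (.inl 0) * G (.inl 2) = G (.inl 2) * G (.inl 0) + κ • G (.inl 2)
  x1x2 : G (.inl 1) * G (.inl 2) = G (.inl 2) * G (.inl 1)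
  X0X1 : G (.inr 0) * G (.inr 1) = G (.inr 1) * G (.inr 0) + l • G (.inr 1)
  X0X2 : G (.inr 0) * G (.inr 2) = G (.inr 2) * G (.inr 0) + -((l * κ) • G (.inr 2))
  X1X2 : G (.inr 1) * G (.inr 2) = G (.inr 2) * G (.inr 1)
  x0X0 : G (.inl 0) * G (.inr 0) = G (.inr 0) * G (.inl 0)
  x1X0 : G (.inl 1) * G (.inr 0) = G (.inr 0) * G (.inl 1) + l • G (.inl 1)
  x2X0 : G (.inl 2) * G (.inr 0) = G (.inr 0) * G (.inl 2) + -((l * κ) • G (.inl 2))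
  x0X1 : G (.inl 0) * G (.inr 1) = G (.inr 1) * G (.inl 0) + -G (.inr 1)
  x1X1 : G (.inl 1) * G (.inr 1) = G (.inr 1) * G (.inl 1) + (-(l • G (.inl 0)) + G (.inr 0))
  x2X1 : G (.inl 2) * G (.inr 1) = G (.inr 1) * G (.inl 2)
  x0X2 : G (.inl 0) * G (.inr 2) = G (.inr 2) * G (.inl 0) + -(κ • G (.inr 2))
  x1X2 : G (.inl 1) * G (.inr 2) = G (.inr 2) * G (.inl 1)
  x2X2 : G (.inl 2) * G (.inr 2) = G (.inr 2) * G (.inl 2) + κ • (l • G (.inl 0) + G (.inr 0))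

lemma RelC.lieRel [ZComplete B] (hz : ∀ b : B, z • b = 0) {κ l : K} {G : Gen → B}
    (h : RelC κ l G) : LieRelC κ l G := by
  obtain ⟨h1, h2, h3, h4, h5, h6, h7, h8, h9, h10, h11, h12, h13, h14, h15⟩ := h
  simp only [Sh_of_z_smul hz] at *
  exact ⟨h1, h2, h3, h4, h5, h6, h7, h8, h9, h10, h11, h12, h13, h14, h15⟩

lemma LieRelC.evalDouble_lie {ρ l : ℝ} {G : Gen → B}
    (h : LieRelC (PowerSeries.C ρ) (PowerSeries.C l) G)
    (u v : (bialgC ρ l).Double) : evalDouble (bialgC ρ l) G ⁅u, v⁆ =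
      evalDouble (bialgC ρ l) G u * evalDouble (bialgC ρ l) G v -
        evalDouble (bialgC ρ l) G v * evalDouble (bialgC ρ l) G u := by
  have hb : ⁅u, v⁆ = _ := doubleBracket_C ρ l u v
  obtain ⟨h1, h2, h3, h4, h5, h6, h7, h8, h9, h10, h11, h12, h13, h14, h15⟩ := h
  rw [hb]
  simp only [evalDouble, Fin.sum_univ_three, Matrix.cons_val, map_add, map_sub, map_mul, map_neg,
    map_one, map_zero, mul_add, add_mul, smul_mul_assoc, mul_smul_comm,
    h1, h2, h3, h4, h5, h6, h7, h8, h9, h10, h11, h12, h13, h14, h15]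
  module

/-- The generators of the quantum double in terms of those of the enveloping algebra. -/
def deformC [ZComplete B] (κ l : K) (G : Gen → B) : Gen → B := Sum.elim
  ![G (.inl 0), G (.inl 1), G (.inl 2)]
  ![G (.inr 0),
    quantE l (G (.inl 1)) (G (.inr 1)) (-(l • G (.inl 0)) + G (.inr 0)),
    quantE (-(l * κ * κ)) (G (.inl 2)) (G (.inr 2)) (κ • (l • G (.inl 0) + G (.inr 0)))]

/-- (x^1, X_1, X_0 - l x^0) and (x^2, X_2, κ(l x^0 + X_0)) are triples for `mul_quantE` with
parameters l and -lκ², and each commutes with the other. Deforming only X_1 and X_2 within their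
triples therefore keeps the mixed relations, and x^0, X_0 still act with the same weights. -/
lemma LieRelC.deform [ZComplete B] [ZTorsionFree B] {κ l l' κ' : K} (hl : l' * l = 1)
    (hκ : κ = 0 ∨ κ' * κ = 1) {G : Gen → B} (h : LieRelC κ l G) : RelC κ l (deformC κ l G) := by
  obtain ⟨h1, h2, h3, h4, h5, h6, h7, h8, h9, h10, h11, h12, h13, h14, h15⟩ := h
  have c3 : Commute (G (.inl 1)) (G (.inl 2)) := h3
  have c6 : Commute (G (.inr 1)) (G (.inr 2)) := h6
  have c7 : Commute (G (.inl 0)) (G (.inr 0)) := h7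
  have c12 : Commute (G (.inl 2)) (G (.inr 1)) := h12
  have c14 : Commute (G (.inl 1)) (G (.inr 2)) := h14
  have hx0 : Commute (G (.inl 0)) (-(l • G (.inl 0)) + G (.inr 0)) :=
    ((Commute.refl _).smul_right l).neg_right.add_right h7
  have hx0' : Commute (G (.inl 0)) (κ • (l • G (.inl 0) + G (.inr 0))) :=
    (((Commute.refl _).smul_right l).add_right h7).smul_right κ
  have hX0 : Commute (G (.inr 0)) (-(l • G (.inl 0)) + G (.inr 0)) :=
    (c7.symm.smul_right l).neg_right.add_right (Commute.refl _)
  have hX0' : Commute (G (.inr 0)) (κ • (l • G (.inl 0) + G (.inr 0))) :=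
    ((c7.symm.smul_right l).add_right (Commute.refl _)).smul_right κ
  have hx1 : Commute (G (.inl 1)) (κ • (l • G (.inl 0) + G (.inr 0))) := by
    refine Commute.smul_right ?_ κ
    rw [Commute, SemiconjBy]
    simp only [mul_add, add_mul, smul_mul_assoc, mul_smul_comm, h1, h8]
    module
  have hX1 : Commute (G (.inr 1)) (κ • (l • G (.inl 0) + G (.inr 0))) := by
    refine Commute.smul_right ?_ κ
    rw [Commute, SemiconjBy]
    simp only [mul_add, add_mul, smul_mul_assoc, mul_smul_comm, h10, h4]
    module
  have hx2 : Commute (G (.inl 2)) (-(l • G (.inl 0)) + G (.inr 0)) := by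
    rw [Commute, SemiconjBy]
    simp only [mul_add, add_mul, smul_mul_assoc, mul_smul_comm, mul_neg, neg_mul, h2, h9]
    module
  have hX2 : Commute (G (.inr 2)) (-(l • G (.inl 0)) + G (.inr 0)) := by
    rw [Commute, SemiconjBy]
    simp only [mul_add, add_mul, smul_mul_assoc, mul_smul_comm, mul_neg, neg_mul, h13, h5]
    module
  have hH : Commute (-(l • G (.inl 0)) + G (.inr 0)) (κ • (l • G (.inl 0) + G (.inr 0))) :=
    (hx0'.smul_left l).neg_left.add_left hX0'
  constructor
  all_goals dsimp only [deformC, Sum.elim_inl, Sum.elim_inr, Matrix.cons_val]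
  · exact h1
  · exact h2
  · exact h3
  · exact mul_quantE_of_shift (by rw [h8]; module) h4 hX0
  · rw [← neg_smul]
    exact mul_quantE_of_shift (by rw [h9]; module) (by rw [h5]; module) hX0'
  · exact commute_quantE (commute_quantE c3.symm c12 hx2).symm
      (commute_quantE c14.symm c6.symm hX2).symm
      (commute_quantE hx1.symm hX1.symm hH.symm).symm
  · exact h7
  · exact h8
  · exact h9
  · rw [← neg_one_smul K (quantE _ _ _ _)]
    exact mul_quantE_of_shift (by rw [h1]; module) (by rw [h10]; module) hx0
  · refine mul_quantE hl h11 ?_ ?_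
    · simp only [mul_add, add_mul, smul_mul_assoc, mul_smul_comm, mul_neg, neg_mul, h1, h8]
      module
    · simp only [mul_add, add_mul, smul_mul_assoc, mul_smul_comm, mul_neg, neg_mul, h10, h4]
      module
  · exact commute_quantE c3.symm c12 hx2
  · rw [← neg_smul]
    exact mul_quantE_of_shift (by rw [h2]; module) (by rw [h13]; module) hx0'
  · exact commute_quantE c3 c14 hx1
  -- For κ = 0 the parameter of the second triple is not invertible, but then h = 0 and X_2 is left
  -- unchanged.
  · rcases hκ with rfl | hκ
    · simp only [mul_zero, zero_smul, neg_zero, quantE_zero, Sh_zero] at h15 ⊢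
      exact h15
    · refine mul_quantE (l' := -(l' * κ' * κ')) ?_ h15 ?_ ?_
      · linear_combination hl * (κ' * κ) ^ 2 + hκ * (κ' * κ + 1)
      · simp only [mul_add, add_mul, smul_mul_assoc, mul_smul_comm, h2, h9]
        module
      · simp only [mul_add, add_mul, smul_mul_assoc, mul_smul_comm, h13, h5]
        module

end DeformC

section

attribute [local instance] seriesAlgebra

attribute [local instance] LieRing.ofAssociativeRing

lemma lieRelC_ueaGen (ρ l : ℝ) :
    LieRelC (PowerSeries.C ρ) (PowerSeries.C l) (ueaGen (bialgC ρ l)) := by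
  have hb : ∀ u v : (bialgC ρ l).Double, ⁅u, v⁆ = _ := fun u v => doubleBracket_C ρ l u v
  constructor
  all_goals rw [ueaGen_mul, hb]
  all_goals simp [evalDouble, Fin.sum_univ_three, LieBialgebra.gen, sub_eq_add_neg]
  all_goals module

lemma constantCoeff_zsum {R : Type} [Ring R] [Algebra ℝ R] (c : ℕ → R⟦X⟧) :
    PowerSeries.constantCoeff (zsum c) = PowerSeries.constantCoeff (c 0) := by
  rw [zsum_succ, map_add, z_smul_series, map_mul, PowerSeries.constantCoeff_X, zero_mul, add_zero]

/-- Modulo z the divided difference of cosh is 1/2 and the normalizing factor is 2. -/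
lemma constantCoeff_quantE {R : Type} [Ring R] [Algebra ℝ R] (l : K) (f e h : R⟦X⟧) :
    PowerSeries.constantCoeff (quantE l f e h) = PowerSeries.constantCoeff e := by
  have h1 : PowerSeries.constantCoeff (fc l sinhcSeries⁻¹ : K) = 1 := by
    rw [fc_apply, zsum_succ, map_add, smul_eq_mul, smul_eq_mul, map_mul, map_mul,
      PowerSeries.constantCoeff_X]
    simp [constantCoeff_sinhcSeries]
  rw [quantE, constantCoeff_smul_series, map_mul, map_mul, h1, coshDiff, constantCoeff_zsum]
  simp [constantCoeff_smul_series]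
  rw [map_ofNat, smul_smul]
  norm_num

lemma coprod_quantumC (ρ l : ℝ) (P : QuantumData) (g : Gen) :
    Completion.of _ (Algebra.TensorProduct.map P.proj P.proj ((quantumC ρ l).coprod g)) =
      twist (inl2 _) (inr2 _) (P.gen g) (twistC (PowerSeries.C ρ) (PowerSeries.C l) P.gen g) := by
  rcases g with i | i <;> fin_cases i
  all_goals
    simp [quantumC, twist, twistC, coprod_tmul, -Algebra.TensorProduct.map_tmul, proj_expZ,
      wordLift_X, wordLift_x, wordLift_smul, map_E, proj_xz, proj_Xz, E_zero]

theorem isHopfQuantization_C (ρ : ℝ) {l : ℝ} (hl : l ≠ 0) :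
    IsHopfQuantization (bialgC ρ l) (quantumC ρ l) := by
  have hl' : (PowerSeries.C l⁻¹ : K) * PowerSeries.C l = 1 := by
    rw [← map_mul, inv_mul_cancel₀ hl, map_one]
  have hρ : (PowerSeries.C ρ : K) = 0 ∨ (PowerSeries.C ρ⁻¹ : K) * PowerSeries.C ρ = 1 := by
    rcases eq_or_ne ρ 0 with rfl | h
    · exact .inl (map_zero _)
    · exact .inr (by rw [← map_mul, inv_mul_cancel₀ h, map_one])
  refine isHopfQuantization_of_deformingMap
    (QuantumData.lift _ ((relC_iff ρ l _).2 ((lieRelC_ueaGen ρ l).deform hl' hρ))) (fun g => ?_)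
    ((((relC_gen ρ l).map (RingCon.mkₐ K (zCon _ 1))).lieRel z_smul_level_one).evalDouble_lie)
    fun htf => ?_
  · rw [QuantumData.lift_gen]
    rcases g with i | i <;> fin_cases i
    all_goals simp [deformC, constantCoeff_quantE, ueaGen]
  · have h := relC_gen ρ l
    refine exists_hopfData_of_twist (h := twistC (PowerSeries.C ρ) (PowerSeries.C l)
      (quantumC ρ l).gen) (fun g => ?_) ((relC_iff ρ l _).2 (h.comul commute_inl2_inr2))
      ((relC_iff ρ l _).2 (relC_zero _ _)) ((relC_iff ρ l _).2 ?_) (coprod_quantumC ρ l _)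
      fun g => ?_
    · rcases g with i | i <;> fin_cases i
      exacts [⟨0, .inl 0, (zero_smul _ _).symm, rfl⟩, ⟨-PowerSeries.C l, .inl 0,
        (neg_smul _ _).symm, rfl⟩, ⟨_, .inl 0, rfl, rfl⟩, ⟨0, .inl 0, (zero_smul _ _).symm, rfl⟩,
        ⟨1, .inr 0, (one_smul _ _).symm, rfl⟩, ⟨_, .inr 0, rfl, rfl⟩]
    · exact h.op_twist
    · rw [map_twistC, map_twistC, cocomm_bialgC]

end

/-! ## The quantum double of the first `(𝔯₃(ρ), 𝔯₃(-ρ))` -/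

section RelB

variable {B : Type} [Ring B] [Algebra K B]

/-- The relations of the quantum double of the first `(𝔯₃(κ), 𝔯₃(-κ))`. -/
structure RelB [ZComplete B] (κ : K) (G : Gen → B) : Prop where
  x0x1 : G (.inl 0) * G (.inl 1) = G (.inl 1) * G (.inl 0) + Sh (G (.inl 1))
  x0x2 : G (.inl 0) * G (.inl 2) = G (.inl 2) * G (.inl 0) + κ • (G (.inl 2) * Ch (G (.inl 1)))
  x1x2 : G (.inl 1) * G (.inl 2) = G (.inl 2) * G (.inl 1)
  X0X1 : G (.inr 0) * G (.inr 1) = G (.inr 1) * G (.inr 0) + Sh (G (.inr 0))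
  X0X2 : G (.inr 0) * G (.inr 2) = G (.inr 2) * G (.inr 0)
  X1X2 : G (.inr 1) * G (.inr 2) = G (.inr 2) * G (.inr 1) + κ • (G (.inr 2) * Ch (G (.inr 0)))
  x0X0 : G (.inl 0) * G (.inr 0) = G (.inr 0) * G (.inl 0) + Sh (G (.inl 1))
  x1X0 : G (.inl 1) * G (.inr 0) = G (.inr 0) * G (.inl 1)
  x2X0 : G (.inl 2) * G (.inr 0) = G (.inr 0) * G (.inl 2)
  x0X1 : G (.inl 0) * G (.inr 1) = G (.inr 1) * G (.inl 0) +
    (-(Ch (G (.inr 0)) * G (.inl 0)) - Ch (G (.inl 1)) * G (.inr 1))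
  x1X1 : G (.inl 1) * G (.inr 1) = G (.inr 1) * G (.inl 1) + Sh (G (.inr 0))
  x2X1 : G (.inl 2) * G (.inr 1) = G (.inr 1) * G (.inl 2) + κ • (G (.inl 2) * Ch (G (.inr 0)))
  x0X2 : G (.inl 0) * G (.inr 2) = G (.inr 2) * G (.inl 0) +
    -(κ • (G (.inr 2) * Ch (G (.inl 1))))
  x1X2 : G (.inl 1) * G (.inr 2) = G (.inr 2) * G (.inl 1)
  x2X2 : G (.inl 2) * G (.inr 2) = G (.inr 2) * G (.inl 2) + Sh (κ • (-G (.inl 1) + G (.inr 0)))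

/-- The relations of the enveloping algebra of the double of the first `(𝔯₃(κ), 𝔯₃(-κ))`. -/
structure LieRelB (κ : K) (G : Gen → B) : Prop where
  x0x1 : G (.inl 0) * G (.inl 1) = G (.inl 1) * G (.inl 0) + G (.inl 1)
  x0x2 : G (.inl 0) * G (.inl 2) = G (.inl 2) * G (.inl 0) + κ • G (.inl 2)
  x1x2 : G (.inl 1) * G (.inl 2) = G (.inl 2) * G (.inl 1)
  X0X1 : G (.inr 0) * G (.inr 1) = G (.inr 1) * G (.inr 0) + G (.inr 0)
  X0X2 : G (.inr 0) * G (.inr 2) = G (.inr 2) * G (.inr 0)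
  X1X2 : G (.inr 1) * G (.inr 2) = G (.inr 2) * G (.inr 1) + κ • G (.inr 2)
  x0X0 : G (.inl 0) * G (.inr 0) = G (.inr 0) * G (.inl 0) + G (.inl 1)
  x1X0 : G (.inl 1) * G (.inr 0) = G (.inr 0) * G (.inl 1)
  x2X0 : G (.inl 2) * G (.inr 0) = G (.inr 0) * G (.inl 2)
  x0X1 : G (.inl 0) * G (.inr 1) = G (.inr 1) * G (.inl 0) + (-G (.inl 0) - G (.inr 1))
  x1X1 : G (.inl 1) * G (.inr 1) = G (.inr 1) * G (.inl 1) + G (.inr 0)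
  x2X1 : G (.inl 2) * G (.inr 1) = G (.inr 1) * G (.inl 2) + κ • G (.inl 2)
  x0X2 : G (.inl 0) * G (.inr 2) = G (.inr 2) * G (.inl 0) + -(κ • G (.inr 2))
  x1X2 : G (.inl 1) * G (.inr 2) = G (.inr 2) * G (.inl 1)
  x2X2 : G (.inl 2) * G (.inr 2) = G (.inr 2) * G (.inl 2) + κ • (-G (.inl 1) + G (.inr 0))

lemma relB_iff [ZComplete B] (ρ : ℝ) (G : Gen → B) :
    (∀ r ∈ (quantumB ρ).rels, freeLift G r = 0) ↔ RelB (PowerSeries.C ρ) G := by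
  simp only [quantumB, Set.mem_insert_iff, Set.mem_singleton_iff, forall_eq_or_imp, forall_eq,
    map_sub, map_mul, map_neg, freeLift_comm, freeLift_xz, freeLift_Xz, freeLift_smul,
    freeLift_coshZ, freeLift_sinhDivZ, wordLift_smul, wordLift_X, wordLift_x,
    comm_sub_eq_zero_iff, map_add, map_one, comm_eq_zero_iff]
  constructor
  · rintro ⟨h1, h2, h3, h4, h5, h6, h7, h8, h9, h10, h11, h12, h13, h14, h15⟩
    exact ⟨h1, h2, h3, h4, h5, h6, h7, h8, h9, h10, h11, h12, h13, h14, h15⟩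
  · rintro ⟨h1, h2, h3, h4, h5, h6, h7, h8, h9, h10, h11, h12, h13, h14, h15⟩
    exact ⟨h1, h2, h3, h4, h5, h6, h7, h8, h9, h10, h11, h12, h13, h14, h15⟩

lemma relB_gen (ρ : ℝ) : RelB (PowerSeries.C ρ) (quantumB ρ).gen :=
  (relB_iff ρ _).1 fun r hr => by
    rw [← QuantumData.proj_eq_freeLift, QuantumData.proj_rel _ hr]

lemma RelB.map [ZComplete B] {κ : K} {G : Gen → B} (h : RelB κ G) {B' : Type} [Ring B']
    [Algebra K B'] [ZComplete B'] (F : B →ₐ[K] B') : RelB κ fun g => F (G g) := by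
  constructor
  all_goals simp only [← map_mul, h.x0x1, h.x0x2, h.x1x2, h.X0X1, h.X0X2, h.X1X2, h.x0X0, h.x1X0,
    h.x2X0, h.x0X1, h.x1X1, h.x2X1, h.x0X2, h.x1X2, h.x2X2]
  all_goals simp only [map_mul, map_add, map_sub, map_neg, map_smul, map_Sh, map_Ch]

lemma relB_zero (κ : K) : RelB κ fun _ => (0 : K) := by
  constructor <;> simp [Sh_zero]

lemma RelB.lieRel [ZComplete B] (hz : ∀ b : B, z • b = 0) {κ : K} {G : Gen → B}
    (h : RelB κ G) : LieRelB κ G := by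
  obtain ⟨h1, h2, h3, h4, h5, h6, h7, h8, h9, h10, h11, h12, h13, h14, h15⟩ := h
  simp only [Ch_of_z_smul hz, Sh_of_z_smul hz, mul_one, one_mul] at *
  exact ⟨h1, h2, h3, h4, h5, h6, h7, h8, h9, h10, h11, h12, h13, h14, h15⟩

lemma LieRelB.evalDouble_lie {ρ : ℝ} {G : Gen → B} (h : LieRelB (PowerSeries.C ρ) G)
    (u v : (bialgB ρ).Double) : evalDouble (bialgB ρ) G ⁅u, v⁆ =
      evalDouble (bialgB ρ) G u * evalDouble (bialgB ρ) G v -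
        evalDouble (bialgB ρ) G v * evalDouble (bialgB ρ) G u := by
  have hb : ⁅u, v⁆ = _ := doubleBracket_B ρ u v
  obtain ⟨h1, h2, h3, h4, h5, h6, h7, h8, h9, h10, h11, h12, h13, h14, h15⟩ := h
  rw [hb]
  simp only [evalDouble, Fin.sum_univ_three, Matrix.cons_val, map_add, map_sub, map_mul, map_neg,
    map_one, map_zero, mul_add, add_mul, smul_mul_assoc, mul_smul_comm,
    h1, h2, h3, h4, h5, h6, h7, h8, h9, h10, h11, h12, h13, h14, h15]
  module

section

attribute [local instance] seriesAlgebra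

lemma lieRelB_ueaGen (ρ : ℝ) : LieRelB (PowerSeries.C ρ) (ueaGen (bialgB ρ)) := by
  have hb : ∀ u v : (bialgB ρ).Double, ⁅u, v⁆ = _ := fun u v => doubleBracket_B ρ u v
  constructor
  all_goals rw [ueaGen_mul, hb]
  all_goals simp [evalDouble, Fin.sum_univ_three, LieBialgebra.gen, sub_eq_add_neg]

end

/-- The commutation relation of two twisted primitive elements. -/
lemma twist_mul_twist_of_comm [ZComplete B] {A : Type} [Ring A] [Algebra K A] {F₁ F₂ : A →ₐ[K] B}
    (hF : ∀ a b, Commute (F₁ a) (F₂ b)) {a b r ha hb p q : A}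
    (hab : a * b = b * a + r) (h1 : a * hb = hb * a + p) (h2 : b * ha = ha * b + q)
    (hp : Commute p hb) (hq : Commute q ha) (hh : Commute ha hb) :
    twist F₁ F₂ a ha * twist F₁ F₂ b hb = twist F₁ F₂ b hb * twist F₁ F₂ a ha +
      (E (F₁ ha) * E (F₁ hb) * F₂ r + F₁ r * (E (-F₂ ha) * E (-F₂ hb)) +
      z • (F₁ p * E (F₁ hb) * (E (-F₂ ha) * F₂ b) + E (F₁ hb) * F₁ a * (F₂ q * E (-F₂ ha)) -
        E (F₁ ha) * F₁ b * (F₂ p * E (-F₂ hb)) - F₁ q * E (F₁ ha) * (E (-F₂ hb) * F₂ a))) := by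
  have e1 : F₁ a * E (F₁ hb) = E (F₁ hb) * F₁ a + z • (F₁ p * E (F₁ hb)) :=
    mul_E_of_comm (by rw [← map_mul, h1, map_add, map_mul]) (hp.map F₁)
  have e2 : F₁ b * E (F₁ ha) = E (F₁ ha) * F₁ b + z • (F₁ q * E (F₁ ha)) :=
    mul_E_of_comm (by rw [← map_mul, h2, map_add, map_mul]) (hq.map F₁)
  have e3 : F₂ a * E (-F₂ hb) = E (-F₂ hb) * F₂ a + z • (-F₂ p * E (-F₂ hb)) :=
    mul_E_of_comm (by rw [mul_neg, ← map_mul, h1, map_add, map_mul, neg_add, neg_mul])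
      (hp.map F₂).neg_left.neg_right
  have e4 : F₂ b * E (-F₂ ha) = E (-F₂ ha) * F₂ b + z • (-F₂ q * E (-F₂ ha)) :=
    mul_E_of_comm (by rw [mul_neg, ← map_mul, h2, map_add, map_mul, neg_add, neg_mul])
      (hq.map F₂).neg_left.neg_right
  have e5 : F₁ a * F₁ b = F₁ b * F₁ a + F₁ r := by rw [← map_mul, hab, map_add, map_mul]
  have e6 : F₂ a * F₂ b = F₂ b * F₂ a + F₂ r := by rw [← map_mul, hab, map_add, map_mul]
  have hE : ∀ c d, Commute (F₂ c) (E (F₁ d)) := fun c d => commute_E (hF d c).symm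
  have hE' : ∀ c d, Commute (E (-F₂ c)) (F₁ d) := fun c d => (commute_E (hF d c).neg_right).symm
  have hEE : ∀ c d, Commute (E (-F₂ c)) (E (F₁ d)) := fun c d => commute_E (hE' c d)
  have h3 := (E_comm_E (hh.map F₁)).eq
  have h4 := (E_comm_E (hh.map F₂).neg_left.neg_right).eq
  simp only [twist, add_mul, mul_add]
  rw [(hE a hb).mul_mul_mul_comm, (hF b a).symm.mul_mul_mul_comm,
    (hEE ha hb).mul_mul_mul_comm, (hE' ha b).mul_mul_mul_comm,
    (hE b ha).mul_mul_mul_comm, (hF a b).symm.mul_mul_mul_comm,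
    (hEE hb ha).mul_mul_mul_comm, (hE' hb a).mul_mul_mul_comm,
    e1, e2, e3, e4, e5, e6, h3, h4]
  simp only [mul_add, add_mul, smul_mul_assoc, mul_smul_comm, neg_mul, mul_neg]
  module

end RelB

/-! ### Coproduct for the first `(𝔯₃(ρ), 𝔯₃(-ρ))` -/

section ComulB

variable {B : Type} [Ring B] [Algebra K B] [ZComplete B]
variable {A : Type} [Ring A] [Algebra K A] [ZComplete A] {F₁ F₂ : A →ₐ[K] B}

/-- Here a moves the twist of b not by a scalar multiple of a but by -κ sinh(z h_a)/z.
Differentiating the exponentials yields -sinh ⊗ e^{-z h_a}, which turns e^{z h_a} ⊗ cosh into cosh ⊗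
cosh + sinh ⊗ sinh, that is, cosh of the sum; the other half is symmetric. -/
lemma twist_mul_twist_Ch [ZTorsionFree B] (hF : ∀ a b, Commute (F₁ a) (F₂ b)) {κ : K}
    {a b ha hb : A} (hab : a * b = b * a + κ • (b * Ch ha)) (h1 : a * hb = hb * a + -(κ • Sh ha))
    (h2 : Commute b ha) (hh : Commute ha hb) :
    twist F₁ F₂ a ha * twist F₁ F₂ b hb = twist F₁ F₂ b hb * twist F₁ F₂ a ha +
      κ • (twist F₁ F₂ b hb * Ch (F₁ ha + F₂ ha)) := by
  rw [twist_mul_twist_of_comm hF hab h1 (h2.eq.trans (add_zero _).symm)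
    ((commute_Sh hh.symm).symm.smul_left κ).neg_left (Commute.zero_left _) hh, Ch_add (hF _ _)]
  congr 1
  simp only [map_zero, map_neg, map_smul, map_mul, map_Ch, map_Sh, twist, E_eq (F₁ ha),
    E_neg (F₂ ha), zero_mul, mul_zero]
  let Z : Fin 4 → B := ![Ch (F₁ ha), Sh (F₁ ha), Ch (F₂ ha), Sh (F₂ ha)]
  have hZ : ∀ {c : B}, Commute c (F₁ ha) → Commute c (F₂ ha) → ∀ p, Commute c (Z p) := by
    intro c h1 h2 p
    fin_cases p
    exacts [commute_Ch h1, commute_Sh h1, commute_Ch h2, commute_Sh h2]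
  have c1 : ∀ p, F₁ b * Z p = Z p * F₁ b := fun p => (hZ (h2.map F₁) (hF _ _) p).eq
  have c2 : ∀ p, F₂ b * Z p = Z p * F₂ b := fun p => (hZ (hF _ _).symm (h2.map F₂) p).eq
  have c3 : ∀ p, E (F₁ hb) * Z p = Z p * E (F₁ hb) := fun p =>
    (hZ (commute_E (hh.map F₁)).symm (commute_E (hF _ _).symm).symm p).eq
  have c4 : ∀ p, E (-F₂ hb) * Z p = Z p * E (-F₂ hb) := fun p =>
    (hZ (commute_E (hF _ _).neg_right).symm (commute_E (hh.map F₂).neg_right).symm p).eq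
  have c5 : ∀ p q, Z p * Z q = Z q * Z p := fun p q => (hZ
    (hZ (Commute.refl (F₁ ha)) (hF _ _) p).symm (hZ (hF _ _).symm (Commute.refl (F₂ ha)) p).symm
    q).eq
  have f1 : Ch (F₁ ha) = Z 0 := rfl
  have f2 : Sh (F₁ ha) = Z 1 := rfl
  have f3 : Ch (F₂ ha) = Z 2 := rfl
  have f4 : Sh (F₂ ha) = Z 3 := rfl
  clear_value Z
  simp only [f1, f2, f3, f4, mul_add, add_mul, mul_sub, sub_mul, smul_mul_assoc, mul_smul_comm,
    mul_assoc, smul_add, smul_sub, mul_neg, neg_mul, c1, c2, c3, c4, c5,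
    fun p => mul_mul_of_mul_eq (c1 p), fun p => mul_mul_of_mul_eq (c2 p),
    fun p => mul_mul_of_mul_eq (c3 p), fun p => mul_mul_of_mul_eq (c4 p),
    fun p q => mul_left_comm_of_comm (c5 p q)]
  module

/-- The case where each element moves the twist of the other. The functions of the two twists are
kept apart by tensor factor (Z and W), since a and b do not commute with those in their own factor.
-/
lemma twist_mul_twist_x0X1 [ZTorsionFree B] (hF : ∀ a b, Commute (F₁ a) (F₂ b))
    {a b ha hb : A} (hab : a * b = b * a + (-(Ch hb * a) - Ch ha * b))
    (h1 : a * hb = hb * a + Sh ha) (h2 : b * ha = ha * b + -Sh hb) (hh : Commute ha hb) :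
    twist F₁ F₂ a ha * twist F₁ F₂ b hb = twist F₁ F₂ b hb * twist F₁ F₂ a ha +
      (-(Ch (F₁ hb + F₂ hb) * twist F₁ F₂ a ha) - Ch (F₁ ha + F₂ ha) * twist F₁ F₂ b hb) := by
  rw [twist_mul_twist_of_comm hF hab h1 h2 (commute_Sh hh.symm).symm
    (commute_Sh hh).symm.neg_left hh, Ch_add (hF _ _), Ch_add (hF _ _)]
  congr 1
  simp only [map_neg, map_sub, map_mul, map_Ch, map_Sh, twist, E_eq (F₁ _), E_neg (F₂ _)]
  let Z : Fin 4 → B := ![Ch (F₁ ha), Sh (F₁ ha), Ch (F₁ hb), Sh (F₁ hb)]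
  let W : Fin 4 → B := ![Ch (F₂ ha), Sh (F₂ ha), Ch (F₂ hb), Sh (F₂ hb)]
  have hZ : ∀ {c : B}, Commute c (F₁ ha) → Commute c (F₁ hb) → ∀ p, Commute c (Z p) := by
    intro c h1 h2 p
    fin_cases p
    exacts [commute_Ch h1, commute_Sh h1, commute_Ch h2, commute_Sh h2]
  have hW : ∀ {c : B}, Commute c (F₂ ha) → Commute c (F₂ hb) → ∀ p, Commute c (W p) := by
    intro c h1 h2 p
    fin_cases p
    exacts [commute_Ch h1, commute_Sh h1, commute_Ch h2, commute_Sh h2]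
  have c1 : ∀ c p, F₁ c * W p = W p * F₁ c := fun c p => (hW (hF _ _) (hF _ _) p).eq
  have c2 : ∀ c p, F₂ c * Z p = Z p * F₂ c := fun c p => (hZ (hF _ _).symm (hF _ _).symm p).eq
  have hm : ∀ c d, F₂ c * F₁ d = F₁ d * F₂ c := fun c d => (hF d c).symm
  have c3 : ∀ p q, W p * Z q = Z q * W p := fun p q =>
    (hZ (c1 ha p).symm (c1 hb p).symm q)
  have c4 : ∀ p q, Z p * Z q = Z q * Z p := fun p q => (hZ
    (hZ (Commute.refl (F₁ ha)) (hh.map F₁) p).symm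
      (hZ (hh.symm.map F₁) (Commute.refl _) p).symm q).eq
  have c5 : ∀ p q, W p * W q = W q * W p := fun p q => (hW
    (hW (Commute.refl (F₂ ha)) (hh.map F₂) p).symm
      (hW (hh.symm.map F₂) (Commute.refl _) p).symm q).eq
  have f1 : Ch (F₁ ha) = Z 0 := rfl
  have f2 : Sh (F₁ ha) = Z 1 := rfl
  have f3 : Ch (F₁ hb) = Z 2 := rfl
  have f4 : Sh (F₁ hb) = Z 3 := rfl
  have g1 : Ch (F₂ ha) = W 0 := rfl
  have g2 : Sh (F₂ ha) = W 1 := rfl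
  have g3 : Ch (F₂ hb) = W 2 := rfl
  have g4 : Sh (F₂ hb) = W 3 := rfl
  clear_value Z W
  simp only [f1, f2, f3, f4, g1, g2, g3, g4, mul_add, add_mul, mul_sub, sub_mul, smul_mul_assoc,
    mul_smul_comm, mul_assoc, smul_add, smul_sub, mul_neg, neg_mul, neg_add, neg_sub, c1, c2, c3,
    c4, c5, hm,
    fun c p => mul_mul_of_mul_eq (c1 c p), fun c p => mul_mul_of_mul_eq (c2 c p),
    fun p q => mul_mul_of_mul_eq (c3 p q), fun c d => mul_mul_of_mul_eq (hm c d),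
    fun p q => mul_left_comm_of_comm (c4 p q), fun p q => mul_left_comm_of_comm (c5 p q)]
  module

/-- The twists of the generators in the coproduct. -/
def twistB {B : Type} [Ring B] [Algebra K B] (κ : K) (G : Gen → B) : Gen → B := Sum.elim
  ![G (.inl 1), 0, -(κ • G (.inl 1))] ![0, G (.inr 0), κ • G (.inr 0)]

/-- Relations with cosh on the right are cases of `twist_mul_twist_Ch` with ±κ, except [x^0, X_1],
which has its own lemma. In all others each element commutes with the twist of its partner, and
`twist_mul_twist` applies with μ = 0. -/
lemma RelB.comul [ZTorsionFree B] (hF : ∀ a b, Commute (F₁ a) (F₂ b)) {κ : K} {G : Gen → A}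
    (hG : RelB κ G) : RelB κ fun g => twist F₁ F₂ (G g) (twistB κ G g) := by
  have h0 := twist_zero (F₁ := F₁) (F₂ := F₂)
  obtain ⟨h1, h2, h3, h4, h5, h6, h7, h8, h9, h10, h11, h12, h13, h14, h15⟩ := hG
  have h4' : G (.inr 1) * G (.inr 0) = G (.inr 0) * G (.inr 1) + -Sh (G (.inr 0)) := by
    rw [h4]; abel
  have h11' : G (.inr 1) * G (.inl 1) = G (.inl 1) * G (.inr 1) + -Sh (G (.inr 0)) := by
    rw [h11]; abel
  have h12' : G (.inr 1) * G (.inl 2) = G (.inl 2) * G (.inr 1) +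
    -κ • (G (.inl 2) * Ch (G (.inr 0))) := by rw [h12]; module
  have c3 : Commute (G (.inl 1)) (G (.inl 2)) := h3
  have c5 : Commute (G (.inr 0)) (G (.inr 2)) := h5
  have c8 : Commute (G (.inl 1)) (G (.inr 0)) := h8
  have c9 : Commute (G (.inl 2)) (G (.inr 0)) := h9
  have c14 : Commute (G (.inl 1)) (G (.inr 2)) := h14
  constructor
  all_goals dsimp only [twistB, Sum.elim_inl, Sum.elim_inr, Matrix.cons_val]
  · refine (twist_mul_twist hF h1 (μ := 0) ?_ ?_ ?_).trans ?_ <;> simp [h0, twist_Sh hF, add_comm]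
  · refine (twist_mul_twist_Ch hF h2 ?_ c3.symm ?_).trans ?_
    · simp [h1]; module
    · exact ((Commute.refl _).smul_right κ).neg_right
    · simp only [h0, add_comm]
  · refine (twist_mul_twist hF (h3.trans (add_zero _).symm) (μ := 0) ?_ ?_ ?_).trans ?_ <;>
      simp [twist_zero_left]
  · refine (twist_mul_twist hF h4 (μ := 0) ?_ ?_ ?_).trans ?_ <;> simp [h0, twist_Sh hF, add_comm]
  · refine (twist_mul_twist hF (h5.trans (add_zero _).symm) (μ := 0) ?_ ?_ ?_).trans ?_ <;>
      simp [twist_zero_left]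
  · refine (twist_mul_twist_Ch hF h6 ?_ c5.symm ?_).trans ?_
    · simp [h4']
    · exact (Commute.refl _).smul_right κ
    · simp only [h0, add_comm]
  · refine (twist_mul_twist hF h7 (μ := 0) ?_ ?_ ?_).trans ?_ <;>
      simp [h0, twist_Sh hF, add_comm, h8]
  · refine (twist_mul_twist hF (h8.trans (add_zero _).symm) (μ := 0) ?_ ?_ ?_).trans ?_ <;>
      simp [twist_zero_left]
  · refine (twist_mul_twist hF (h9.trans (add_zero _).symm) (μ := 0) ?_ ?_ ?_).trans ?_ <;>
      simp [twist_zero_left, h8]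
  · refine (twist_mul_twist_x0X1 hF h10 h7 h11' c8).trans ?_
    simp only [h0, add_comm]
  · refine (twist_mul_twist hF h11 (μ := 0) ?_ ?_ ?_).trans ?_ <;>
      simp [h0, twist_Sh hF, add_comm, h8]
  · have h := twist_mul_twist_Ch hF h12' (hb := -(κ • G (.inl 1))) (by
      simp [h11', add_comm]) c9 (c8.symm.smul_right κ).neg_right
    rw [h, h0]
    simp only [add_comm]
    module
  · have h := twist_mul_twist_Ch hF (κ := -κ) (ha := G (.inl 1)) (hb := κ • G (.inr 0))
      (h13.trans (by module)) (by simp [h7]) c14.symm (c8.smul_right κ)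
    rw [h, h0]
    simp only [add_comm]
    module
  · refine (twist_mul_twist hF (h14.trans (add_zero _).symm) (μ := 0) ?_ ?_ ?_).trans ?_ <;>
      simp [twist_zero_left, h8]
  · refine (twist_mul_twist hF h15 (μ := 0) ?_ ?_ ?_).trans ?_
    · simp [h9]
    · simp [h14]
    · exact ((c8.smul_left κ).smul_right κ).neg_left
    · rw [show -(κ • G (.inl 1)) + κ • G (.inr 0) = κ • (-G (.inl 1) + G (.inr 0)) by module,
        twist_Sh hF, h0, h0]
      congr 2
      simp only [map_add, map_smul, map_neg]
      module

end ComulB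

/-! ### Antipode for the first `(𝔯₃(ρ), 𝔯₃(-ρ))` -/

section AntipodeB

variable {B : Type} [Ring B] [Algebra K B] [ZComplete B]

lemma mul_Ch_of_comm {a b c : B} (h : a * b = b * a + c) (hc : Commute c b) :
    a * Ch b = Ch b * a + (z * z) • (c * Sh b) := by
  rw [Ch, mul_fc_of_comm h hc, derivative_coshSeries, fc_X_mul, mul_smul_comm, smul_smul, Sh]

lemma mul_Sh_of_comm [ZTorsionFree B] {a b c : B} (h : a * b = b * a + c) (hc : Commute c b) :
    a * Sh b = Sh b * a + c * Ch b := by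
  refine z_smul_cancel ?_
  have hS : z • Sh b = fc b (PowerSeries.X * sinhcSeries) := (fc_X_mul b _).symm
  rw [smul_add, ← mul_smul_comm, ← smul_mul_assoc z (Sh b), hS, mul_fc_of_comm h hc,
    derivative_X_mul_sinhcSeries, Ch]

/-- Conjugating x^0 by e^{z x^1} shifts it by sinh(z x^1), because [x^0, x^1] = sinh(z x^1)/z
commutes with x^1; similarly X_1 is shifted by -sinh(z X_0). These are the values of -S, the
remaining generators being unchanged. -/
lemma RelB.op [ZTorsionFree B] {κ : K} {G : Gen → B} (h : RelB κ G) :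
    RelB κ fun g => MulOpposite.op (-(G g + z • (Sum.elim ![Sh (G (.inl 1)), 0, 0]
      ![0, -Sh (G (.inr 0)), 0] g : B))) := by
  obtain ⟨h1, h2, h3, h4, h5, h6, h7, h8, h9, h10, h11, h12, h13, h14, h15⟩ := h
  have c1 : Commute (G (.inl 1)) (G (.inl 2)) := h3
  have c2 : Commute (G (.inl 1)) (G (.inr 0)) := h8
  have c3 : Commute (G (.inl 1)) (G (.inr 2)) := h14
  have c4 : Commute (G (.inr 0)) (G (.inr 2)) := h5
  have c5 : Commute (G (.inl 2)) (G (.inr 0)) := h9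
  have e1 : Sh (κ • (G (.inl 1) + -G (.inr 0))) = -Sh (κ • (-G (.inl 1) + G (.inr 0))) := by
    rw [← Sh_neg]; congr 1; module
  have h4' : G (.inr 1) * G (.inr 0) = G (.inr 0) * G (.inr 1) + -Sh (G (.inr 0)) := by
    rw [h4]; abel
  have h11' : G (.inr 1) * G (.inl 1) = G (.inl 1) * G (.inr 1) + -Sh (G (.inr 0)) := by
    rw [h11]; abel
  have su : Commute (Sh (G (.inl 1))) (G (.inl 1)) := (commute_Sh (Commute.refl _)).symm
  have suv : Commute (Sh (G (.inl 1))) (G (.inr 0)) := (commute_Sh c2.symm).symm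
  have sv : Commute (-Sh (G (.inr 0))) (G (.inr 0)) := (commute_Sh (Commute.refl _)).symm.neg_left
  have svu : Commute (-Sh (G (.inr 0))) (G (.inl 1)) := (commute_Sh c2).symm.neg_left
  have d1 := mul_Ch_of_comm h1 su
  have d2 := mul_Sh_of_comm h1 su
  have d3 := mul_Ch_of_comm h7 suv
  have d4 := mul_Sh_of_comm h7 suv
  have d5 := mul_Ch_of_comm h11' svu
  have d6 := mul_Sh_of_comm h11' svu
  have d7 := mul_Ch_of_comm h4' sv
  have d8 := mul_Sh_of_comm h4' sv
  let Z : Fin 6 → B := ![G (.inl 1), G (.inr 0), Ch (G (.inl 1)), Sh (G (.inl 1)),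
    Ch (G (.inr 0)), Sh (G (.inr 0))]
  have hZ : ∀ {c : B}, Commute c (G (.inl 1)) → Commute c (G (.inr 0)) →
      ∀ p, Commute c (Z p) := by
    intro c h1 h2 p
    fin_cases p
    exacts [h1, h2, commute_Ch h1, commute_Sh h1, commute_Ch h2, commute_Sh h2]
  have hZZ : ∀ p q, Z p * Z q = Z q * Z p := fun p q => (hZ
    (hZ (Commute.refl _) c2 p).symm (hZ c2.symm (Commute.refl _) p).symm q).eq
  have hx2 : ∀ p, G (.inl 2) * Z p = Z p * G (.inl 2) := fun p => (hZ c1.symm c5 p).eq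
  have hX2 : ∀ p, G (.inr 2) * Z p = Z p * G (.inr 2) := fun p => (hZ c3.symm c4.symm p).eq
  have f1 : Ch (G (.inl 1)) = Z 2 := rfl
  have f2 : Sh (G (.inl 1)) = Z 3 := rfl
  have f3 : Ch (G (.inr 0)) = Z 4 := rfl
  have f4 : Sh (G (.inr 0)) = Z 5 := rfl
  have f5 : G (.inl 1) = Z 0 := rfl
  have f6 : G (.inr 0) = Z 1 := rfl
  constructor
  all_goals dsimp only [Sum.elim_inl, Sum.elim_inr, Matrix.cons_val]
  all_goals simp only [← MulOpposite.op_smul, ← MulOpposite.op_neg, ← MulOpposite.op_add,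
    ← MulOpposite.op_sub, Sh_op, Ch_op, ← MulOpposite.op_mul, MulOpposite.op_inj, smul_zero,
    add_zero, Sh_neg, Ch_neg, neg_mul_neg, neg_neg, e1, neg_add, mul_neg, neg_mul]
  all_goals clear_value Z
  all_goals simp only [f1, f2, f3, f4] at *
  all_goals simp only [f5, f6] at *
  all_goals simp only [mul_add, add_mul, mul_sub, sub_mul, smul_mul_assoc, mul_smul_comm,
    mul_assoc, smul_add, smul_sub, mul_neg, neg_mul, neg_add, neg_sub, smul_neg, neg_neg,
    h1, h7, d1, d2, d3, d4, h11', h4', d5, d6, d7, d8, h2, h6, h10, h12, h13, h15, hx2, hX2, hZZ,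
    fun p q => mul_left_comm_of_comm (hZZ p q), fun p => mul_mul_of_mul_eq (hx2 p),
    fun p => mul_mul_of_mul_eq (hX2 p)]
  all_goals try module

end AntipodeB

/-! ### Auxiliary power series -/

section Series

open PowerSeries

/-- A linear first order differential equation has a solution with constant coefficient one. -/
lemma exists_derivative_eq_mul (g : ℝ⟦X⟧) :
    ∃ h : ℝ⟦X⟧, constantCoeff h = 1 ∧ derivative ℝ h = g * h := by
  obtain ⟨c, hc0, hc⟩ : ∃ c : ℕ → ℝ, c 0 = 1 ∧ ∀ n, c (n + 1) =
      (∑ i ∈ Finset.range (n + 1), c i * coeff (n - i) g) / (n + 1) := by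
    -- Course-of-values recursion: `L n` lists the coefficients 0, …, n, and F computes the next
    -- one. Indices stay below the length, so the default value 0 is never used.
    let F : List ℝ → ℝ := fun l => (∑ i ∈ Finset.range l.length,
      l.getD i 0 * coeff (l.length - 1 - i) g) / l.length
    let L : ℕ → List ℝ := fun n => Nat.rec [1] (fun _ l => l ++ [F l]) n
    have hL : ∀ n, L (n + 1) = L n ++ [F (L n)] := fun _ => rfl
    have hlen : ∀ n, (L n).length = n + 1 := by
      intro n
      induction n with
      | zero => rfl
      | succ n ih => rw [hL, List.length_append, ih]; rfl
    have hget : ∀ m n i, i ≤ n → n ≤ m → (L m).getD i 0 = (L n).getD i 0 := by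
      intro m n i hi hm
      induction m, hm using Nat.le_induction with
      | base => rfl
      | succ m hm ih => rw [hL, List.getD_append _ _ _ _ (by rw [hlen]; omega), ih]
    refine ⟨fun n => (L n).getD n 0, rfl, fun n => ?_⟩
    dsimp only
    rw [hL, List.getD_append_right _ _ _ _ (by rw [hlen]), hlen, Nat.sub_self]
    simp only [F, hlen, List.getD_cons_zero, Nat.add_sub_cancel]
    push_cast
    congr 1
    refine Finset.sum_congr rfl fun i hi => ?_
    rw [hget n i i le_rfl (Finset.mem_range_succ_iff.1 hi)]
  refine ⟨mk c, by rw [← coeff_zero_eq_constantCoeff_apply, coeff_mk, hc0], ?_⟩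
  ext n
  have hn : (n : ℝ) + 1 ≠ 0 := by positivity
  rw [coeff_derivative, coeff_mk, hc, div_mul_cancel₀ _ hn, mul_comm g, coeff_mul,
    Finset.Nat.sum_antidiagonal_eq_sum_range_succ (fun i j => coeff i (mk c) * coeff j g)]
  simp only [coeff_mk]

lemma sinhcSeries_mul_inv : sinhcSeries * sinhcSeries⁻¹ = 1 :=
  PowerSeries.mul_inv_cancel _ (by simp [constantCoeff_sinhcSeries])

lemma sinhcSeries_add_X_mul_derivative :
    sinhcSeries + PowerSeries.X * derivative ℝ sinhcSeries = coshSeries := by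
  rw [← derivative_X_mul_sinhcSeries]
  simp
  ring

lemma coshSeries_sq :
    coshSeries * coshSeries - (PowerSeries.X * sinhcSeries) * (PowerSeries.X * sinhcSeries) = 1 := by
  have h := exp_mul_exp_neg_eq_one (A := ℝ)
  have h2 : evalNegHom (exp ℝ) = coshSeries - PowerSeries.X * sinhcSeries := by
    rw [exp_eq_cosh_add_sinh, evalNegHom, map_add, map_mul, rescale_neg_one_coshSeries,
      rescale_neg_one_sinhcSeries, rescale_X]
    simp [sub_eq_add_neg]
  rw [h2, exp_eq_cosh_add_sinh] at h
  rw [← h]; ring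

lemma derivative_sinhcSeries_inv : derivative ℝ sinhcSeries⁻¹ =
    -(sinhcSeries⁻¹ * sinhcSeries⁻¹ * derivative ℝ sinhcSeries) := by
  rw [derivative_inv']
  ring

/-- The series `θ` with `X θ = cosh X - X / sinh X`. -/
def thetaSeries : ℝ⟦X⟧ := mk fun n => coeff (n + 1) (coshSeries - sinhcSeries⁻¹)

lemma X_mul_thetaSeries : PowerSeries.X * thetaSeries = coshSeries - sinhcSeries⁻¹ := by
  ext n
  cases n with
  | zero =>
    rw [coeff_zero_X_mul, coeff_zero_eq_constantCoeff_apply, map_sub, constantCoeff_coshSeries,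
      constantCoeff_inv, constantCoeff_sinhcSeries, inv_one, sub_self]
  | succ n => rw [coeff_succ_X_mul, thetaSeries, coeff_mk]

/-- After multiplication by X this is cosh² - sinh² = 1 combined with (X σ)' = cosh for σ = sinh X /
X. It produces the cancellation in `BorelRel.borelW_mul`. -/
lemma thetaSeries_mul_coshSeries : thetaSeries * coshSeries +
    sinhcSeries⁻¹ * derivative ℝ sinhcSeries = PowerSeries.X * sinhcSeries * sinhcSeries := by
  refine mul_left_cancel₀ X_ne_zero ?_
  have h1 := X_mul_thetaSeries
  have h2 := sinhcSeries_mul_inv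
  have h3 := sinhcSeries_add_X_mul_derivative
  have h4 := coshSeries_sq
  linear_combination coshSeries * h1 + h4 + sinhcSeries⁻¹ * h3 - h2

lemma derivative_thetaSeries : PowerSeries.X * derivative ℝ thetaSeries =
    PowerSeries.X * sinhcSeries + sinhcSeries⁻¹ * sinhcSeries⁻¹ * derivative ℝ sinhcSeries -
      thetaSeries := by
  have h := congrArg (derivative ℝ) X_mul_thetaSeries
  rw [map_sub, derivative_coshSeries, derivative_sinhcSeries_inv] at h
  simp at h
  linear_combination h

end Series

/-! ### Deformed images of x^0 and X_1 for the first `(𝔯₃(ρ), 𝔯₃(-ρ))` -/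

section DeformB

variable {B : Type} [Ring B] [Algebra K B] [ZComplete B]

lemma fc_mul_fc (u : B) (f g : ℝ⟦X⟧) : fc u f * fc u g = fc u (f * g) := (map_mul _ _ _).symm

/-- The relations between the elements `u = x¹`, `y = x⁰`, `w = x⁰ + X₁` and `c = x¹ - X₀` of the
double. -/
structure BorelRel (u y w c : B) : Prop where
  y_u : y * u = u * y + u
  w_u : w * u = u * w + c
  y_w : y * w = w * y - w
  c_u : Commute c u
  c_y : Commute c y
  c_w : Commute c w

/-- The image of `x⁰`. -/
def borelY (u y : B) : B := fc u sinhcSeries * y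

/-- The image of `X₁`. -/
def borelW (u y w c : B) : B := fc c sinhcSeries * (fc u sinhcSeries⁻¹ * w) -
  (Ch c * (fc u sinhcSeries * y) - z • (Sh c * (fc u thetaSeries * y)))

variable {u y w c : B}

lemma Ch_sub_of_commute (h : Commute u c) : Ch (u - c) = fc u coshSeries * Ch c -
    z • (fc u (PowerSeries.X * sinhcSeries) * Sh c) := by
  rw [sub_eq_add_neg, Ch_add h.neg_right, Ch_neg, Sh_neg, fc_X_mul, Sh, Ch, smul_mul_assoc,
    smul_smul, mul_neg, smul_neg, sub_eq_add_neg]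

lemma Sh_sub_of_commute [ZTorsionFree B] (h : Commute u c) : Sh (u - c) =
    u * fc u sinhcSeries * Ch c - fc u coshSeries * Sh c := by
  rw [sub_eq_add_neg, Sh_add h.neg_right, Ch_neg, Sh_neg, mul_neg, sub_eq_add_neg]; rfl

namespace BorelRel

lemma y_fc (h : BorelRel u y w c) (f : ℝ⟦X⟧) : y * fc u f = fc u f * y +
    fc u (PowerSeries.X * PowerSeries.derivative ℝ f) := by
  rw [mul_fc_of_comm h.y_u (Commute.refl u), fc_X_mul]

lemma w_fc (h : BorelRel u y w c) (f : ℝ⟦X⟧) : w * fc u f = fc u f * w +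
    z • (c * fc u (PowerSeries.derivative ℝ f)) := mul_fc_of_comm h.w_u h.c_u f

lemma borelY_mul_fc_w (h : BorelRel u y w c) : borelY u y * (fc u sinhcSeries⁻¹ * w) =
    fc u sinhcSeries⁻¹ * w * borelY u y - fc u coshSeries * (fc u sinhcSeries⁻¹ * w) -
      z • (c * (fc u (sinhcSeries⁻¹ * PowerSeries.derivative ℝ sinhcSeries) * y)) := by
  have i1 : sinhcSeries * (PowerSeries.X * PowerSeries.derivative ℝ sinhcSeries⁻¹) =
      1 - coshSeries * sinhcSeries⁻¹ := by
    rw [derivative_sinhcSeries_inv]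
    linear_combination (-sinhcSeries⁻¹) * sinhcSeries_add_X_mul_derivative -
      (PowerSeries.X * sinhcSeries⁻¹ * PowerSeries.derivative ℝ sinhcSeries - 1) *
        sinhcSeries_mul_inv
  have i2 := sinhcSeries_mul_inv
  have i3 : sinhcSeries⁻¹ * sinhcSeries = 1 := by rw [mul_comm, i2]
  simp only [borelY, mul_add, add_mul, mul_sub, sub_mul, mul_assoc, mul_smul_comm, smul_mul_assoc,
    fc_mul_fc, mul_mul_of_mul_eq (fc_mul_fc u _ _), h.y_fc, mul_mul_of_mul_eq (h.y_fc _), h.w_fc,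
    mul_mul_of_mul_eq (h.w_fc _), (commute_fc h.c_u _).symm.eq,
    mul_mul_of_mul_eq (commute_fc h.c_u _).symm.eq, h.y_w, i1, i2, i3, map_sub, map_one, one_mul]
  module

lemma borelY_mul_fc_y (h : BorelRel u y w c) (f : ℝ⟦X⟧) : borelY u y * (fc u f * y) =
    fc u f * y * borelY u y + fc u (sinhcSeries * (PowerSeries.X * PowerSeries.derivative ℝ f) -
      f * (PowerSeries.X * PowerSeries.derivative ℝ sinhcSeries)) * y := by
  simp only [borelY, mul_add, add_mul, mul_sub, sub_mul, mul_assoc, fc_mul_fc,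
    mul_mul_of_mul_eq (fc_mul_fc u _ _), h.y_fc, mul_mul_of_mul_eq (h.y_fc _), map_sub,
    mul_comm f sinhcSeries]
  abel

lemma c_borelY (h : BorelRel u y w c) : Commute c (borelY u y) :=
  (commute_fc h.c_u _).mul_right h.c_y

lemma c_borelW (h : BorelRel u y w c) : Commute c (borelW u y w c) :=
  ((commute_fc (Commute.refl c) _).mul_right ((commute_fc h.c_u _).mul_right h.c_w)).sub_right
    (((commute_Ch (Commute.refl c)).mul_right ((commute_fc h.c_u _).mul_right h.c_y)).sub_right
      (((commute_Sh (Commute.refl c)).mul_right ((commute_fc h.c_u _).mul_right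
        h.c_y)).smul_right _))

/-- Functions of c commute with Y = `borelY u y`, so only the three elements of U(D)⟦z⟧ multiplying
them in `borelW` matter. The bracket of Y with σ⁻¹w leaves a term in σ'/σ; the bracket with θy,
through `derivative_thetaSeries`, contains its opposite. The surviving X σ² term is the sinh · sinh
part of cosh z(u - c). -/
lemma borelY_mul_borelW (h : BorelRel u y w c) : borelY u y * borelW u y w c =
    borelW u y w c * borelY u y + (-(Ch (u - c) * borelY u y) - Ch u * borelW u y w c) := by
  have i1 : sinhcSeries * (PowerSeries.X * PowerSeries.derivative ℝ thetaSeries) -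
      thetaSeries * (PowerSeries.X * PowerSeries.derivative ℝ sinhcSeries) =
      PowerSeries.X * sinhcSeries * sinhcSeries +
        sinhcSeries⁻¹ * PowerSeries.derivative ℝ sinhcSeries - coshSeries * thetaSeries := by
    rw [derivative_thetaSeries]
    linear_combination (sinhcSeries⁻¹ * PowerSeries.derivative ℝ sinhcSeries) *
      sinhcSeries_mul_inv - thetaSeries * sinhcSeries_add_X_mul_derivative
  have e1 := h.borelY_mul_fc_w
  have e2 := h.borelY_mul_fc_y sinhcSeries
  have e3 := h.borelY_mul_fc_y thetaSeries
  rw [sub_self, map_zero, zero_mul, add_zero] at e2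
  rw [i1] at e3
  have hc : ∀ f, borelY u y * fc c f = fc c f * borelY u y := fun f =>
    (commute_fc h.c_borelY.symm f).eq
  have hC : borelY u y * Ch c = Ch c * borelY u y := hc _
  have hS : borelY u y * Sh c = Sh c * borelY u y := (commute_Sh h.c_borelY.symm).eq
  have hcc : ∀ f b, fc u f * (fc c sinhcSeries * b) = fc c sinhcSeries * (fc u f * b) := fun f b =>
    mul_left_comm_of_comm (commute_fc_fc h.c_u.symm _ _).eq b
  have hcC : ∀ f b, fc u f * (Ch c * b) = Ch c * (fc u f * b) := fun f b =>
    mul_left_comm_of_comm (commute_fc_fc h.c_u.symm _ _).eq b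
  have hcS : ∀ f b, fc u f * (Sh c * b) = Sh c * (fc u f * b) := fun f b =>
    mul_left_comm_of_comm (commute_Sh (commute_fc h.c_u f).symm).eq b
  have hSc : ∀ b, Sh c * b = fc c sinhcSeries * (c * b) := fun b => by
    rw [Sh, (commute_fc (Commute.refl c) _).eq, mul_assoc]
  have hY : borelY u y * borelW u y w c =
      fc c sinhcSeries * (borelY u y * (fc u sinhcSeries⁻¹ * w)) -
      (Ch c * (borelY u y * (fc u sinhcSeries * y)) -
        z • (Sh c * (borelY u y * (fc u thetaSeries * y)))) := by
    simp only [borelW, mul_sub, mul_smul_comm, ← mul_assoc, hc, hC, hS]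
  have hcN : ∀ f b, fc u f * (c * b) = c * (fc u f * b) := fun f b =>
    mul_left_comm_of_comm (commute_fc h.c_u f).symm.eq b
  rw [hY, e1, e2, e3, Ch_sub_of_commute h.c_u.symm,
    show Ch u = fc u coshSeries from rfl]
  simp only [borelW, borelY, map_add, map_sub, mul_add, add_mul, mul_sub, sub_mul, mul_smul_comm,
    smul_mul_assoc, mul_assoc, hcc, hcC, hcS, fc_mul_fc, mul_mul_of_mul_eq (fc_mul_fc u _ _), hSc,
    hcN]
  simp only [← mul_assoc, mul_comm thetaSeries]
  module

lemma borelY_mul_u (h : BorelRel u y w c) : borelY u y * u = u * borelY u y + Sh u := by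
  rw [borelY, mul_assoc, h.y_u, mul_add, ← mul_assoc, ← (commute_fc (Commute.refl u) _).eq, Sh,
    mul_assoc]

/-- This relation dictates θ: the part with w contributes -(sinh(zc)/z)/σ(zu), and X θ = cosh - 1/σ
is what converts it into the term -cosh(zu) sinh(zc)/z of the addition theorem. -/
lemma borelW_mul_u [ZTorsionFree B] (h : BorelRel u y w c) :
    u * borelW u y w c = borelW u y w c * u + Sh (u - c) := by
  have hy : y * u = u * y + u := h.y_u
  have hN : ∀ f, u * fc u f = fc u f * u := fun f => (commute_fc (Commute.refl u) f).eq
  have hc : ∀ f b, u * (fc c f * b) = fc c f * (u * b) := fun f b =>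
    mul_left_comm_of_comm (commute_fc h.c_u.symm f).eq b
  have hS : ∀ b, u * (Sh c * b) = Sh c * (u * b) := fun b =>
    mul_left_comm_of_comm (commute_Sh h.c_u.symm).eq b
  have hC : ∀ b, u * (Ch c * b) = Ch c * (u * b) := hc _
  have hθ : z • (Sh c * (fc u thetaSeries * u)) =
      Sh c * fc u coshSeries - Sh c * fc u sinhcSeries⁻¹ := by
    rw [← mul_smul_comm, ← hN, ← fc_X_mul, X_mul_thetaSeries, map_sub, mul_sub]
  have hcu : fc c sinhcSeries * (fc u sinhcSeries⁻¹ * c) = Sh c * fc u sinhcSeries⁻¹ := by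
    rw [← (commute_fc h.c_u _).eq, ← mul_assoc, ← (commute_fc (Commute.refl c) _).eq, Sh]
  have hCu : u * fc u sinhcSeries * Ch c = Ch c * (fc u sinhcSeries * u) := by
    rw [hN, Ch, ((commute_fc_fc h.c_u _ _).mul_right (commute_fc h.c_u.symm _).symm).eq.symm]
  have hs : fc u coshSeries * Sh c = Sh c * fc u coshSeries :=
    (commute_Sh (commute_fc h.c_u _).symm).eq
  rw [Sh_sub_of_commute h.c_u.symm, borelW]
  simp only [mul_sub, sub_mul, mul_smul_comm, smul_mul_assoc, mul_assoc, hc, hS, hC, h.w_u, hy,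
    mul_mul_of_mul_eq (hN _), mul_add, smul_add, hθ, hcu, hCu, hs]
  abel

/-- A power series with `a h' = ρ a' h`, where `a = sinh X / X`. -/
def _root_.QuantumDouble.IsSinhcPow (ρ : ℝ) (s : ℝ⟦X⟧) : Prop := PowerSeries.derivative ℝ s =
  PowerSeries.C ρ * (PowerSeries.derivative ℝ sinhcSeries * sinhcSeries⁻¹) * s

/-- The equation for s says X s' = ρ (cosh/σ - 1) s. Multiplying t by s(zu) therefore changes its
weight under y from ρ to ρ cosh(zu)/σ(zu), and multiplying y by σ removes the denominator. -/
lemma fc_y_mul (h : BorelRel u y w c) {ρ : ℝ} {s : ℝ⟦X⟧} (hs : IsSinhcPow ρ s) {t : B}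
    (hy : y * t = t * y + (PowerSeries.C ρ : K) • t) (hu : Commute u t) (f : ℝ⟦X⟧) :
    fc u f * y * (fc u s * t) = fc u s * t * (fc u f * y) +
      (PowerSeries.C ρ : K) • (fc u (f * sinhcSeries⁻¹ * s * coshSeries) * t) := by
  have i1 : f * (PowerSeries.X * PowerSeries.derivative ℝ s) =
      PowerSeries.C ρ * (f * sinhcSeries⁻¹ * s * coshSeries - f * s) := by
    rw [hs]
    linear_combination (PowerSeries.C ρ * f * sinhcSeries⁻¹ * s) *
      sinhcSeries_add_X_mul_derivative - PowerSeries.C ρ * f * s * sinhcSeries_mul_inv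
  have hu' : ∀ f, t * fc u f = fc u f * t := fun f => (commute_fc hu.symm f).eq
  simp only [mul_add, add_mul, mul_assoc, fc_mul_fc, mul_mul_of_mul_eq (fc_mul_fc u _ _), h.y_fc,
    mul_mul_of_mul_eq (h.y_fc _), hy, hu', mul_mul_of_mul_eq (hu' _), mul_smul_comm, i1, map_sub,
    fc_C_mul, sub_mul, mul_comm s f, smul_mul_assoc]
  module

lemma borelY_mul (h : BorelRel u y w c) {ρ : ℝ} {s : ℝ⟦X⟧} (hs : IsSinhcPow ρ s) {t : B}
    (hy : y * t = t * y + (PowerSeries.C ρ : K) • t) (hu : Commute u t) :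
    borelY u y * (fc u s * t) = fc u s * t * borelY u y +
      (PowerSeries.C ρ : K) • (fc u s * t * Ch u) := by
  have hu' : Commute t (Ch u) := commute_Ch hu.symm
  rw [borelY, h.fc_y_mul hs hy hu, sinhcSeries_mul_inv, one_mul, mul_assoc _ t (Ch u), hu'.eq,
    ← mul_assoc _ (Ch u) t, Ch, fc_mul_fc]

/-- As w commutes with t, the bracket of σ⁻¹w with s t comes from s' alone. By
`thetaSeries_mul_coshSeries` it splits into the sinh · sinh part of cosh z(u - c) and a term
cancelling the one produced by θy; the cosh · cosh part comes from σy. -/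
lemma borelW_mul (h : BorelRel u y w c) {ρ : ℝ} {s : ℝ⟦X⟧} (hs : IsSinhcPow ρ s) {t : B}
    (hy : y * t = t * y + (PowerSeries.C ρ : K) • t) (hw : Commute w t) (hu : Commute u t)
    (hc : Commute c t) :
    fc u s * t * borelW u y w c = borelW u y w c * (fc u s * t) +
      (PowerSeries.C ρ : K) • (fc u s * t * Ch (u - c)) := by
  set T := fc u s * t with hT
  have hTu : ∀ f, T * fc u f = fc u f * T := fun f =>
    (commute_fc ((commute_fc (Commute.refl u) s).mul_right hu).symm f).eq
  have hTc : Commute T c := ((commute_fc h.c_u s).mul_right hc).symm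
  have hTσ : ∀ b, T * (fc c sinhcSeries * b) = fc c sinhcSeries * (T * b) := fun b =>
    mul_left_comm_of_comm (commute_fc hTc _).eq b
  have hTC : ∀ b, T * (Ch c * b) = Ch c * (T * b) := fun b =>
    mul_left_comm_of_comm (commute_Ch hTc).eq b
  have hTS : ∀ b, T * (Sh c * b) = Sh c * (T * b) := fun b =>
    mul_left_comm_of_comm (commute_Sh hTc).eq b
  have i1 : sinhcSeries⁻¹ * PowerSeries.derivative ℝ s = PowerSeries.C ρ *
      (PowerSeries.X * sinhcSeries * s - thetaSeries * sinhcSeries⁻¹ * s * coshSeries) := by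
    rw [hs]
    linear_combination PowerSeries.C ρ * s * sinhcSeries⁻¹ * thetaSeries_mul_coshSeries +
      PowerSeries.C ρ * s * PowerSeries.X * sinhcSeries * sinhcSeries_mul_inv
  have e1 : fc u sinhcSeries⁻¹ * w * T = T * (fc u sinhcSeries⁻¹ * w) +
      (PowerSeries.C ρ : K) • z • (c * (fc u (PowerSeries.X * sinhcSeries * s) * t) -
        c * (fc u (thetaSeries * sinhcSeries⁻¹ * s * coshSeries) * t)) := by
    rw [← mul_assoc T, hTu, mul_assoc, mul_assoc, hT, ← mul_assoc w, h.w_fc, add_mul, mul_add,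
      mul_assoc _ w t, hw.eq, ← mul_assoc _ t w, smul_mul_assoc, mul_smul_comm, mul_assoc c,
      mul_left_comm_of_comm (commute_fc h.c_u _).symm.eq, ← mul_assoc (fc u _) (fc u _), fc_mul_fc,
      i1, fc_C_mul, map_sub, smul_mul_assoc, mul_smul_comm, smul_comm z, sub_mul, mul_sub]
  have e2 := h.fc_y_mul hs hy hu sinhcSeries
  have e3 := h.fc_y_mul hs hy hu thetaSeries
  rw [sinhcSeries_mul_inv, one_mul] at e2
  rw [← hT] at e2 e3
  have hTCh : T * Ch (u - c) = Ch c * (fc u (s * coshSeries) * t) -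
      z • (Sh c * (fc u (PowerSeries.X * sinhcSeries * s) * t)) := by
    have hfT : ∀ f, fc u f * T = fc u (s * f) * t := fun f => by
      rw [hT, ← mul_assoc, fc_mul_fc, mul_comm f]
    rw [Ch_sub_of_commute h.c_u.symm, mul_sub, mul_smul_comm, ← mul_assoc, ← mul_assoc, hTu, hTu,
      hfT, hfT, mul_comm s (PowerSeries.X * sinhcSeries)]
    congr 1
    · exact (commute_Ch ((commute_fc h.c_u _).mul_right hc).symm).eq
    · exact congrArg _ (commute_Sh ((commute_fc h.c_u _).mul_right hc).symm).eq
  have hSc : ∀ b, Sh c * b = fc c sinhcSeries * (c * b) := fun b => by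
    rw [Sh, (commute_fc (Commute.refl c) _).eq, mul_assoc]
  rw [hTCh, borelW]
  simp only [mul_sub, sub_mul, mul_smul_comm, smul_mul_assoc, hTσ, hTC, hTS]
  simp only [mul_assoc] at e1 e2 e3 ⊢
  simp only [e1, e2, e3, mul_add, mul_sub, mul_smul_comm, hSc]
  module

end BorelRel

end DeformB

lemma IsSinhcPow.inv {ρ : ℝ} {s : ℝ⟦X⟧} (hs : IsSinhcPow ρ s) (h1 : s * s⁻¹ = 1) :
    IsSinhcPow (-ρ) s⁻¹ := by
  rw [IsSinhcPow, PowerSeries.derivative_inv', hs, map_neg]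
  linear_combination (-PowerSeries.C ρ * (PowerSeries.derivative ℝ sinhcSeries * sinhcSeries⁻¹) *
    s⁻¹) * h1

lemma exists_isSinhcPow (ρ : ℝ) :
    ∃ s : ℝ⟦X⟧, PowerSeries.constantCoeff s = 1 ∧ s * s⁻¹ = 1 ∧ IsSinhcPow ρ s := by
  obtain ⟨s, hs, h⟩ := exists_derivative_eq_mul
    (PowerSeries.C ρ * (PowerSeries.derivative ℝ sinhcSeries * sinhcSeries⁻¹))
  exact ⟨s, hs, PowerSeries.mul_inv_cancel _ (by simp [hs]), h⟩

/-! ### Deforming map for the first `(𝔯₃(ρ), 𝔯₃(-ρ))` -/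

section DeformRelB

variable {B : Type} [Ring B] [Algebra K B]

/-- The generators of the quantum double in terms of those of the enveloping algebra. -/
def deformB [ZComplete B] (κ : K) (s : ℝ⟦X⟧) (G : Gen → B) : Gen → B := Sum.elim
  ![borelY (G (.inl 1)) (G (.inl 0)), G (.inl 1), fc (G (.inl 1)) s * G (.inl 2)]
  ![G (.inr 0),
    borelW (G (.inl 1)) (G (.inl 0)) (G (.inl 0) + G (.inr 1)) (G (.inl 1) - G (.inr 0)),
    fc (κ • (-G (.inl 1) + G (.inr 0))) sinhcSeries * (fc (G (.inl 1)) s⁻¹ * G (.inr 2))]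

lemma LieRelB.borelRel {κ : K} {G : Gen → B} (h : LieRelB κ G) :
    BorelRel (G (.inl 1)) (G (.inl 0)) (G (.inl 0) + G (.inr 1)) (G (.inl 1) - G (.inr 0)) := by
  obtain ⟨h1, h2, h3, h4, h5, h6, h7, h8, h9, h10, h11, h12, h13, h14, h15⟩ := h
  constructor
  · exact h1
  · simp only [mul_add, add_mul, h1, h11]; abel
  · simp only [mul_add, add_mul, h10]; abel
  · exact (Commute.refl _).sub_left (Commute.symm h8)
  · rw [Commute, SemiconjBy]; simp only [mul_sub, sub_mul, h1, h7]; abel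
  · rw [Commute, SemiconjBy]; simp only [mul_add, add_mul, mul_sub, sub_mul, h1, h7, h4, h11]; abel

/-- Under x^0 the elements x^2 and X_2 have weights ρ and -ρ, so they receive s(z x^1) and its
inverse. These cancel in [x^2, X_2], and the central factor σ(zκ(X_0 - x^1)) on X_2 supplies the
required sinh. Relations with X_0 follow from those with x^1, the difference being central. -/
lemma LieRelB.deform [ZComplete B] [ZTorsionFree B] {ρ : ℝ} {s : ℝ⟦X⟧} (hs : IsSinhcPow ρ s)
    (hs1 : s * s⁻¹ = 1) {G : Gen → B} (h : LieRelB (PowerSeries.C ρ) G) :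
    RelB (PowerSeries.C ρ) (deformB (PowerSeries.C ρ) s G) := by
  have hb := h.borelRel
  obtain ⟨h1, h2, h3, h4, h5, h6, h7, h8, h9, h10, h11, h12, h13, h14, h15⟩ := h
  have hYu := hb.borelY_mul_u
  have hWu := hb.borelW_mul_u
  have hcY := hb.c_borelY
  have hcW := hb.c_borelW
  have hYW := hb.borelY_mul_borelW
  have c1 : Commute (G (.inl 1)) (G (.inl 2)) := h3
  have c2 : Commute (G (.inr 0)) (G (.inr 2)) := h5
  have c3 : Commute (G (.inl 1)) (G (.inr 0)) := h8
  have c4 : Commute (G (.inl 2)) (G (.inr 0)) := h9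
  have c5 : Commute (G (.inl 1)) (G (.inr 2)) := h14
  have hx2 := hb.borelY_mul hs h2 c1
  have hX2 := hb.borelY_mul (hs.inv hs1) (t := G (.inr 2)) (by rw [h13, map_neg, neg_smul]) c5
  have hx2W := hb.borelW_mul hs h2
    (by rw [Commute, SemiconjBy]; simp only [mul_add, add_mul, h2, h12]; abel) c1
    (c1.sub_left c4.symm)
  have hX2W := hb.borelW_mul (hs.inv hs1) (t := G (.inr 2)) (by rw [h13, map_neg, neg_smul])
    (by rw [Commute, SemiconjBy]; simp only [mul_add, add_mul, h13, h6]; abel) c5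
    (c5.sub_left c2)
  rw [sub_sub_cancel] at hWu hYW hx2W hX2W
  have hM : ∀ {a : B}, Commute (G (.inl 1) - G (.inr 0)) a → Commute a
      (fc ((PowerSeries.C ρ : K) • (-G (.inl 1) + G (.inr 0))) sinhcSeries) := fun ha => by
    refine commute_fc (Commute.smul_right ?_ _) _
    rw [show -G (.inl 1) + G (.inr 0) = -(G (.inl 1) - G (.inr 0)) by abel]
    exact ha.symm.neg_right
  -- An element commuting with x^1 - X_0 has the same commutator with X_0 as with x^1.
  have hv : ∀ {a r : B}, Commute (G (.inl 1) - G (.inr 0)) a → G (.inl 1) * a = a * G (.inl 1) + r →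
      G (.inr 0) * a = a * G (.inr 0) + r := fun ha hu => by
    have := ha.eq
    rw [sub_mul, mul_sub, hu, sub_eq_sub_iff_add_eq_add, add_assoc, add_left_cancel_iff] at this
    rw [← this, add_comm]
  have hMT : ∀ {m t q a : B} {μ : K}, Commute a m →
      a * t = t * a + μ • (t * q) → a * (m * t) = m * t * a + μ • (m * t * q) := fun ha ht => by
    rw [mul_left_comm_of_comm ha.eq, ht, mul_add, mul_smul_comm, mul_assoc, mul_assoc]
  constructor
  all_goals dsimp only [deformB, Sum.elim_inl, Sum.elim_inr, Matrix.cons_val]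
  · exact hYu
  · exact hx2
  · exact ((commute_fc (Commute.refl _) _).mul_right c1).eq
  · exact hv hcW hWu
  · exact ((hM (c3.sub_left (Commute.refl _))).mul_right ((commute_fc c3.symm _).mul_right c2)).eq
  · refine hMT (hM hcW) ?_
    rw [hX2W, map_neg]
    module
  · have := hv hcY (a := borelY _ _) (r := -Sh (G (.inl 1))) (by rw [hYu]; abel)
    rw [this]
    abel
  · exact h8
  · exact (((commute_fc c3.symm s).symm).mul_left c4).eq
  · exact hYW
  · exact hWu
  · exact hx2W
  · rw [← neg_smul, ← map_neg]
    exact hMT (hM hcY) hX2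
  · exact ((hM ((Commute.refl _).sub_left c3.symm)).mul_right
      ((commute_fc (Commute.refl _) _).mul_right c5)).eq
  · have hcx : Commute (G (.inl 1) - G (.inr 0)) (G (.inl 2)) := c1.sub_left c4.symm
    have hcu : Commute (G (.inl 1) - G (.inr 0)) (G (.inl 1)) := (Commute.refl _).sub_left c3.symm
    have hcT := (commute_fc hcu s).mul_right hcx
    have e : ∀ {f g : ℝ⟦X⟧} {a b : B}, Commute (G (.inl 1)) a → f * g = 1 →
        fc (G (.inl 1)) f * a * (fc (G (.inl 1)) g * b) = a * b := fun ha hfg => by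
      rw [mul_assoc, mul_left_comm_of_comm (commute_fc ha.symm _).eq, ← mul_assoc, fc_mul_fc, hfg,
        map_one, one_mul]
    rw [mul_left_comm_of_comm (hM hcT).eq, mul_assoc (fc (_ • _) _), e c1 hs1,
      e c5 (by rw [mul_comm, hs1]), h15, mul_add, Sh, (commute_fc (Commute.refl _) _).eq]

end DeformRelB

lemma RelB.op_twist {B : Type} [Ring B] [Algebra K B] [ZComplete B] [ZTorsionFree B] {κ : K}
    {G : Gen → B} (h : RelB κ G) : RelB κ fun g => MulOpposite.op
      (-(E (-twistB κ G g) * G g * E (twistB κ G g))) := by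
  have hg : ∀ g, E (-twistB κ G g) * G g * E (twistB κ G g) =
      G g + z • (Sum.elim ![Sh (G (.inl 1)), 0, 0] ![0, -Sh (G (.inr 0)), 0] g : B) := by
    have key : ∀ {a h c : B}, a * h = h * a + c → Commute c h → E (-h) * a * E h = a + z • c :=
      fun hah hc => by
        rw [mul_assoc, mul_E_of_comm hah hc, (commute_E hc).eq, mul_add, ← mul_assoc, mul_smul_comm,
          ← mul_assoc, E_neg_mul_E, one_mul, one_mul]
    obtain ⟨h1, h2, h3, h4, h5, h6, h7, h8, h9, h10, h11, h12, h13, h14, h15⟩ := h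
    intro g
    rcases g with i | i <;> fin_cases i
    · exact key h1 (commute_Sh (Commute.refl _)).symm
    · simp [twistB, E_zero]
    · refine key ?_ (Commute.zero_left _)
      simp [twistB, h3]
    · simp [twistB, E_zero]
    · refine key ?_ (commute_Sh (Commute.refl _)).symm.neg_left
      simp [twistB, h4]
    · refine key ?_ (Commute.zero_left _)
      simp [twistB, h5]
  simp only [hg]
  exact h.op

lemma map_twistB {A B : Type} [Ring A] [Algebra K A] [Ring B] [Algebra K B] (F : A →ₐ[K] B)
    (κ : K) (G : Gen → A) (g : Gen) :
    F (twistB κ G g) = twistB κ (fun g => F (G g)) g := by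
  rcases g with i | i <;> fin_cases i <;> simp [twistB]

lemma cocomm_bialgB {A : Type} [Ring A] [Algebra K A] (ρ : ℝ) (G H : Gen → A) (g : Gen) :
    ∑ a : Gen, ∑ b : Gen, (PowerSeries.C ((bialgB ρ).cocomm g a b) : K) • (G a * H b) =
      G g * twistB (PowerSeries.C ρ) H g - twistB (PowerSeries.C ρ) G g * H g := by
  rcases g with i | i <;> fin_cases i
  all_goals simp [LieBialgebra.cocomm, bialgB, r3, skewConst, Fin.sum_univ_three, twistB]
  all_goals try module

lemma coprod_quantumB (ρ : ℝ) (P : QuantumData) (g : Gen) :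
    Completion.of _ (Algebra.TensorProduct.map P.proj P.proj ((quantumB ρ).coprod g)) =
      twist (inl2 _) (inr2 _) (P.gen g) (twistB (PowerSeries.C ρ) P.gen g) := by
  rcases g with i | i <;> fin_cases i
  all_goals
    simp [quantumB, twist, twistB, coprod_tmul, -Algebra.TensorProduct.map_tmul, proj_expZ,
      wordLift_X, wordLift_x, wordLift_smul, map_E, proj_xz, proj_Xz, E_zero]

section

attribute [local instance] seriesAlgebra

attribute [local instance] LieRing.ofAssociativeRing

lemma constantCoeff_deformB {R : Type} [Ring R] [Algebra ℝ R] {κ : K} {s : ℝ⟦X⟧}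
    (hs : PowerSeries.constantCoeff s = 1) (G : Gen → R⟦X⟧) (g : Gen) :
    PowerSeries.constantCoeff (deformB κ s G g) = PowerSeries.constantCoeff (G g) := by
  rcases g with i | i <;> fin_cases i
  all_goals simp [deformB, borelY, borelW, Ch, constantCoeff_fc, constantCoeff_sinhcSeries,
    constantCoeff_coshSeries, hs, z_smul_series]

theorem isHopfQuantization_B (ρ : ℝ) : IsHopfQuantization (bialgB ρ) (quantumB ρ) := by
  obtain ⟨s, hs0, hs1, hs⟩ := exists_isSinhcPow ρ
  refine isHopfQuantization_of_deformingMap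
    (QuantumData.lift _ ((relB_iff ρ _).2 ((lieRelB_ueaGen ρ).deform hs hs1))) (fun g => ?_)
    ((((relB_gen ρ).map (RingCon.mkₐ K (zCon _ 1))).lieRel z_smul_level_one).evalDouble_lie)
    fun htf => ?_
  · rw [QuantumData.lift_gen, constantCoeff_deformB hs0]
    simp [ueaGen]
  · have h := relB_gen ρ
    refine exists_hopfData_of_twist (h := twistB (PowerSeries.C ρ) (quantumB ρ).gen)
      (fun g => ?_) ((relB_iff ρ _).2 (h.comul commute_inl2_inr2))
      ((relB_iff ρ _).2 (relB_zero _)) ((relB_iff ρ _).2 ?_) (coprod_quantumB ρ _)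
      fun g => ?_
    · rcases g with i | i <;> fin_cases i
      exacts [⟨1, .inl 1, (one_smul _ _).symm, rfl⟩, ⟨0, .inl 1, (zero_smul _ _).symm, rfl⟩,
        ⟨-PowerSeries.C ρ, .inl 1, (neg_smul _ _).symm, rfl⟩,
        ⟨0, .inl 1, (zero_smul _ _).symm, rfl⟩, ⟨1, .inr 0, (one_smul _ _).symm, rfl⟩,
        ⟨_, .inr 0, rfl, rfl⟩]
    · exact h.op_twist
    · rw [map_twistB, map_twistB, cocomm_bialgB]

end

/-! ## The double of the second `(𝔯₃(ρ), 𝔯₃(-ρ))` as a Lie algebra -/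

section SpecialLinear

open LieAlgebra.SpecialLinear

/-- The traceless matrix with given entries. -/
def slMatrix (a b c : ℝ) : sl (Fin 2) ℝ :=
  ⟨!![a, b; c, -a], by simp [sl, Matrix.trace_fin_two]⟩

lemma slMatrix_congr {a b c a' b' c' : ℝ} (ha : a = a') (hb : b = b') (hc : c = c') :
    slMatrix a b c = slMatrix a' b' c' := by rw [ha, hb, hc]

lemma slMatrix_add (a b c a' b' c' : ℝ) :
    slMatrix (a + a') (b + b') (c + c') = slMatrix a b c + slMatrix a' b' c' := by
  apply Subtype.ext
  ext i j; fin_cases i <;> fin_cases j <;> simp [slMatrix, add_comm]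

lemma slMatrix_smul (r a b c : ℝ) : slMatrix (r * a) (r * b) (r * c) = r • slMatrix a b c := by
  apply Subtype.ext
  ext i j; fin_cases i <;> fin_cases j <;> simp [slMatrix]

lemma slMatrix_lie (a b c a' b' c' : ℝ) : ⁅slMatrix a b c, slMatrix a' b' c'⁆ =
    slMatrix (b * c' - b' * c) (2 * (a * b' - a' * b)) (2 * (a' * c - a * c')) := by
  apply Subtype.ext
  change !![a, b; c, -a] * !![a', b'; c', -a'] - !![a', b'; c', -a'] * !![a, b; c, -a] = _
  ext i j
  fin_cases i <;> fin_cases j <;> simp [slMatrix] <;> ring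

lemma slMatrix_eta (m : sl (Fin 2) ℝ) : slMatrix (m.1 0 0) (m.1 0 1) (m.1 1 0) = m := by
  have h : m.1.trace = 0 := m.2
  rw [Matrix.trace_fin_two] at h
  apply Subtype.ext
  ext i j; fin_cases i <;> fin_cases j <;> simp [slMatrix]
  linarith

/-- The double as a sum of two copies of `𝔰𝔩₂`. -/
def doubleEquivSl {ρ l : ℝ} (hl : l ≠ 0) (hρ : ρ ≠ 0) :
    (bialgC ρ l).Double ≃ₗ⁅ℝ⁆ sl (Fin 2) ℝ × sl (Fin 2) ℝ where
  -- In the standard basis e, h, f the pairs x^1, X_1 and x^2, X_2 go to -l f, e in the first copy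
  -- and l ρ² f, e in the second. Then X_0 - l x^0 must go to (l h, 0) and ρ (X_0 + l x^0) to (0, -l
  -- ρ² h), which determines the images of x^0 and X_0.
  toFun u := (slMatrix ((l * u.2 0 - u.1 0) / 2) (u.2 1) (-(l * u.1 1)),
    slMatrix (-(ρ * (u.1 0 + l * u.2 0) / 2)) (u.2 2) (l * ρ ^ 2 * u.1 2))
  map_add' u v := by
    have h1 : ∀ i, (u + v).1 i = u.1 i + v.1 i := fun i => rfl
    have h2 : ∀ i, (u + v).2 i = u.2 i + v.2 i := fun i => rfl
    simp only [h1, h2]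
    refine Prod.ext ?_ ?_
    · refine (slMatrix_congr ?_ ?_ ?_).trans (slMatrix_add _ _ _ _ _ _) <;> ring
    · refine (slMatrix_congr ?_ ?_ ?_).trans (slMatrix_add _ _ _ _ _ _) <;> ring
  map_smul' r u := by
    have h1 : ∀ i, (r • u).1 i = r * u.1 i := fun i => rfl
    have h2 : ∀ i, (r • u).2 i = r * u.2 i := fun i => rfl
    simp only [h1, h2]
    refine Prod.ext ?_ ?_
    · refine (slMatrix_congr ?_ ?_ ?_).trans (slMatrix_smul r _ _ _) <;> ring
    · refine (slMatrix_congr ?_ ?_ ?_).trans (slMatrix_smul r _ _ _) <;> ring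
  map_lie' {u v} := by
    have hb : ⁅u, v⁆ = _ := doubleBracket_C ρ l u v
    rw [hb]
    refine Prod.ext ?_ ?_
    · refine (slMatrix_congr ?_ ?_ ?_).trans (slMatrix_lie _ _ _ _ _ _).symm <;> simp <;> ring
    · refine (slMatrix_congr ?_ ?_ ?_).trans (slMatrix_lie _ _ _ _ _ _).symm <;> simp <;> ring
  invFun m := (![-(m.1.1 0 0 + m.2.1 0 0 / ρ), -(m.1.1 1 0 / l), m.2.1 1 0 / (l * ρ ^ 2)],
    ![(m.1.1 0 0 - m.2.1 0 0 / ρ) / l, m.1.1 0 1, m.2.1 0 1])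
  left_inv u := by
    apply Prod.ext <;> funext i <;> fin_cases i <;> simp [slMatrix] <;> field_simp <;> ring
  right_inv m := by
    refine Prod.ext ((slMatrix_congr ?_ ?_ ?_).trans (slMatrix_eta m.1))
      ((slMatrix_congr ?_ ?_ ?_).trans (slMatrix_eta m.2)) <;> simp <;> field_simp <;> ring

end SpecialLinear

end QuantumDouble

theorem mainTheorem6 :
    (∀ ρ : ℝ, QuantumDouble.IsHopfQuantization
      (QuantumDouble.bialgA ρ) (QuantumDouble.quantumA ρ)) ∧
    (∀ ρ : ℝ, QuantumDouble.IsHopfQuantization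
      (QuantumDouble.bialgB ρ) (QuantumDouble.quantumB ρ)) ∧
    (∀ ρ l : ℝ, l ≠ 0 → QuantumDouble.IsHopfQuantization
      (QuantumDouble.bialgC ρ l) (QuantumDouble.quantumC ρ l)) ∧
    (∀ ρ l : ℝ, l ≠ 0 → ρ ≠ 0 → Nonempty
      ((QuantumDouble.bialgC ρ l).Double ≃ₗ⁅ℝ⁆
        LieAlgebra.SpecialLinear.sl (Fin 2) ℝ × LieAlgebra.SpecialLinear.sl (Fin 2) ℝ)) :=
  ⟨QuantumDouble.isHopfQuantization_A, QuantumDouble.isHopfQuantization_B,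
    fun ρ _ hl => QuantumDouble.isHopfQuantization_C ρ hl,
    fun _ _ hl hρ => ⟨QuantumDouble.doubleEquivSl hl hρ⟩⟩
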